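/- **Setting.** Let $n\ge 1$. On $L^2(\mathbb R^n)$ let $\hat R=(\hat x_1,\hat p_1,\dots,\hat x_n,\hat p_n)$ be the position and momentum operators, with $[\hat R_k,\hat R_l]=i(\Omega_n)_{kl}$ and $\Omega_n=\mathbb 1_n\otimes\begin{pmatrix}0&1\\-1&0\end{pmatrix}$. Let $\hat E_n=\tfrac12\hat R^\intercal\hat R$ be the energy operator. An $n$-mode state is a positive operator $\rho$ on $L^2(\mathbb R^n)$ with unit trace. Its first moment is $m(\rho)_k=\operatorname{Tr}[\rho\hat R_k]$ and its covariance matrix is $V(\rho)_{kl}=\operatorname{Tr}[\rho\{\hat R_k,\hat R_l\}]-2m(\rho)_km(\rho)_l$, where $\{A,B\}=AB+BA$. Let $\varepsilon,\delta\in(0,1)$ and $E\ge 0$, and set $$N'=\left\lceil 68\log\!\left(\frac{2(2n^2+3n)}{\delta}\right)\frac{200(8n^2E^2+3n)}{\varepsilon^2}\right\rceil,\qquad N=(n+3)N'.$$ **Algorithm.** On $N$ copies of $\rho$, carry out $n+3$ rounds. Each round uses $N'$ copies, and each copy is measured separately by a joint measurement of the following commuting observables: * round "position": all $\hat x_i$;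 * round "momentum": all $\hat p_i$; * round "dilation": all $\{\hat x_i,\hat p_i\}$; * for each $k\in\{1,\dots,n\}$, one round: $\hat p_k$ together with the $\hat x_i$, $i\neq k$. From the outcomes form median-of-means estimators with $\lceil 2\log(2(2n^2+3n)/\delta)\rceil$ bins of equal size, as follows. The first two rounds give the entries of a vector $\tilde m\in\mathbb R^{2n}$ (for the $\operatorname{Tr}[\rho\hat R_k]$). All rounds together give a symmetric matrix $\tilde W\in\mathbb R^{2n\times 2n}$ (for the $\operatorname{Tr}[\rho\{\hat R_k,\hat R_l\}]$): the entries for $\{\hat x_i,\hat x_j\}$ come from the position round, those for $\{\hat p_i,\hat p_j\}$ from the momentum round, those for $\{\hat x_i,\hat p_i\}$ from the dilation round, and those for $\{\hat p_k,\hat x_i\}$ with $i\ne k$ from the round of $k$; for two commuting quadratures the outcome of the anticommutator is twice the product of the two outcomes. Put $\tilde V'=\tilde W-2\tilde m\tilde m^\intercal+\frac{\varepsilon}{2}\mathbb 1$. If $\tilde V'+i\Omega_n\ge 0$, output $(\tilde m,\tilde V')$; otherwise declare failure. **Theorem.** There is a universal constant $C$ such that the following holds for all $n\ge1$, $\varepsilon,\delta\in(0,1)$,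 $E\ge0$ and every $n$-mode state $\rho$ with $\sqrt{\operatorname{Tr}[\hat E_n^2\rho]}\le nE$. If $n\ge2$, then $$N\le C\,\log\!\left(\frac{n^2}{\delta}\right)\frac{n^3E^2}{\varepsilon^2}.$$ Moreover, when the measurement outcomes are independent and distributed according to the Born rule, with probability at least $1-\delta$ the algorithm does not fail and outputs a vector $\tilde m$ and a symmetric matrix $\tilde V'$ with $$\|\tilde V'-V(\rho)\|_\infty\le\varepsilon,\qquad \tilde V'+i\Omega_n\ge0,\qquad \|\tilde m-m(\rho)\|_2\le\frac{\varepsilon}{10\sqrt{8En}},$$ where $\|\cdot\|_\infty$ is the largest singular value. -/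

import Mathlib

open MeasureTheory ProbabilityTheory
open scoped SchwartzMap ENNReal Kronecker ComplexOrder InnerProductSpace LineDeriv

noncomputable section

namespace CVTomo

/-! ### Hilbert space, quadratures, and operators on the Schwartz core -/

/-- Configuration space of `n` modes. -/
abbrev Conf (n : ℕ) : Type := EuclideanSpace ℝ (Fin n)

/-- The Hilbert space `L²(ℝⁿ)` of `n` modes. -/
abbrev HSpace (n : ℕ) : Type := Lp ℂ 2 (volume : Measure (Conf n))

/-- The Schwartz space `𝓢(ℝⁿ)`, the common invariant core of all operators below. -/
abbrev Core (n : ℕ) : Type := 𝓢(Conf n, ℂ)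

/-- Operators on the core (a ring under composition). -/
abbrev CoreOp (n : ℕ) : Type := Module.End ℂ (Core n)

/-- A Schwartz function as a vector of `L²(ℝⁿ)`. -/
def toL2 {n : ℕ} (φ : Core n) : HSpace n := φ.toLp 2 volume

/-- The position operator `(x̂ⱼ φ)(y) = yⱼ φ(y)`. -/
def positionOp {n : ℕ} (j : Fin n) : CoreOp n :=
  (SchwartzMap.smulLeftCLM ℂ (fun y : Conf n => ((y j : ℝ) : ℂ))).toLinearMap

/-- The momentum operator `p̂ⱼ φ = -i ∂ⱼ φ`. -/
def momentumOp {n : ℕ} (j : Fin n) : CoreOp n :=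
  (-Complex.I) •
    (LineDeriv.lineDerivOpCLM ℂ (Core n) (EuclideanSpace.single j (1 : ℝ) : Conf n)).toLinearMap

theorem positionOp_apply {n : ℕ} (j : Fin n) (φ : Core n) (y : Conf n) :
    positionOp j φ y = (y j : ℂ) * φ y := by
  have h1 : (fun y : Conf n => y j).HasTemperateGrowth :=
    (PiLp.proj 2 (fun _ : Fin n => ℝ) j : Conf n →L[ℝ] ℝ).hasTemperateGrowth
  have h : (fun y : Conf n => ((y j : ℝ) : ℂ)).HasTemperateGrowth := by fun_prop
  simp [positionOp, SchwartzMap.smulLeftCLM_apply_apply h]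

theorem momentumOp_apply {n : ℕ} (j : Fin n) (φ : Core n) (y : Conf n) :
    momentumOp j φ y =
      -Complex.I * lineDeriv ℝ φ y (EuclideanSpace.single j (1 : ℝ) : Conf n) := by
  rw [← SchwartzMap.lineDerivOp_apply]
  rfl

/-- Index set of the quadratures: `(j, 0)` stands for `x̂ⱼ` and `(j, 1)` for `p̂ⱼ`, so that the
lexicographic order is `(x̂₁, p̂₁, …, x̂ₙ, p̂ₙ)`. -/
abbrev QIdx (n : ℕ) : Type := Fin n × Fin 2

/-- The quadrature vector `R̂`. -/
def quad {n : ℕ} : QIdx n → CoreOp n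
  | (j, 0) => positionOp j
  | (j, 1) => momentumOp j

/-- The anticommutator `{A, B} = AB + BA`. -/
def anticomm {n : ℕ} (A B : CoreOp n) : CoreOp n := A * B + B * A

/-- The energy operator `Êₙ = ½ R̂ᵀ R̂ = ½ ∑ⱼ (x̂ⱼ² + p̂ⱼ²)`. -/
def energyOp (n : ℕ) : CoreOp n := (1 / 2 : ℂ) • ∑ k : QIdx n, quad k * quad k

/-- The symplectic form `Ωₙ = 𝟙ₙ ⊗ (0 1; -1 0)`. -/
def symplecticForm (n : ℕ) : Matrix (QIdx n) (QIdx n) ℝ :=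
  (1 : Matrix (Fin n) (Fin n) ℝ) ⊗ₖ !![0, 1; -1, 0]

/-- `IsValue A f g` says that `f` is in the domain of the adjoint of `A` (as a densely defined
operator with domain `𝓢(ℝⁿ)`) and that `g` is its value at `f`. The operators to which this is
applied (`R̂ₖ`, `{R̂ₖ, R̂ₗ}`, `Êₙ`) are essentially self-adjoint on `𝓢(ℝⁿ)`, so this adjoint is the
self-adjoint operator on `L²(ℝⁿ)` that the symbol denotes. The value `g` is unique, since
`𝓢(ℝⁿ)` is dense. -/
def IsValue {n : ℕ} (A : CoreOp n) (f g : HSpace n) : Prop :=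
  ∀ φ : Core n, ⟪toL2 (A φ), f⟫_ℂ = ⟪toL2 φ, g⟫_ℂ

open Classical in
/-- The value of (the self-adjoint extension of) `A` at `f`; zero outside the domain. -/
def opApply {n : ℕ} (A : CoreOp n) (f : HSpace n) : HSpace n :=
  if h : ∃ g, IsValue A f g then h.choose else 0

open Classical in
/-- `‖A f‖²`, with value `∞` outside the domain. -/
def opNormSq {n : ℕ} (A : CoreOp n) (f : HSpace n) : ℝ≥0∞ :=
  if ∃ g, IsValue A f g then ‖opApply A f‖ₑ ^ 2 else ⊤

/-! ### Quantum states and expectation values -/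

/-- A fixed orthonormal basis of `L²(ℝⁿ)`, used to write traces; none of the traces below depends
on the choice. -/
def onbIndex (n : ℕ) : Set (HSpace n) := (exists_hilbertBasis ℂ (HSpace n)).choose

def onb (n : ℕ) : HilbertBasis (onbIndex n) ℂ (HSpace n) :=
  (exists_hilbertBasis ℂ (HSpace n)).choose_spec.choose

/-- An `n`-mode quantum state: a positive operator on `L²(ℝⁿ)` with unit trace. -/
structure State (n : ℕ) where
  op : HSpace n →L[ℂ] HSpace n
  isPositive : op.IsPositive
  trace_eq_one : HasSum (fun i => ⟪onb n i, op (onb n i)⟫_ℂ) 1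

/-- The positive square root of a positive operator on a Hilbert space. -/
def opSqrt {H : Type*} [NormedAddCommGroup H] [InnerProductSpace ℂ H]
    [CompleteSpace H] (T : H →L[ℂ] H) : H →L[ℂ] H := CFC.sqrt T

namespace State

variable {n : ℕ}

/-- The vectors `√ρ eᵢ`; so `ρ = ∑ᵢ |√ρ eᵢ⟩⟨√ρ eᵢ|`. -/
def vec (ρ : State n) (i : onbIndex n) : HSpace n := opSqrt ρ.op (onb n i)

/-- `Tr[ρ U] = Tr[√ρ U √ρ]` for a bounded operator `U`. -/
def traceBounded (ρ : State n) (U : HSpace n → HSpace n) : ℂ :=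
  ∑' i, ⟪ρ.vec i, U (ρ.vec i)⟫_ℂ

/-- `Tr[ρ A] = Tr[√ρ A √ρ]` for an observable `A`. -/
def expect (ρ : State n) (A : CoreOp n) : ℝ :=
  (∑' i, ⟪ρ.vec i, opApply A (ρ.vec i)⟫_ℂ).re

/-- `Tr[ρ A²] = ‖A √ρ‖²` (squared Hilbert-Schmidt norm), in `[0, ∞]`. -/
def secondMoment (ρ : State n) (A : CoreOp n) : ℝ≥0∞ :=
  ∑' i, opNormSq A (ρ.vec i)

/-- The first moment `m(ρ)ₖ = Tr[ρ R̂ₖ]`. -/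
def mean (ρ : State n) : EuclideanSpace ℝ (QIdx n) :=
  WithLp.toLp 2 fun k => ρ.expect (quad k)

/-- The covariance matrix `V(ρ)ₖₗ = Tr[ρ {R̂ₖ, R̂ₗ}] - 2 m(ρ)ₖ m(ρ)ₗ`. -/
def cov (ρ : State n) : Matrix (QIdx n) (QIdx n) ℝ :=
  Matrix.of fun k l => ρ.expect (anticomm (quad k) (quad l)) - 2 * ρ.mean k * ρ.mean l

end State

/-! ### Joint measurement of commuting observables -/

/-- `U` is the strongly continuous unitary group `t ↦ exp(i ∑ⱼ tⱼ Aⱼ)` of the commuting observables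
`A₁, …, Aₘ`, given through its generators on the core. -/
structure IsJointUnitaryGroup {n m : ℕ} (A : Fin m → CoreOp n)
    (U : (Fin m → ℝ) → (HSpace n ≃ₗᵢ[ℂ] HSpace n)) : Prop where
  map_add : ∀ s t f, U (s + t) f = U s (U t f)
  continuous : ∀ f, Continuous fun t => U t f
  generator : ∀ (t : Fin m → ℝ) (φ : Core n),
    HasDerivAt (fun s : ℝ => U (s • t) (toL2 φ))
      (Complex.I • toL2 ((∑ j, (t j : ℂ) • A j) φ)) 0

/-- `μ` is the Born distribution of the outcome of a joint measurement of the commuting observables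
`A₁, …, Aₘ` on the state `ρ`: the probability measure on `ℝᵐ` with
`∫ exp(i t·a) dμ(a) = Tr[ρ exp(i ∑ⱼ tⱼ Aⱼ)]` for all `t`. -/
def IsBornLaw {n m : ℕ} (ρ : State n) (A : Fin m → CoreOp n) (μ : Measure (Fin m → ℝ)) : Prop :=
  IsProbabilityMeasure μ ∧
    ∃ U : (Fin m → ℝ) → (HSpace n ≃ₗᵢ[ℂ] HSpace n), IsJointUnitaryGroup A U ∧
      ∀ t : Fin m → ℝ,
        ∫ a, Complex.exp (Complex.I * ((∑ j, t j * a j : ℝ) : ℂ)) ∂μ = ρ.traceBounded (U t)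

/-! ### The estimation algorithm -/

/-- The `n + 3` rounds of measurements. -/
inductive Round (n : ℕ) : Type
  | position : Round n
  | momentum : Round n
  | dilation : Round n
  | mixed (k : Fin n) : Round n

/-- The `n` commuting observables that are jointly measured in a round: all `x̂ᵢ`; all `p̂ᵢ`; all
`{x̂ᵢ, p̂ᵢ}`; and, in the round of `k`, `p̂ₖ` together with the `x̂ᵢ` for `i ≠ k`. -/
def Round.observables {n : ℕ} : Round n → Fin n → CoreOp n
  | .position, i => positionOp i
  | .momentum, i => momentumOp i
  | .dilation, i => anticomm (positionOp i) (momentumOp i)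
  | .mixed k, i => if i = k then momentumOp k else positionOp i

/-- The number of copies measured in each round. -/
def roundSize (n : ℕ) (E ε δ : ℝ) : ℕ :=
  ⌈68 * Real.log (2 * (2 * (n : ℝ) ^ 2 + 3 * n) / δ)
    * (200 * (8 * (n : ℝ) ^ 2 * E ^ 2 + 3 * n) / ε ^ 2)⌉₊

/-- The total number of copies. -/
def numCopies (n : ℕ) (E ε δ : ℝ) : ℕ := (n + 3) * roundSize n E ε δ

/-- The copies: each round uses `roundSize` of them. -/
abbrev Copy (n : ℕ) (E ε δ : ℝ) : Type := Round n × Fin (roundSize n E ε δ)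

/-- The number of bins of the median-of-means estimators. -/
def numBins (n : ℕ) (δ : ℝ) : ℕ := ⌈2 * Real.log (2 * (2 * (n : ℝ) ^ 2 + 3 * n) / δ)⌉₊

/-- The median of `K` real numbers (the mean of the two middle ones if `K` is even). -/
def median {K : ℕ} (x : Fin K → ℝ) : ℝ :=
  if h : 0 < K then
    (x (Tuple.sort x ⟨(K - 1) / 2, by omega⟩) + x (Tuple.sort x ⟨K / 2, by omega⟩)) / 2
  else 0

theorem bin_lt {N K : ℕ} (l : Fin K) (j : Fin (N / K)) : (l : ℕ) * (N / K) + j < N :=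
  calc (l : ℕ) * (N / K) + j < l * (N / K) + N / K := by omega
    _ = (l + 1) * (N / K) := by ring
    _ ≤ K * (N / K) := Nat.mul_le_mul_right _ l.2
    _ ≤ N := Nat.mul_div_le N K

/-- The median of means: the samples are cut into `K` consecutive bins of size `⌊N / K⌋` (fewer than
`K` remaining samples are not used), and the median of the `K` bin averages is taken. -/
def medianOfMeans {N : ℕ} (K : ℕ) (Y : Fin N → ℝ) : ℝ :=
  median fun l : Fin K =>
    (∑ j : Fin (N / K), Y ⟨(l : ℕ) * (N / K) + j, bin_lt l j⟩) / ((N / K : ℕ) : ℝ)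

/-- The estimator of `m(ρ)`, from the outcomes `Y r s i` of the `i`-th observable on the `s`-th copy
of round `r`. -/
def estMean {n N : ℕ} (K : ℕ) (Y : Round n → Fin N → Fin n → ℝ) : EuclideanSpace ℝ (QIdx n) :=
  WithLp.toLp 2 fun
    | (i, 0) => medianOfMeans K fun s => Y .position s i
    | (i, 1) => medianOfMeans K fun s => Y .momentum s i

/-- The estimator of `Tr[ρ {R̂ₖ, R̂ₗ}]`; for commuting quadratures the outcome of `{R̂ₖ, R̂ₗ}` is twice
the product of the outcomes. -/
def estSecond {n N : ℕ} (K : ℕ) (Y : Round n → Fin N → Fin n → ℝ) :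
    Matrix (QIdx n) (QIdx n) ℝ :=
  Matrix.of fun
    | (i, 0), (j, 0) => medianOfMeans K fun s => 2 * (Y .position s i * Y .position s j)
    | (i, 1), (j, 1) => medianOfMeans K fun s => 2 * (Y .momentum s i * Y .momentum s j)
    | (i, 0), (j, 1) =>
      if i = j then medianOfMeans K fun s => Y .dilation s i
      else medianOfMeans K fun s => 2 * (Y (.mixed j) s i * Y (.mixed j) s j)
    | (i, 1), (j, 0) =>
      if i = j then medianOfMeans K fun s => Y .dilation s i
      else medianOfMeans K fun s => 2 * (Y (.mixed i) s j * Y (.mixed i) s i)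

/-- The matrix `Ṽ' = W̃ - 2 m̃ m̃ᵀ + (ε/2) 𝟙`. -/
def estCov {n N : ℕ} (K : ℕ) (ε : ℝ) (Y : Round n → Fin N → Fin n → ℝ) :
    Matrix (QIdx n) (QIdx n) ℝ :=
  estSecond K Y - (2 : ℝ) • Matrix.vecMulVec (estMean K Y) (estMean K Y) + (ε / 2) • 1

/-- The uncertainty relation `V + iΩₙ ≥ 0`. -/
def Uncertainty {n : ℕ} (V : Matrix (QIdx n) (QIdx n) ℝ) : Prop :=
  (V.map Complex.ofReal + Complex.I • (symplecticForm n).map Complex.ofReal).PosSemidef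

open Classical in
/-- The output of the algorithm: the pair `(m̃, Ṽ')`, or `none` (failure) if `Ṽ' + iΩₙ` is not
positive semidefinite. -/
def algorithm (n : ℕ) (E ε δ : ℝ) (Y : Round n → Fin (roundSize n E ε δ) → Fin n → ℝ) :
    Option (EuclideanSpace ℝ (QIdx n) × Matrix (QIdx n) (QIdx n) ℝ) :=
  if Uncertainty (estCov (numBins n δ) ε Y) then
    some (estMean (numBins n δ) Y, estCov (numBins n δ) ε Y)
  else none

/-- The largest singular value of a real matrix. -/
def opNorm {ι : Type} [Fintype ι] [DecidableEq ι] (A : Matrix ι ι ℝ) : ℝ :=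
  ‖Matrix.toEuclideanCLM (𝕜 := ℝ) A‖

end CVTomo

end

noncomputable section

namespace CVTomo

/-! ### Algebra of the quadratures on the Schwartz core -/

section CoreAlgebra

variable {n : ℕ}

/-! Each entry of `estMean` and `estSecond` is a median of means of independent samples, so its
squared error is governed by the second moment of the observable it estimates. The point is that
these second moments are controlled jointly. On the core, ∑ₖₗ ‖R̂ₖR̂ₗφ‖² = 4‖Êφ‖² + 2n‖φ‖² holds
exactly (`sum_norm_sq_quad_quad`), because Ê is half the sum of the R̂ₖ² and [Ê, R̂ₗ] is linear in
the quadratures. Hence the second moments of all anticommutators together sum to at most 16n²E² +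
8n, and those of the quadratures to at most 2nE. Letting each entry have an error proportional to
its own standard deviation, rather than a uniform one, makes the squared Frobenius error of
`estSecond` a sum of second moments divided by the sample size. This is why order n²E²/ε² copies per
round are enough.

The hypothesis only says that the vectors √ρ eᵢ lie in the domain of Ê, so the identities must be
carried from the core to that domain. The spaces obtained from the Gaussian by at most m quadratures
are finite dimensional, invariant under Ê, and have dense union. Projecting onto them approximates
every vector of the domain in the graph norm of Ê by core vectors (`exists_core_tendsto_energy`),
and the values of quadratures and their products then converge as well.

A Born law is known only through its characteristic function. That function makes trigonometric
polynomials in L²(μ) isometric to the corresponding combinations of the unitaries U(t) applied to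
√ρ. Difference quotients (exp(is aⱼ) − 1)/s tend to i aⱼ on one side and to i Aⱼ√ρ on the other;
Fatou bounds the second moments, and dominated convergence identifies the means.

For the output, V(ρ) + iΩ is a Gram matrix of the centred vectors (R̂ₖ − mₖ)√ρ eᵢ, hence positive
semidefinite. When the estimators are accurate, W̃ − 2m̃m̃ᵀ is within ε/2 of V(ρ) in norm; adding
(ε/2)𝟙 makes the result dominate V(ρ), so the uncertainty relation survives and the error stays
below ε. -/

/-- The embedding of the core into `L²(ℝⁿ)` as a linear map. -/
def toL2Lin (n : ℕ) : Core n →ₗ[ℂ] HSpace n :=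
  (SchwartzMap.toLpCLM ℂ ℂ 2 (volume : Measure (Conf n))).toLinearMap

theorem toL2Lin_apply (φ : Core n) : toL2Lin n φ = toL2 φ := rfl

@[simp] theorem toL2_add (φ ψ : Core n) : toL2 (φ + ψ) = toL2 φ + toL2 ψ := map_add (toL2Lin n) φ ψ
@[simp] theorem toL2_sub (φ ψ : Core n) : toL2 (φ - ψ) = toL2 φ - toL2 ψ := map_sub (toL2Lin n) φ ψ
@[simp] theorem toL2_smul (c : ℂ) (φ : Core n) : toL2 (c • φ) = c • toL2 φ :=
  map_smul (toL2Lin n) c φ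
@[simp] theorem toL2_sum {ι : Type*} (s : Finset ι) (φ : ι → Core n) :
    toL2 (∑ i ∈ s, φ i) = ∑ i ∈ s, toL2 (φ i) := map_sum (toL2Lin n) φ s

theorem denseRange_toL2 : DenseRange (toL2 : Core n → HSpace n) :=
  SchwartzMap.denseRange_toLpCLM (F := ℂ) (μ := (volume : Measure (Conf n))) (by simp)

theorem inner_toL2 (φ ψ : Core n) :
    ⟪toL2 φ, toL2 ψ⟫_ℂ = ∫ x, (starRingEnd ℂ) (φ x) * ψ x := by
  have h := SchwartzMap.inner_toL2_toL2_eq φ ψ (volume : Measure (Conf n))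
  refine h.trans (integral_congr_ae (Filter.Eventually.of_forall fun x => ?_))
  simp [mul_comm]

/-! ### Symmetry and canonical commutation relations. -/

theorem positionOp_symm (j : Fin n) (φ ψ : Core n) :
    ⟪toL2 (positionOp j φ), toL2 ψ⟫_ℂ = ⟪toL2 φ, toL2 (positionOp j ψ)⟫_ℂ := by
  rw [inner_toL2, inner_toL2]
  congr 1; ext x
  rw [positionOp_apply, positionOp_apply]
  simp; ring

theorem momentumOp_eq (j : Fin n) (φ : Core n) :
    momentumOp j φ = (-Complex.I) • ∂_{(EuclideanSpace.single j (1 : ℝ) : Conf n)} φ := rfl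

/-- Integration by parts; the sign it produces is cancelled by conjugating the factor -i. -/
theorem momentumOp_symm (j : Fin n) (φ ψ : Core n) :
    ⟪toL2 (momentumOp j φ), toL2 ψ⟫_ℂ = ⟪toL2 φ, toL2 (momentumOp j ψ)⟫_ℂ := by
  have h := SchwartzMap.integral_bilinear_lineDerivOp_right_eq_neg_left
    (μ := (volume : Measure (Conf n))) φ ψ
    ((ContinuousLinearMap.mul ℝ ℂ).comp (Complex.conjCLE : ℂ →L[ℝ] ℂ))
    (EuclideanSpace.single j (1 : ℝ) : Conf n)
  simp only [ContinuousLinearMap.comp_apply, ContinuousLinearMap.mul_apply',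
    ContinuousLinearEquiv.coe_coe, Complex.conjCLE_apply] at h
  rw [momentumOp_eq, momentumOp_eq, toL2_smul, toL2_smul, inner_smul_left, inner_smul_right,
    inner_toL2, inner_toL2, h]
  simp

theorem quad_symm (k : QIdx n) (φ ψ : Core n) :
    ⟪toL2 (quad k φ), toL2 ψ⟫_ℂ = ⟪toL2 φ, toL2 (quad k ψ)⟫_ℂ := by
  obtain ⟨j, s⟩ := k
  fin_cases s
  · exact positionOp_symm j φ ψ
  · exact momentumOp_symm j φ ψ

theorem positionOp_comm (i j : Fin n) (φ : Core n) :
    positionOp i (positionOp j φ) = positionOp j (positionOp i φ) := by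
  ext y
  simp only [positionOp_apply]
  ring

theorem lineDerivOp_lineDerivOp_comm (v w : Conf n) (φ : Core n) :
    ∂_{v} (∂_{w} φ) = ∂_{w} (∂_{v} φ) := by
  have key : ∀ (v w : Conf n) (x : Conf n),
      (∂_{v} (∂_{w} φ)) x = iteratedFDeriv ℝ 2 φ x ![v, w] := by
    intro v w x
    rw [← SchwartzMap.iteratedLineDerivOp_eq_iteratedFDeriv]
    simp [LineDeriv.iteratedLineDerivOp_succ_left]
  ext x
  rw [key, key]
  have h : IsSymmSndFDerivAt ℝ φ x :=
    ((φ.smooth 2).contDiffAt (x := x)).isSymmSndFDerivAt (by simp)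
  rw [iteratedFDeriv_two_apply, iteratedFDeriv_two_apply]
  exact h v w

theorem momentumOp_comm (i j : Fin n) (φ : Core n) :
    momentumOp i (momentumOp j φ) = momentumOp j (momentumOp i φ) := by
  simp only [momentumOp_eq, LineDeriv.lineDerivOp_smul]
  rw [lineDerivOp_lineDerivOp_comm]

theorem lineDeriv_eq_fderiv (φ : Core n) (x v : Conf n) : lineDeriv ℝ φ x v = fderiv ℝ φ x v :=
  ((φ.smooth 1).differentiable (by norm_num) x).lineDeriv_eq_fderiv

theorem position_momentum_comm (i j : Fin n) (φ : Core n) :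
    positionOp i (momentumOp j φ) - momentumOp j (positionOp i φ)
      = (if i = j then Complex.I else 0) • φ := by
  ext y
  have h1 : HasFDerivAt (fun y : Conf n => ((y i : ℝ) : ℂ))
      (Complex.ofRealCLM.comp (PiLp.proj 2 (fun _ : Fin n => ℝ) i : Conf n →L[ℝ] ℝ)) y :=
    (Complex.ofRealCLM.comp (PiLp.proj 2 (fun _ : Fin n => ℝ) i : Conf n →L[ℝ] ℝ)).hasFDerivAt
  have h2 : HasFDerivAt φ (fderiv ℝ φ y) y :=
    ((φ.smooth 1).differentiable (by norm_num) y).hasFDerivAt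
  have h3 := h1.mul h2
  have h4 : (positionOp i φ : Conf n → ℂ) = (fun y : Conf n => ((y i : ℝ) : ℂ)) * φ :=
    funext fun y => positionOp_apply i φ y
  simp only [sub_apply, smul_apply, positionOp_apply, momentumOp_apply,
    lineDeriv_eq_fderiv]
  rw [h4, h3.fderiv]
  by_cases hij : i = j
  · simp [hij]; ring
  · simp [hij]; ring

theorem quad_comm (k l : QIdx n) (φ : Core n) :
    quad k (quad l φ) - quad l (quad k φ) = (Complex.I * symplecticForm n k l) • φ := by
  obtain ⟨i, s⟩ := k
  obtain ⟨j, t⟩ := l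
  fin_cases s <;> fin_cases t
  · simp [quad, positionOp_comm i j, symplecticForm]
  · simp [quad, position_momentum_comm, symplecticForm, Matrix.one_apply]
    split_ifs <;> simp
  · have := position_momentum_comm j i φ
    have h2 : momentumOp i (positionOp j φ) - positionOp j (momentumOp i φ)
      = -((if j = i then Complex.I else 0) • φ) := by rw [← this]; abel
    simp [quad, symplecticForm, Matrix.one_apply, h2, eq_comm]
    split_ifs <;> simp
  · simp [quad, momentumOp_comm i j, symplecticForm]

/-! ### Energy identities and bounds on the core. -/

theorem energyOp_apply (φ : Core n) : energyOp n φ = (1 / 2 : ℂ) • ∑ k, quad k (quad k φ) := by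
  simp [energyOp, LinearMap.sum_apply]

theorem sum_inner_quad (φ ψ : Core n) :
    ∑ k, ⟪toL2 (quad k φ), toL2 (quad k ψ)⟫_ℂ = 2 * ⟪toL2 φ, toL2 (energyOp n ψ)⟫_ℂ := by
  rw [energyOp_apply, toL2_smul, toL2_sum, inner_smul_right, inner_sum]
  simp only [quad_symm]
  ring

theorem energyOp_symm (φ ψ : Core n) :
    ⟪toL2 (energyOp n φ), toL2 ψ⟫_ℂ = ⟪toL2 φ, toL2 (energyOp n ψ)⟫_ℂ := by
  rw [energyOp_apply, energyOp_apply, toL2_smul, toL2_sum, toL2_smul, toL2_sum, inner_smul_right,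
    inner_sum, inner_smul_left, sum_inner]
  simp only [quad_symm]
  simp [map_ofNat (starRingEnd ℂ) 2]

theorem symplecticForm_antisymm (k l : QIdx n) :
    symplecticForm n k l = -symplecticForm n l k := by
  obtain ⟨i, s⟩ := k
  obtain ⟨j, t⟩ := l
  fin_cases s <;> fin_cases t <;> simp [symplecticForm, Matrix.one_apply, eq_comm]

theorem sum_symplecticForm_sq : ∑ k, ∑ l, symplecticForm n k l ^ 2 = 2 * n := by
  simp [symplecticForm, Fintype.sum_prod_type, Matrix.one_apply]
  ring

/-- Moving R̂ₖ leftwards through R̂ₗ² produces the same central commutator twice, which cancels the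
½ in the energy. So the commutator of the energy with a quadrature is again linear in quadratures.
-/
theorem energyOp_quad (k : QIdx n) (φ : Core n) :
    energyOp n (quad k φ)
      = quad k (energyOp n φ) + ∑ l, (Complex.I * symplecticForm n l k) • quad l φ := by
  have key : ∀ l, quad l (quad l (quad k φ)) = quad k (quad l (quad l φ))
      + (2 : ℂ) • ((Complex.I * symplecticForm n l k) • quad l φ) := by
    intro l
    have h1 := eq_add_of_sub_eq (quad_comm l k φ)
    have h2 := eq_add_of_sub_eq (quad_comm l k (quad l φ))
    rw [h1, map_add, map_smul, h2, two_smul]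
    abel
  rw [energyOp_apply, energyOp_apply, map_smul, map_sum]
  simp_rw [key]
  rw [Finset.sum_add_distrib, ← Finset.smul_sum, smul_add, smul_smul]
  simp

/-- Antisymmetry of Ω keeps only the commutator part of the inner products; each commutator is again
an entry of Ω, and the squares of the entries sum to 2n. -/
theorem sum_symplecticForm_inner (φ : Core n) :
    ∑ l, ∑ m, (symplecticForm n m l : ℂ) * ⟪toL2 (quad l φ), toL2 (quad m φ)⟫_ℂ
      = -(Complex.I * n * (‖toL2 φ‖ : ℂ) ^ 2) := by
  set S := ∑ l, ∑ m, (symplecticForm n m l : ℂ) * ⟪toL2 (quad l φ), toL2 (quad m φ)⟫_ℂ with hS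
  have h1 : S = ∑ l, ∑ m, -(symplecticForm n m l : ℂ) * ⟪toL2 (quad m φ), toL2 (quad l φ)⟫_ℂ := by
    rw [hS, Finset.sum_comm]
    refine Finset.sum_congr rfl fun l _ => Finset.sum_congr rfl fun m _ => ?_
    rw [symplecticForm_antisymm l m]
    simp
  have h2 : S + S = ∑ l, ∑ m, -(Complex.I * (symplecticForm n m l : ℂ) ^ 2
      * (‖toL2 φ‖ : ℂ) ^ 2) := by
    refine (congrArg₂ (· + ·) hS h1).trans ?_
    rw [← Finset.sum_add_distrib]
    refine Finset.sum_congr rfl fun l _ => ?_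
    rw [← Finset.sum_add_distrib]
    refine Finset.sum_congr rfl fun m _ => ?_
    rw [quad_symm, quad_symm]
    have h3 := quad_comm l m φ
    have h4 : ⟪toL2 φ, toL2 (quad l (quad m φ))⟫_ℂ - ⟪toL2 φ, toL2 (quad m (quad l φ))⟫_ℂ
        = (Complex.I * symplecticForm n l m) * (‖toL2 φ‖ : ℂ) ^ 2 := by
      rw [← inner_sub_right, ← toL2_sub, h3, toL2_smul, inner_smul_right,
        inner_self_eq_norm_sq_to_K]
      rfl
    rw [symplecticForm_antisymm l m] at h4
    push_cast at h4
    linear_combination (symplecticForm n m l : ℂ) * h4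
  have h5 : (∑ l, ∑ m, (symplecticForm n m l : ℂ) ^ 2) = 2 * n := by
    rw [Finset.sum_comm]
    exact_mod_cast sum_symplecticForm_sq (n := n)
  have h6 : ∑ l, ∑ m, -(Complex.I * (symplecticForm n m l : ℂ) ^ 2 * (‖toL2 φ‖ : ℂ) ^ 2)
      = -(Complex.I * (∑ l, ∑ m, (symplecticForm n m l : ℂ) ^ 2) * (‖toL2 φ‖ : ℂ) ^ 2) := by
    simp [Finset.mul_sum, Finset.sum_mul]
  rw [h6, h5] at h2
  linear_combination h2 / 2

/-- For fixed l, the sum over k is twice the energy form at R̂ₗφ. Commuting the energy past R̂ₗ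
leaves ⟨R̂ₗφ, R̂ₗÊφ⟩, which sums over l to twice ‖Êφ‖², and a commutator term whose sum is the
zero-point contribution 2n‖φ‖². -/
theorem sum_norm_sq_quad_quad (φ : Core n) :
    ∑ k, ∑ l, ‖toL2 (quad k (quad l φ))‖ ^ 2
      = 4 * ‖toL2 (energyOp n φ)‖ ^ 2 + 2 * n * ‖toL2 φ‖ ^ 2 := by
  have h : ((∑ k, ∑ l, ‖toL2 (quad k (quad l φ))‖ ^ 2 : ℝ) : ℂ)
      = ((4 * ‖toL2 (energyOp n φ)‖ ^ 2 + 2 * n * ‖toL2 φ‖ ^ 2 : ℝ) : ℂ) := by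
    rw [Finset.sum_comm]
    push_cast
    have h1 : ∀ ψ : Core n, ((‖toL2 ψ‖ : ℂ)) ^ 2 = ⟪toL2 ψ, toL2 ψ⟫_ℂ := fun ψ => by
      rw [inner_self_eq_norm_sq_to_K]; rfl
    have h2 : ∀ l, ∑ k, ((‖toL2 (quad k (quad l φ))‖ : ℂ)) ^ 2
        = 2 * ⟪toL2 (quad l φ), toL2 (quad l (energyOp n φ))⟫_ℂ + 2 * Complex.I *
          ∑ m, (symplecticForm n m l : ℂ) * ⟪toL2 (quad l φ), toL2 (quad m φ)⟫_ℂ := by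
      intro l
      simp_rw [h1]
      rw [sum_inner_quad, energyOp_quad, toL2_add, toL2_sum, inner_add_right, inner_sum, mul_add,
        Finset.mul_sum, Finset.mul_sum]
      congr 1
      refine Finset.sum_congr rfl fun m _ => ?_
      rw [toL2_smul, inner_smul_right]
      ring
    rw [Finset.sum_congr rfl fun l _ => h2 l, Finset.sum_add_distrib, ← Finset.mul_sum,
      ← Finset.mul_sum, sum_inner_quad, sum_symplecticForm_inner, ← energyOp_symm, ← h1]
    linear_combination (-2 * n * (‖toL2 φ‖ : ℂ) ^ 2) * Complex.I_sq
  exact_mod_cast h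

theorem sum_norm_sq_quad (φ : Core n) :
    ∑ k, ‖toL2 (quad k φ)‖ ^ 2 = 2 * (⟪toL2 φ, toL2 (energyOp n φ)⟫_ℂ).re := by
  have h := congrArg Complex.re (sum_inner_quad φ φ)
  simp only [Complex.re_sum, inner_self_eq_norm_sq_to_K] at h
  have h2 : ∀ x : ℝ, ((x : ℂ) ^ 2).re = x ^ 2 := fun x => by
    rw [← Complex.ofReal_pow, Complex.ofReal_re]
  simpa [h2] using h

theorem sum_norm_sq_quad_le (φ : Core n) :
    ∑ k, ‖toL2 (quad k φ)‖ ^ 2 ≤ 2 * (‖toL2 φ‖ * ‖toL2 (energyOp n φ)‖) := by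
  rw [sum_norm_sq_quad]
  gcongr
  exact (Complex.re_le_norm _).trans (norm_inner_le_norm _ _)

/-- Heisenberg's inequality mode by mode: [x̂ⱼ, p̂ⱼ] = i gives ‖φ‖² ≤ 2‖x̂ⱼφ‖‖p̂ⱼφ‖ ≤ ‖x̂ⱼφ‖² +
‖p̂ⱼφ‖². -/
theorem le_sum_norm_sq_quad (φ : Core n) :
    n * ‖toL2 φ‖ ^ 2 ≤ ∑ k, ‖toL2 (quad k φ)‖ ^ 2 := by
  have h : ∀ j : Fin n, ‖toL2 φ‖ ^ 2 ≤ ∑ s : Fin 2, ‖toL2 (quad (j, s) φ)‖ ^ 2 := by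
    intro j
    rw [Fin.sum_univ_two]
    have h1 := quad_comm (j, 0) (j, 1) φ
    have h2 : ⟪toL2 (quad (j, 0) φ), toL2 (quad (j, 1) φ)⟫_ℂ
        - ⟪toL2 (quad (j, 1) φ), toL2 (quad (j, 0) φ)⟫_ℂ = Complex.I * (‖toL2 φ‖ : ℂ) ^ 2 := by
      rw [quad_symm, quad_symm, ← inner_sub_right, ← toL2_sub, h1, toL2_smul, inner_smul_right,
        inner_self_eq_norm_sq_to_K]
      simp [symplecticForm]
    have h3 : ‖toL2 φ‖ ^ 2 = ‖Complex.I * (‖toL2 φ‖ : ℂ) ^ 2‖ := by simp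
    rw [h3, ← h2]
    refine (norm_sub_le _ _).trans ?_
    have h4 := norm_inner_le_norm (𝕜 := ℂ) (toL2 (quad (j, 0) φ)) (toL2 (quad (j, 1) φ))
    have h5 := norm_inner_le_norm (𝕜 := ℂ) (toL2 (quad (j, 1) φ)) (toL2 (quad (j, 0) φ))
    nlinarith [sq_nonneg (‖toL2 (quad (j, 0) φ)‖ - ‖toL2 (quad (j, 1) φ)‖)]
  rw [Fintype.sum_prod_type]
  calc (n : ℝ) * ‖toL2 φ‖ ^ 2 = ∑ _j : Fin n, ‖toL2 φ‖ ^ 2 := by simp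
    _ ≤ _ := Finset.sum_le_sum fun j _ => h j

end CoreAlgebra

end CVTomo

end

noncomputable section

namespace CVTomo

/-! ### Gaussians and the density of Gaussians times polynomials -/

section Gaussian

open scoped Nat FourierTransform
open Filter Topology

theorem iteratedDeriv_exp_neg_mul (a : ℝ) (i : ℕ) :
    iteratedDeriv i (fun u : ℝ => (Real.exp (-(a * u)) : ℂ))
      = fun u => (-(a : ℂ)) ^ i * (Real.exp (-(a * u)) : ℂ) := by
  induction i with
  | zero => simp
  | succ i ih =>
    rw [iteratedDeriv_succ, ih]
    funext u
    have h : HasDerivAt (fun u : ℝ => Real.exp (-(a * u))) (Real.exp (-(a * u)) * -(a * 1)) u :=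
      (((hasDerivAt_id u).const_mul a).neg).exp
    rw [(h.ofReal_comp.const_mul _).deriv]
    push_cast
    ring

/-- The power is at most N! exp(1 + r), and completing the square bounds r − a r² by 1/(4a). -/
theorem one_add_pow_mul_exp_le {a : ℝ} (ha : 0 < a) (N : ℕ) :
    ∃ K : ℝ, ∀ r : ℝ, 0 ≤ r → (1 + r) ^ N * Real.exp (-(a * r ^ 2)) ≤ K := by
  refine ⟨N ! * Real.exp (1 + 1 / (4 * a)), fun r hr => ?_⟩
  have h1 : (1 + r) ^ N ≤ N ! * Real.exp (1 + r) := by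
    have := Real.pow_div_factorial_le_exp (1 + r) (by positivity) N
    rw [div_le_iff₀ (by positivity)] at this
    linarith
  have h2 : 1 + r + -(a * r ^ 2) ≤ 1 + 1 / (4 * a) := by
    have : 0 ≤ (2 * a * r - 1) ^ 2 / (4 * a) := by positivity
    have h3 : (2 * a * r - 1) ^ 2 / (4 * a) = a * r ^ 2 - r + 1 / (4 * a) := by
      field_simp; ring
    linarith
  calc (1 + r) ^ N * Real.exp (-(a * r ^ 2)) ≤ N ! * Real.exp (1 + r) * Real.exp (-(a * r ^ 2)) := by
        gcongr
    _ = N ! * Real.exp (1 + r + -(a * r ^ 2)) := by rw [Real.exp_add (1 + r)]; ring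
    _ ≤ _ := by gcongr

/-- The Gaussian `exp (-a ‖x‖²)` as a Schwartz function. -/
def gaussianCore (n : ℕ) (a : ℝ) (ha : 0 < a) : Core n where
  toFun x := (Real.exp (-(a * ‖x‖ ^ 2)) : ℂ)
  smooth' := by
    have h : ContDiff ℝ (⊤ : ℕ∞) (fun x : Conf n => Real.exp (-(a * ‖x‖ ^ 2))) :=
      ((contDiff_const.mul (contDiff_norm_sq ℝ)).neg).exp
    exact Complex.ofRealCLM.contDiff.comp h
  decay' := by
    intro m k
    obtain ⟨l, C, hC0, hC⟩ := (Function.hasTemperateGrowth_norm_sq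
      (H := Conf n)).norm_iteratedFDeriv_le_uniform k
    obtain ⟨K, hK⟩ := one_add_pow_mul_exp_le ha (m + l * k)
    refine ⟨k ! * (1 + a) ^ k * (1 + C) ^ k * K, fun x => ?_⟩
    have hg : ContDiff ℝ (⊤ : ℕ∞) (fun u : ℝ => (Real.exp (-(a * u)) : ℂ)) :=
      Complex.ofRealCLM.contDiff.comp (contDiff_const.mul contDiff_id).neg.exp
    -- The chain-rule bound below wants derivatives of order i controlled by Dⁱ. Enlarging C to 1 +
    -- C makes D at least 1, so that D ≤ Dⁱ for i ≥ 1.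
    have hf : ContDiff ℝ (⊤ : ℕ∞) (fun x : Conf n => ‖x‖ ^ 2) := contDiff_norm_sq ℝ
    have h1 := norm_iteratedFDeriv_comp_le (n := k) hg hf (by exact_mod_cast le_top) x
      (C := (1 + a) ^ k * Real.exp (-(a * ‖x‖ ^ 2))) (D := (1 + C) * (1 + ‖x‖) ^ l)
      (fun i hi => by
        rw [norm_iteratedFDeriv_eq_norm_iteratedDeriv, iteratedDeriv_exp_neg_mul, norm_mul,
          norm_pow, norm_neg, Complex.norm_real, Complex.norm_real, Real.norm_of_nonneg ha.le,
          Real.norm_of_nonneg (Real.exp_pos _).le]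
        gcongr
        calc a ^ i ≤ (1 + a) ^ i := by gcongr; linarith
          _ ≤ (1 + a) ^ k := pow_le_pow_right₀ (by linarith) hi)
      (fun i hi1 hi => by
        refine (hC i hi x).trans ?_
        have h2 : C * (1 + ‖x‖) ^ l ≤ (1 + C) * (1 + ‖x‖) ^ l := by gcongr; linarith
        refine h2.trans (le_self_pow₀ ?_ (by omega))
        exact one_le_mul_of_one_le_of_one_le (by linarith)
          (one_le_pow₀ (by linarith [norm_nonneg x])))
    calc ‖x‖ ^ m * ‖iteratedFDeriv ℝ k (fun x : Conf n => (Real.exp (-(a * ‖x‖ ^ 2)) : ℂ)) x‖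
        ≤ (1 + ‖x‖) ^ m * (k ! * ((1 + a) ^ k * Real.exp (-(a * ‖x‖ ^ 2)))
            * ((1 + C) * (1 + ‖x‖) ^ l) ^ k) := by
          gcongr
          · linarith [norm_nonneg x]
          · exact h1
      _ = k ! * (1 + a) ^ k * (1 + C) ^ k
            * ((1 + ‖x‖) ^ (m + l * k) * Real.exp (-(a * ‖x‖ ^ 2))) := by
          rw [mul_pow, ← pow_mul, pow_add]; ring
      _ ≤ _ := by
          gcongr
          exact hK _ (norm_nonneg x)

theorem gaussianCore_apply (n : ℕ) (a : ℝ) (ha : 0 < a) (x : Conf n) :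
    gaussianCore n a ha x = (Real.exp (-(a * ‖x‖ ^ 2)) : ℂ) := rfl

/-- The vacuum, `exp (-‖x‖² / 2)` up to normalisation. -/
def vacuum (n : ℕ) : Core n := gaussianCore n (1 / 2) (by norm_num)

variable {n : ℕ}

/-- The vacuum is annihilated by x̂ⱼ + i p̂ⱼ; this reduces every momentum acting on it to a
position. -/
theorem momentumOp_vacuum (j : Fin n) :
    momentumOp j (vacuum n) = Complex.I • positionOp j (vacuum n) := by
  ext x
  have h1 : HasFDerivAt (fun x : Conf n => ‖x‖ ^ 2) (2 • (innerSL ℝ x)) x :=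
    (hasStrictFDerivAt_norm_sq x).hasFDerivAt
  have h2 := ((h1.const_mul (1 / 2)).neg).exp
  have h3 : HasFDerivAt (vacuum n : Conf n → ℂ) _ x := Complex.ofRealCLM.hasFDerivAt.comp x h2
  rw [momentumOp_apply, lineDeriv_eq_fderiv, h3.fderiv, smul_apply, positionOp_apply]
  have h4 : vacuum n x = (Real.exp (-(1 / 2 * ‖x‖ ^ 2)) : ℂ) := rfl
  rw [h4]
  simp [EuclideanSpace.inner_single_right]
  ring

theorem energyOp_vacuum : energyOp n (vacuum n) = (n / 2 : ℂ) • vacuum n := by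
  have h : ∀ j : Fin n, momentumOp j (momentumOp j (vacuum n))
      = vacuum n - positionOp j (positionOp j (vacuum n)) := by
    intro j
    have h1 := position_momentum_comm j j (vacuum n)
    simp only [if_true] at h1
    have h2 : momentumOp j (positionOp j (vacuum n))
        = Complex.I • positionOp j (positionOp j (vacuum n)) - Complex.I • vacuum n := by
      rw [← h1, momentumOp_vacuum, map_smul]; abel
    rw [momentumOp_vacuum, map_smul, h2, smul_sub, smul_smul, smul_smul, Complex.I_mul_I]
    simp only [neg_smul, one_smul]
    abel
  rw [energyOp_apply, Fintype.sum_prod_type]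
  simp only [Fin.sum_univ_two]
  have h2 : ∀ j : Fin n, quad (j, 0) (quad (j, 0) (vacuum n)) + quad (j, 1) (quad (j, 1) (vacuum n))
      = vacuum n := fun j => by
    change positionOp j (positionOp j (vacuum n)) + momentumOp j (momentumOp j (vacuum n)) = _
    rw [h]; abel
  simp only [h2, Finset.sum_const, Finset.card_univ, Fintype.card_fin]
  rw [← Nat.cast_smul_eq_nsmul ℂ, smul_smul]
  congr 1
  ring

/-- The operator of multiplication by `⟪y, w⟫`. -/
def innerOp (w : Conf n) : CoreOp n := ∑ j, (w j : ℂ) • positionOp j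

theorem innerOp_apply (w : Conf n) (ψ : Core n) (y : Conf n) :
    innerOp w ψ y = (⟪y, w⟫_ℝ : ℂ) * ψ y := by
  simp only [innerOp, LinearMap.sum_apply, LinearMap.smul_apply]
  have h : (∑ j, (w j : ℂ) • positionOp j ψ) y = ∑ j, (w j : ℂ) * ((y j : ℂ) * ψ y) := by
    simp [sum_apply, positionOp_apply]
  rw [h]
  simp [PiLp.inner_apply, Finset.sum_mul, mul_assoc]

theorem innerOp_pow_apply (w : Conf n) (k : ℕ) (ψ : Core n) (y : Conf n) :
    (innerOp w ^ k) ψ y = (⟪y, w⟫_ℝ : ℂ) ^ k * ψ y := by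
  induction k with
  | zero => simp
  | succ k ih =>
    rw [pow_succ', Module.End.mul_apply, innerOp_apply, ih]
    ring

/-! ### Completeness of polynomials times the Gaussian. -/

theorem inner_toL2_left (ψ : Core n) (f : HSpace n) :
    ⟪toL2 ψ, f⟫_ℂ = ∫ x, (starRingEnd ℂ) (ψ x) * f x := by
  rw [L2.inner_def]
  refine integral_congr_ae ?_
  filter_upwards [ψ.coeFn_toLp 2 (volume : Measure (Conf n))] with x hx
  simp only [toL2, RCLike.inner_apply, hx]
  ring

theorem integrable_mul_of_core (ψ : Core n) (f : HSpace n) : Integrable fun x => ψ x * f x :=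
  MemLp.integrable_mul (ψ.memLp 2 volume) (Lp.memLp f)

/-- Half of the Gaussian exponent absorbs the exponential: |c|‖w‖‖x‖ ≤ ‖x‖²/4 + (|c|‖w‖)². The other
half is still a Schwartz function, integrable against f. -/
theorem integrable_exp_mul_gaussian (c : ℝ) (w : Conf n) (f : HSpace n) :
    Integrable fun x : Conf n => Real.exp |c * ⟪x, w⟫_ℝ| * ‖vacuum n x * f x‖ := by
  have h1 := (integrable_mul_of_core (gaussianCore n (1 / 4) (by norm_num)) f).norm.const_mul
    (Real.exp ((|c| * ‖w‖) ^ 2))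
  have hv : Continuous fun x : Conf n => vacuum n x := (vacuum n).continuous
  refine h1.mono' ?_ (Eventually.of_forall fun x => ?_)
  · refine AEStronglyMeasurable.mul ?_ (integrable_mul_of_core _ f).1.norm
    exact (by fun_prop : Continuous fun x : Conf n => Real.exp |c * ⟪x, w⟫_ℝ|).aestronglyMeasurable
  · have h2 : vacuum n x = (Real.exp (-(1 / 2 * ‖x‖ ^ 2)) : ℂ) := rfl
    rw [norm_mul, norm_norm, norm_mul, norm_mul, gaussianCore_apply, h2, Complex.norm_real,
      Complex.norm_real, Real.norm_of_nonneg (Real.exp_pos _).le,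
      Real.norm_of_nonneg (Real.exp_pos _).le, Real.norm_of_nonneg (Real.exp_pos _).le,
      ← mul_assoc, ← mul_assoc, ← Real.exp_add, ← Real.exp_add]
    refine mul_le_mul_of_nonneg_right (Real.exp_le_exp.2 ?_) (norm_nonneg _)
    have h3 : |c * ⟪x, w⟫_ℝ| ≤ (|c| * ‖w‖) * ‖x‖ := by
      rw [abs_mul, mul_assoc]
      gcongr
      rw [mul_comm]
      exact abs_real_inner_le_norm x w
    nlinarith [sq_nonneg (‖x‖ / 2 - |c| * ‖w‖)]

/-- Expand the character exp(-2πi⟨x,w⟩) in its power series and integrate term by term. Each term is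
a multiple of an inner product that vanishes by hypothesis, and `integrable_exp_mul_gaussian` is the
domination. -/
theorem fourier_vacuum_mul_eq_zero {f : HSpace n}
    (hf : ∀ (w : Conf n) (k : ℕ), ⟪toL2 ((innerOp w ^ k) (vacuum n)), f⟫_ℂ = 0) (w : Conf n) :
    𝓕 (fun x : Conf n => vacuum n x * f x) w = 0 := by
  rw [Real.fourier_eq']
  have key := hasSum_integral_of_dominated_convergence (μ := (volume : Measure (Conf n)))
    (F := fun (k : ℕ) (x : Conf n) => ((k ! : ℂ))⁻¹ * (((-2 * Real.pi * ⟪x, w⟫_ℝ : ℝ) : ℂ)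
      * Complex.I) ^ k * (vacuum n x * f x))
    (f := fun x : Conf n => Complex.exp (((-2 * Real.pi * ⟪x, w⟫_ℝ : ℝ) : ℂ) * Complex.I)
      • (vacuum n x * f x))
    (fun k x => ((k ! : ℝ))⁻¹ * |(-2 * Real.pi) * ⟪x, w⟫_ℝ| ^ k * ‖vacuum n x * f x‖)
    (fun k => ?_) (fun k => Eventually.of_forall fun x => ?_)
    (Eventually.of_forall fun x => ?_) ?_ (Eventually.of_forall fun x => ?_)
  · refine (key.unique ?_)
    have h0 : ∀ k : ℕ, ∫ x : Conf n, ((k ! : ℂ))⁻¹ * (((-2 * Real.pi * ⟪x, w⟫_ℝ : ℝ) : ℂ)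
        * Complex.I) ^ k * (vacuum n x * f x) = 0 := by
      intro k
      have h1 := hf w k
      rw [inner_toL2_left] at h1
      have h2 : ∀ x : Conf n, ((k ! : ℂ))⁻¹ * (((-2 * Real.pi * ⟪x, w⟫_ℝ : ℝ) : ℂ)
        * Complex.I) ^ k * (vacuum n x * f x) = (((k ! : ℂ))⁻¹ * (-2 * Real.pi * Complex.I) ^ k) *
          ((starRingEnd ℂ) ((innerOp w ^ k) (vacuum n) x) * f x) := by
        intro x
        have h3 : vacuum n x = (Real.exp (-(1 / 2 * ‖x‖ ^ 2)) : ℂ) := rfl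
        rw [innerOp_pow_apply, h3]
        simp only [map_mul, map_pow, Complex.conj_ofReal]
        push_cast
        ring
      simp_rw [h2]
      rw [integral_const_mul, h1, mul_zero]
    simp_rw [h0]
    exact hasSum_zero
  · refine AEStronglyMeasurable.mul ?_ (integrable_mul_of_core _ f).1
    exact (by fun_prop : Continuous fun x : Conf n => ((k ! : ℂ))⁻¹ *
      (((-2 * Real.pi * ⟪x, w⟫_ℝ : ℝ) : ℂ) * Complex.I) ^ k).aestronglyMeasurable
  · simp only [norm_mul, norm_inv, norm_pow, Complex.norm_real, Complex.norm_I, mul_one,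
      Complex.norm_natCast, Real.norm_eq_abs, abs_mul]
    exact le_refl _
  · refine Summable.mul_right _ ?_
    have := Real.summable_pow_div_factorial |(-2 * Real.pi) * ⟪x, w⟫_ℝ|
    simpa [div_eq_inv_mul] using this
  · refine (integrable_exp_mul_gaussian (-2 * Real.pi) w f).congr
      (Eventually.of_forall fun x => ?_)
    simp only
    rw [tsum_mul_right, Real.exp_eq_exp_ℝ, NormedSpace.exp_eq_tsum_div]
    simp [div_eq_inv_mul]
  · rw [smul_eq_mul]
    refine HasSum.mul_right _ ?_
    have := NormedSpace.exp_series_hasSum_exp' (𝕂 := ℂ)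
      (((-2 * Real.pi * ⟪x, w⟫_ℝ : ℝ) : ℂ) * Complex.I)
    rw [← Complex.exp_eq_exp_ℂ] at this
    simpa [smul_eq_mul] using this

/-- The Fourier transform of vacuum · f vanishes, so vacuum · f is zero almost everywhere; the
Gaussian has no zeros. -/
theorem eq_zero_of_inner_innerOp_pow_vacuum {f : HSpace n}
    (hf : ∀ (w : Conf n) (k : ℕ), ⟪toL2 ((innerOp w ^ k) (vacuum n)), f⟫_ℂ = 0) : f = 0 := by
  set h : Conf n → ℂ := fun x => vacuum n x * f x with hh
  have hint : Integrable h := integrable_mul_of_core _ f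
  have hF : 𝓕 h = 0 := funext (fourier_vacuum_mul_eq_zero hf)
  -- Every Schwartz function is the Fourier transform of its inverse transform, and the Fourier
  -- transform can be moved onto h, where it is zero.
  have h1 : ∀ ψ : Core n, ∫ x, h x * ψ x = 0 := by
    intro ψ
    have h2 := VectorFourier.integral_bilin_fourierIntegral_eq_flip
      (ContinuousLinearMap.mul ℂ ℂ) (L := innerₗ (Conf n)) Real.continuous_fourierChar
      continuous_inner hint ((𝓕⁻ ψ : Core n).integrable (μ := (volume : Measure (Conf n))))
    have h3 : ∫ ξ, 𝓕 h ξ * (𝓕⁻ ψ : Core n) ξ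
        = ∫ x, h x * (𝓕 (𝓕⁻ ψ : Core n) : Core n) x := by
      simp only [ContinuousLinearMap.mul_apply', flip_innerₗ] at h2
      exact h2
    rw [FourierTransform.fourier_fourierInv_eq, hF] at h3
    simpa using h3.symm
  have h2 : ∀ᵐ x ∂(volume : Measure (Conf n)), h x = 0 := by
    refine ae_eq_zero_of_integral_contDiff_smul_eq_zero hint.locallyIntegrable
      fun g hg hgs => ?_
    have h3 : HasCompactSupport (fun x => (g x : ℂ)) := hgs.comp_left Complex.ofReal_zero
    have h4 : ContDiff ℝ (⊤ : ℕ∞) (fun x => (g x : ℂ)) := Complex.ofRealCLM.contDiff.comp hg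
    have h5 := h1 (h3.toSchwartzMap h4)
    rw [← h5]
    refine integral_congr_ae (Eventually.of_forall fun x => ?_)
    simp [mul_comm]
  rw [Lp.eq_zero_iff_ae_eq_zero]
  filter_upwards [h2] with x hx
  have h6 : vacuum n x ≠ 0 := by
    have h3 : vacuum n x = (Real.exp (-(1 / 2 * ‖x‖ ^ 2)) : ℂ) := rfl
    rw [h3]
    exact_mod_cast (Real.exp_pos _).ne'
  simpa [hh, h6] using hx

end Gaussian

end CVTomo

end

noncomputable section

namespace CVTomo

/-! ### The domain of the energy operator -/

section EnergyDomain

open Filter Topology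

variable {n : ℕ}

/-- The vectors obtained from the vacuum by applying at most `m` quadratures. -/
def quadSpan (n : ℕ) : ℕ → Submodule ℂ (Core n)
  | 0 => Submodule.span ℂ {vacuum n}
  | m + 1 => quadSpan n m ⊔ ⨆ k : QIdx n, (quadSpan n m).map (quad k)

theorem quadSpan_mono : Monotone (quadSpan n) :=
  monotone_nat_of_le_succ fun _ => le_sup_left

theorem quad_mem_quadSpan {m : ℕ} (k : QIdx n) {φ : Core n} (h : φ ∈ quadSpan n m) :
    quad k φ ∈ quadSpan n (m + 1) :=
  Submodule.mem_sup_right (Submodule.mem_iSup_of_mem k (Submodule.mem_map_of_mem h))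

instance finiteDimensional_quadSpan (m : ℕ) : FiniteDimensional ℂ (quadSpan n m) := by
  induction m with
  | zero => exact FiniteDimensional.span_singleton ℂ _
  | succ m ih =>
    change FiniteDimensional ℂ
      (quadSpan n m ⊔ ⨆ k : QIdx n, (quadSpan n m).map (quad k) : Submodule ℂ (Core n))
    infer_instance

/-- The vacuum is an eigenvector, and commuting the energy past a quadrature does not raise the
degree. -/
theorem energyOp_mem_quadSpan (m : ℕ) :
    ∀ φ ∈ quadSpan n m, energyOp n φ ∈ quadSpan n m := by
  induction m with
  | zero =>
    intro φ hφ
    obtain ⟨c, rfl⟩ := Submodule.mem_span_singleton.1 hφ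
    rw [map_smul, energyOp_vacuum]
    exact Submodule.smul_mem _ _ (Submodule.smul_mem _ _ (Submodule.mem_span_singleton_self _))
  | succ m ih =>
    suffices quadSpan n (m + 1) ≤ (quadSpan n (m + 1)).comap (energyOp n) from fun φ hφ => this hφ
    refine sup_le (fun φ hφ => quadSpan_mono m.le_succ (ih φ hφ)) (iSup_le fun k => ?_)
    rintro _ ⟨φ, hφ, rfl⟩
    rw [Submodule.mem_comap, energyOp_quad]
    exact Submodule.add_mem _ (quad_mem_quadSpan k (ih φ hφ))
      (Submodule.sum_mem _ fun l _ => Submodule.smul_mem _ _ (quad_mem_quadSpan l hφ))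

theorem innerOp_pow_vacuum_mem (w : Conf n) (k : ℕ) :
    (innerOp w ^ k) (vacuum n) ∈ quadSpan n k := by
  induction k with
  | zero => exact Submodule.mem_span_singleton_self _
  | succ k ih =>
    rw [pow_succ', Module.End.mul_apply]
    have h : innerOp w ((innerOp w ^ k) (vacuum n))
        = ∑ j, (w j : ℂ) • quad (j, 0) ((innerOp w ^ k) (vacuum n)) := by
      simp [innerOp, LinearMap.sum_apply, quad]
    rw [h]
    exact Submodule.sum_mem _ fun j _ => Submodule.smul_mem _ _ (quad_mem_quadSpan _ ih)

/-- `quadSpan` as a subspace of `L²(ℝⁿ)`. -/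
def quadSpanL2 (n m : ℕ) : Submodule ℂ (HSpace n) := (quadSpan n m).map (toL2Lin n)

instance finiteDimensional_quadSpanL2 (m : ℕ) : FiniteDimensional ℂ (quadSpanL2 n m) := by
  unfold quadSpanL2; infer_instance

theorem quadSpanL2_mono : Monotone (quadSpanL2 n) := fun _ _ h => Submodule.map_mono (quadSpan_mono h)

theorem topologicalClosure_iSup_quadSpanL2 :
    (⨆ m, quadSpanL2 n m).topologicalClosure = ⊤ := by
  rw [Submodule.topologicalClosure_eq_top_iff, eq_bot_iff]
  intro f hf
  rw [Submodule.mem_bot]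
  refine eq_zero_of_inner_innerOp_pow_vacuum fun w k => ?_
  exact (Submodule.mem_orthogonal _ _).1 hf _
    (Submodule.mem_iSup_of_mem k (Submodule.mem_map_of_mem (innerOp_pow_vacuum_mem w k)))

/-- The energy operator is essentially self-adjoint on the core. -/
theorem exists_core_tendsto_energy {f g : HSpace n} (h : IsValue (energyOp n) f g) :
    ∃ φ : ℕ → Core n, Tendsto (fun m => toL2 (φ m)) atTop (𝓝 f) ∧
      Tendsto (fun m => toL2 (energyOp n (φ m))) atTop (𝓝 g) := by
  have h1 : ∀ m, ∃ φ ∈ quadSpan n m, toL2 φ = (quadSpanL2 n m).starProjection f := fun m =>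
    Submodule.mem_map.1 ((quadSpanL2 n m).starProjection_apply_mem f)
  choose φ hφ hφf using h1
  -- For ψ in the m-th space, ⟨ψ, g⟩ = ⟨Êψ, f⟩, and Êψ stays in that space, so f may be replaced by
  -- its projection: ⟨ψ, g⟩ = ⟨ψ, Êφₘ⟩. Thus Êφₘ is the projection of g, and both sequences converge
  -- by density.
  have hE : ∀ m, toL2 (energyOp n (φ m)) = (quadSpanL2 n m).starProjection g := by
    intro m
    refine (Submodule.eq_starProjection_of_mem_of_inner_eq_zero
      (Submodule.mem_map_of_mem (f := toL2Lin n) (energyOp_mem_quadSpan m _ (hφ m))) ?_).symm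
    rintro _ ⟨ψ, hψ, rfl⟩
    rw [toL2Lin_apply, toL2Lin_apply, ← inner_conj_symm, inner_sub_right, ← h ψ, ← energyOp_symm,
      hφf, ← inner_sub_right, ← inner_conj_symm]
    have hmem : toL2 (energyOp n ψ) ∈ quadSpanL2 n m :=
      Submodule.mem_map_of_mem (f := toL2Lin n) (energyOp_mem_quadSpan m _ hψ)
    have := (quadSpanL2 n m).starProjection_inner_eq_zero f _ hmem
    rw [this]
    simp
  refine ⟨φ, ?_, ?_⟩
  · simp_rw [hφf]
    exact Submodule.starProjection_tendsto_self _ quadSpanL2_mono f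
      topologicalClosure_iSup_quadSpanL2.ge
  · simp_rw [hE]
    exact Submodule.starProjection_tendsto_self _ quadSpanL2_mono g
      topologicalClosure_iSup_quadSpanL2.ge

/-- An operator bounded relative to the graph norm of the energy sends graph-norm Cauchy sequences
to Cauchy sequences. -/
theorem exists_tendsto_of_energy_bound {φ : ℕ → Core n} {f g : HSpace n}
    (hf : Tendsto (fun m => toL2 (φ m)) atTop (𝓝 f))
    (hg : Tendsto (fun m => toL2 (energyOp n (φ m))) atTop (𝓝 g)) (A : CoreOp n) (C : ℝ)
    (hA : ∀ ψ, ‖toL2 (A ψ)‖ ^ 2 ≤ C * (‖toL2 (energyOp n ψ)‖ ^ 2 + ‖toL2 ψ‖ ^ 2)) :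
    ∃ h, Tendsto (fun m => toL2 (A (φ m))) atTop (𝓝 h) := by
  refine cauchySeq_tendsto_of_complete (cauchySeq_iff_tendsto_dist_atTop_0.2 ?_)
  have h1 := cauchySeq_iff_tendsto_dist_atTop_0.1 hf.cauchySeq
  have h2 := cauchySeq_iff_tendsto_dist_atTop_0.1 hg.cauchySeq
  have h3 := (((h2.pow 2).add (h1.pow 2)).const_mul C).sqrt
  simp only [ne_eq, OfNat.ofNat_ne_zero, not_false_eq_true, zero_pow, add_zero, mul_zero,
    Real.sqrt_zero] at h3
  refine squeeze_zero (fun _ => dist_nonneg) (fun p => Real.le_sqrt_of_sq_le ?_) h3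
  simpa [dist_eq_norm] using hA (φ p.1 - φ p.2)

/-- `f` is in the domain of the energy operator with value `g`; the core vectors `φ m` tend to `f`
together with the values of the energy, of the quadratures (limits `r`) and of their products
(limits `w`). -/
structure IsEnergyLimit (φ : ℕ → Core n) (f g : HSpace n) (r : QIdx n → HSpace n)
    (w : QIdx n → QIdx n → HSpace n) : Prop where
  tendsto : Tendsto (fun m => toL2 (φ m)) atTop (𝓝 f)
  energy : Tendsto (fun m => toL2 (energyOp n (φ m))) atTop (𝓝 g)
  quad : ∀ k, Tendsto (fun m => toL2 (quad k (φ m))) atTop (𝓝 (r k))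
  quad_quad : ∀ k l, Tendsto (fun m => toL2 (CVTomo.quad k (CVTomo.quad l (φ m)))) atTop (𝓝 (w k l))

theorem exists_isEnergyLimit {f g : HSpace n} (h : IsValue (energyOp n) f g) :
    ∃ φ r w, IsEnergyLimit φ f g r w := by
  obtain ⟨φ, hf, hg⟩ := exists_core_tendsto_energy h
  have h1 : ∀ k, ∃ r, Tendsto (fun m => toL2 (quad k (φ m))) atTop (𝓝 r) := fun k => by
    refine exists_tendsto_of_energy_bound hf hg (quad k) 1 fun ψ => ?_
    have h2 := sum_norm_sq_quad_le ψ
    have h3 : ‖toL2 (quad k ψ)‖ ^ 2 ≤ ∑ k, ‖toL2 (quad k ψ)‖ ^ 2 :=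
      Finset.single_le_sum (f := fun k => ‖toL2 (quad k ψ)‖ ^ 2) (fun _ _ => by positivity)
        (Finset.mem_univ k)
    nlinarith [sq_nonneg (‖toL2 ψ‖ - ‖toL2 (energyOp n ψ)‖)]
  have h2 : ∀ k l, ∃ w, Tendsto (fun m => toL2 (quad k (quad l (φ m)))) atTop (𝓝 w) := fun k l => by
    refine exists_tendsto_of_energy_bound hf hg (quad k * quad l) (4 + 2 * n) fun ψ => ?_
    have h2 := sum_norm_sq_quad_quad ψ
    have h3 : ‖toL2 (quad k (quad l ψ))‖ ^ 2 ≤ ∑ k, ∑ l, ‖toL2 (quad k (quad l ψ))‖ ^ 2 :=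
      (Finset.single_le_sum (f := fun l => ‖toL2 (quad k (quad l ψ))‖ ^ 2)
        (fun _ _ => by positivity) (Finset.mem_univ l)).trans
      (Finset.single_le_sum (f := fun k => ∑ l, ‖toL2 (quad k (quad l ψ))‖ ^ 2)
        (fun _ _ => by positivity) (Finset.mem_univ k))
    rw [Module.End.mul_apply]
    have h4 : 0 ≤ 4 * ‖toL2 ψ‖ ^ 2 + 2 * n * ‖toL2 (energyOp n ψ)‖ ^ 2 := by positivity
    linarith
  choose r hr using h1
  choose w hw using h2
  exact ⟨φ, r, w, hf, hg, hr, hw⟩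

/-- The core is dense. -/
theorem IsValue.unique {A : CoreOp n} {f g g' : HSpace n} (h : IsValue A f g)
    (h' : IsValue A f g') : g = g' := by
  refine denseRange_toL2.eq_of_inner_right (𝕜 := ℂ) fun φ => ?_
  rw [← h φ, ← h' φ]

theorem opApply_eq {A : CoreOp n} {f g : HSpace n} (h : IsValue A f g) : opApply A f = g := by
  have h1 : ∃ g, IsValue A f g := ⟨g, h⟩
  rw [opApply, dif_pos h1]
  exact h1.choose_spec.unique h

namespace IsEnergyLimit

variable {φ : ℕ → Core n} {f g : HSpace n} {r : QIdx n → HSpace n} {w : QIdx n → QIdx n → HSpace n}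

theorem isValue_quad (h : IsEnergyLimit φ f g r w) (k : QIdx n) :
    IsValue (CVTomo.quad k) f (r k) := fun ψ =>
  tendsto_nhds_unique (tendsto_const_nhds.inner h.tendsto)
    ((tendsto_const_nhds.inner (h.quad k)).congr fun m => (quad_symm k ψ (φ m)).symm)

theorem isValue_anticomm (h : IsEnergyLimit φ f g r w) (k l : QIdx n) :
    IsValue (anticomm (CVTomo.quad k) (CVTomo.quad l)) f (w k l + w l k) := fun ψ => by
  refine tendsto_nhds_unique (tendsto_const_nhds.inner h.tendsto)
    ((tendsto_const_nhds.inner ((h.quad_quad k l).add (h.quad_quad l k))).congr fun m => ?_)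
  simp only [anticomm, LinearMap.add_apply, Module.End.mul_apply, toL2_add, inner_add_left,
    inner_add_right, quad_symm]
  ring

theorem opApply_quad (h : IsEnergyLimit φ f g r w) (k : QIdx n) :
    opApply (CVTomo.quad k) f = r k := opApply_eq (h.isValue_quad k)

theorem opApply_anticomm (h : IsEnergyLimit φ f g r w) (k l : QIdx n) :
    opApply (anticomm (CVTomo.quad k) (CVTomo.quad l)) f = w k l + w l k :=
  opApply_eq (h.isValue_anticomm k l)

theorem inner_eq (h : IsEnergyLimit φ f g r w) (k l : QIdx n) : ⟪r k, r l⟫_ℂ = ⟪f, w k l⟫_ℂ :=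
  tendsto_nhds_unique ((h.quad k).inner (h.quad l))
    ((h.tendsto.inner (h.quad_quad k l)).congr fun _ => (quad_symm k _ _).symm)

theorem sub_eq (h : IsEnergyLimit φ f g r w) (k l : QIdx n) :
    w k l - w l k = (Complex.I * symplecticForm n k l) • f :=
  tendsto_nhds_unique ((h.quad_quad k l).sub (h.quad_quad l k))
    ((h.tendsto.const_smul _).congr fun _ => by rw [← toL2_sub, quad_comm, toL2_smul])

theorem sum_norm_sq_quad_quad (h : IsEnergyLimit φ f g r w) :
    ∑ k, ∑ l, ‖w k l‖ ^ 2 = 4 * ‖g‖ ^ 2 + 2 * n * ‖f‖ ^ 2 :=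
  tendsto_nhds_unique
    (tendsto_finsetSum _ fun k _ => tendsto_finsetSum _ fun l _ => (h.quad_quad k l).norm.pow 2)
    ((((h.energy.norm.pow 2).const_mul 4).add ((h.tendsto.norm.pow 2).const_mul (2 * n : ℝ))).congr
      fun m => (CVTomo.sum_norm_sq_quad_quad (φ m)).symm)

theorem sum_norm_sq_quad_le (h : IsEnergyLimit φ f g r w) :
    ∑ k, ‖r k‖ ^ 2 ≤ 2 * (‖f‖ * ‖g‖) :=
  le_of_tendsto_of_tendsto' (tendsto_finsetSum _ fun k _ => (h.quad k).norm.pow 2)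
    ((h.tendsto.norm.mul h.energy.norm).const_mul 2) fun m => CVTomo.sum_norm_sq_quad_le (φ m)

theorem le_sum_norm_sq_quad (h : IsEnergyLimit φ f g r w) :
    n * ‖f‖ ^ 2 ≤ ∑ k, ‖r k‖ ^ 2 :=
  le_of_tendsto_of_tendsto' ((h.tendsto.norm.pow 2).const_mul (n : ℝ))
    (tendsto_finsetSum _ fun k _ => (h.quad k).norm.pow 2)
    fun m => CVTomo.le_sum_norm_sq_quad (φ m)

end IsEnergyLimit

end EnergyDomain

end CVTomo

end

noncomputable section

namespace CVTomo

/-! ### Moments of a spectral measure from its characteristic function -/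

section Moments

open Filter Topology

variable {m : ℕ}

/-- The trigonometric polynomial `a ↦ ∑ₖ cₖ exp (i τₖ·a)`. -/
def trigEval {κ : Type*} [Fintype κ] (c : κ → ℂ) (τ : κ → Fin m → ℝ) (a : Fin m → ℝ) : ℂ :=
  ∑ k, c k * Complex.exp (Complex.I * ((∑ j, τ k j * a j : ℝ) : ℂ))

/-- The vector `∑ₖ cₖ U(τₖ) f`. -/
def trigApply {H : Type*} [NormedAddCommGroup H] [InnerProductSpace ℂ H] {κ : Type*} [Fintype κ]
    (U : (Fin m → ℝ) → (H ≃ₗᵢ[ℂ] H)) (c : κ → ℂ) (τ : κ → Fin m → ℝ) (f : H) : H :=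
  ∑ k, c k • U (τ k) f

theorem continuous_trigEval {κ : Type*} [Fintype κ] (c : κ → ℂ) (τ : κ → Fin m → ℝ) :
    Continuous (trigEval c τ) := by
  unfold trigEval
  fun_prop

theorem norm_exp_I_mul_ofReal (x : ℝ) : ‖Complex.exp (Complex.I * (x : ℂ))‖ = 1 := by
  rw [mul_comm, Complex.norm_exp_ofReal_mul_I]

variable {H : Type*} [NormedAddCommGroup H] [InnerProductSpace ℂ H] {ι : Type*}
  {U : (Fin m → ℝ) → (H ≃ₗᵢ[ℂ] H)} {f : ι → H} {μ : Measure (Fin m → ℝ)} [IsProbabilityMeasure μ]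

theorem summable_inner_apply (hf : Summable fun i => ‖f i‖ ^ 2) (t : Fin m → ℝ) :
    Summable fun i => ⟪f i, U t (f i)⟫_ℂ := by
  refine Summable.of_norm_bounded hf fun i => (norm_inner_le_norm _ _).trans ?_
  rw [LinearIsometryEquiv.norm_map, sq]

theorem inner_apply_apply (hU : ∀ s t f, U (s + t) f = U s (U t f)) (s t : Fin m → ℝ) (x : H) :
    ⟪U s x, U t x⟫_ℂ = ⟪x, U (t - s) x⟫_ℂ := by
  conv_lhs => rw [← add_sub_cancel s t, hU, LinearIsometryEquiv.inner_map_map]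

/-- The isometry between trigonometric polynomials in L²(μ) and vectors ∑ cₖU(τₖ)f: both sides
expand into values at σₗ − τₖ, of the characteristic function on the left and of ⟨f, U f⟩ on the
right. -/
theorem integral_conj_trigEval_mul_trigEval {κ κ' : Type*} [Fintype κ] [Fintype κ']
    (hU : ∀ s t f, U (s + t) f = U s (U t f)) (hf : Summable fun i => ‖f i‖ ^ 2)
    (hμ : ∀ t : Fin m → ℝ,
      ∫ a, Complex.exp (Complex.I * ((∑ j, t j * a j : ℝ) : ℂ)) ∂μ = ∑' i, ⟪f i, U t (f i)⟫_ℂ)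
    (c : κ → ℂ) (τ : κ → Fin m → ℝ) (d : κ' → ℂ) (σ : κ' → Fin m → ℝ) :
    ∫ a, (starRingEnd ℂ) (trigEval c τ a) * trigEval d σ a ∂μ
      = ∑' i, ⟪trigApply U c τ (f i), trigApply U d σ (f i)⟫_ℂ := by
  have h1 : ∀ a, (starRingEnd ℂ) (trigEval c τ a) * trigEval d σ a
      = ∑ k, ∑ l, (starRingEnd ℂ) (c k) * d l
        * Complex.exp (Complex.I * ((∑ j, (σ l - τ k) j * a j : ℝ) : ℂ)) := by
    intro a
    rw [trigEval, trigEval, map_sum, Finset.sum_mul_sum]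
    refine Finset.sum_congr rfl fun k _ => Finset.sum_congr rfl fun l _ => ?_
    rw [map_mul, ← Complex.exp_conj, mul_mul_mul_comm, ← Complex.exp_add]
    congr 2
    simp only [map_mul, Complex.conj_I, Complex.conj_ofReal, Pi.sub_apply, sub_mul,
      Finset.sum_sub_distrib]
    push_cast
    ring
  have h2 : ∀ i, ⟪trigApply U c τ (f i), trigApply U d σ (f i)⟫_ℂ
      = ∑ k, ∑ l, (starRingEnd ℂ) (c k) * d l * ⟪f i, U (σ l - τ k) (f i)⟫_ℂ := by
    intro i
    rw [trigApply, trigApply, sum_inner]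
    refine Finset.sum_congr rfl fun k _ => ?_
    rw [inner_sum]
    refine Finset.sum_congr rfl fun l _ => ?_
    rw [inner_smul_left, inner_smul_right, inner_apply_apply hU, mul_assoc]
  have hint : ∀ t : Fin m → ℝ, Integrable
      (fun a : Fin m → ℝ => Complex.exp (Complex.I * ((∑ j, t j * a j : ℝ) : ℂ))) μ := fun t =>
    Integrable.of_bound (by fun_prop : Continuous fun a : Fin m → ℝ =>
      Complex.exp (Complex.I * ((∑ j, t j * a j : ℝ) : ℂ))).aestronglyMeasurable 1
      (Eventually.of_forall fun a => (norm_exp_I_mul_ofReal _).le)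
  simp_rw [h1, h2]
  rw [integral_finsetSum _ fun k _ => integrable_finsetSum _ fun l _ => (hint _).const_mul _]
  refine (HasSum.tsum_eq ?_).symm
  refine hasSum_sum fun k _ => ?_
  rw [integral_finsetSum _ fun l _ => (hint _).const_mul _]
  refine hasSum_sum fun l _ => ?_
  rw [integral_const_mul, hμ]
  exact (summable_inner_apply hf _).hasSum.mul_left _

theorem lintegral_trigEval_le {κ : Type*} [Fintype κ]
    (hU : ∀ s t f, U (s + t) f = U s (U t f)) (hf : Summable fun i => ‖f i‖ ^ 2)
    (hμ : ∀ t : Fin m → ℝ,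
      ∫ a, Complex.exp (Complex.I * ((∑ j, t j * a j : ℝ) : ℂ)) ∂μ = ∑' i, ⟪f i, U t (f i)⟫_ℂ)
    (c : κ → ℂ) (τ : κ → Fin m → ℝ) {b : ι → ℝ} (hb : Summable fun i => b i ^ 2)
    (hle : ∀ i, ‖trigApply U c τ (f i)‖ ≤ b i) :
    ∫⁻ a, ‖trigEval c τ a‖ₑ ^ 2 ∂μ ≤ ENNReal.ofReal (∑' i, b i ^ 2) := by
  have h0 : ∀ i, ‖trigApply U c τ (f i)‖ ^ 2 ≤ b i ^ 2 := fun i =>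
    pow_le_pow_left₀ (norm_nonneg _) (hle i) 2
  have hs : Summable fun i => ‖trigApply U c τ (f i)‖ ^ 2 :=
    Summable.of_nonneg_of_le (fun _ => by positivity) h0 hb
  have h1 := integral_conj_trigEval_mul_trigEval hU hf hμ c τ c τ
  have hint : Integrable (fun a => ‖trigEval c τ a‖ ^ 2) μ := by
    refine Integrable.of_bound ((continuous_trigEval c τ).norm.pow 2).aestronglyMeasurable
      ((∑ k, ‖c k‖) ^ 2) (Eventually.of_forall fun a => ?_)
    rw [norm_pow, norm_norm]
    gcongr
    refine (norm_sum_le _ _).trans (le_of_eq (Finset.sum_congr rfl fun k _ => ?_))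
    rw [norm_mul, norm_exp_I_mul_ofReal, mul_one]
  have h2 : ((∫ a, ‖trigEval c τ a‖ ^ 2 ∂μ : ℝ) : ℂ)
      = ((∑' i, ‖trigApply U c τ (f i)‖ ^ 2 : ℝ) : ℂ) := by
    rw [← integral_complex_ofReal, Complex.ofReal_tsum]
    refine Eq.trans (integral_congr_ae (Eventually.of_forall fun a => ?_)) (h1.trans ?_)
    · simp only
      rw [mul_comm, Complex.mul_conj, Complex.normSq_eq_norm_sq]
    · refine tsum_congr fun i => ?_
      rw [inner_self_eq_norm_sq_to_K]
      push_cast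
      rfl
  have h3 : ∫⁻ a, ‖trigEval c τ a‖ₑ ^ 2 ∂μ = ENNReal.ofReal (∫ a, ‖trigEval c τ a‖ ^ 2 ∂μ) := by
    rw [ofReal_integral_eq_lintegral_ofReal hint (Eventually.of_forall fun a => by positivity)]
    refine lintegral_congr fun a => ?_
    rw [ENNReal.ofReal_pow (norm_nonneg _), ofReal_norm]
  rw [h3, Complex.ofReal_inj.1 h2]
  exact ENNReal.ofReal_le_ofReal (hs.tsum_le_tsum h0 hb)

/-- Fatou's lemma. No integrability of the limit is assumed, so this is what first yields square
integrability of the outcomes. -/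
theorem lintegral_le_of_tendsto_trigEval {κ : Type*} [Fintype κ]
    (hU : ∀ s t f, U (s + t) f = U s (U t f)) (hf : Summable fun i => ‖f i‖ ^ 2)
    (hμ : ∀ t : Fin m → ℝ,
      ∫ a, Complex.exp (Complex.I * ((∑ j, t j * a j : ℝ) : ℂ)) ∂μ = ∑' i, ⟪f i, U t (f i)⟫_ℂ)
    (c : ℕ → κ → ℂ) (τ : ℕ → κ → Fin m → ℝ) {b : ι → ℝ} (hb : Summable fun i => b i ^ 2)
    (hle : ∀ N i, ‖trigApply U (c N) (τ N) (f i)‖ ≤ b i) {P : (Fin m → ℝ) → ℂ}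
    (hP : ∀ a, Tendsto (fun N => trigEval (c N) (τ N) a) atTop (𝓝 (P a))) :
    ∫⁻ a, ‖P a‖ₑ ^ 2 ∂μ ≤ ENNReal.ofReal (∑' i, b i ^ 2) := by
  have h1 : ∀ a, ‖P a‖ₑ ^ 2 = liminf (fun N => ‖trigEval (c N) (τ N) a‖ₑ ^ 2) atTop := fun a =>
    (((ENNReal.continuous_pow 2).tendsto _).comp
      ((continuous_enorm.tendsto _).comp (hP a))).liminf_eq.symm
  simp_rw [h1]
  refine (lintegral_liminf_le fun N => ?_).trans ?_
  · exact ((continuous_trigEval _ _).measurable.enorm).pow_const 2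
  · refine liminf_le_of_frequently_le' (Frequently.of_forall fun N => ?_)
    exact lintegral_trigEval_le hU hf hμ _ _ hb (hle N)

/-- Pass to the limit in the isometry by dominated convergence on both sides; the approximants are
dominated by their limits, both pointwise and as vectors. -/
theorem integral_conj_mul_of_tendsto_trigEval {κ κ' : Type*} [Fintype κ] [Fintype κ']
    (hU : ∀ s t f, U (s + t) f = U s (U t f)) (hf : Summable fun i => ‖f i‖ ^ 2)
    (hμ : ∀ t : Fin m → ℝ,
      ∫ a, Complex.exp (Complex.I * ((∑ j, t j * a j : ℝ) : ℂ)) ∂μ = ∑' i, ⟪f i, U t (f i)⟫_ℂ)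
    (c : ℕ → κ → ℂ) (τ : ℕ → κ → Fin m → ℝ) (d : ℕ → κ' → ℂ) (σ : ℕ → κ' → Fin m → ℝ)
    {v w : ι → H} (hv : Summable fun i => ‖v i‖ ^ 2) (hw : Summable fun i => ‖w i‖ ^ 2)
    (hvle : ∀ N i, ‖trigApply U (c N) (τ N) (f i)‖ ≤ ‖v i‖)
    (hwle : ∀ N i, ‖trigApply U (d N) (σ N) (f i)‖ ≤ ‖w i‖)
    (hvlim : ∀ i, Tendsto (fun N => trigApply U (c N) (τ N) (f i)) atTop (𝓝 (v i)))
    (hwlim : ∀ i, Tendsto (fun N => trigApply U (d N) (σ N) (f i)) atTop (𝓝 (w i)))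
    {P Q : (Fin m → ℝ) → ℂ}
    (hP : ∀ a, Tendsto (fun N => trigEval (c N) (τ N) a) atTop (𝓝 (P a)))
    (hQ : ∀ a, Tendsto (fun N => trigEval (d N) (σ N) a) atTop (𝓝 (Q a)))
    (hPle : ∀ N a, ‖trigEval (c N) (τ N) a‖ ≤ ‖P a‖)
    (hQle : ∀ N a, ‖trigEval (d N) (σ N) a‖ ≤ ‖Q a‖)
    (hint : Integrable (fun a => P a * Q a) μ) :
    ∫ a, (starRingEnd ℂ) (P a) * Q a ∂μ = ∑' i, ⟪v i, w i⟫_ℂ := by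
  have h1 : Tendsto (fun N => ∫ a, (starRingEnd ℂ) (trigEval (c N) (τ N) a)
      * trigEval (d N) (σ N) a ∂μ) atTop (𝓝 (∫ a, (starRingEnd ℂ) (P a) * Q a ∂μ)) := by
    refine tendsto_integral_of_dominated_convergence (fun a => ‖P a * Q a‖) (fun N => ?_)
      hint.norm (fun N => Eventually.of_forall fun a => ?_) (Eventually.of_forall fun a => ?_)
    · exact ((Complex.continuous_conj.comp (continuous_trigEval _ _)).mul
        (continuous_trigEval _ _)).aestronglyMeasurable
    · rw [norm_mul, norm_mul, RCLike.norm_conj]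
      exact mul_le_mul (hPle N a) (hQle N a) (norm_nonneg _) (norm_nonneg _)
    · exact ((Complex.continuous_conj.tendsto _).comp (hP a)).mul (hQ a)
  have h2 : Tendsto (fun N => ∑' i, ⟪trigApply U (c N) (τ N) (f i),
      trigApply U (d N) (σ N) (f i)⟫_ℂ) atTop (𝓝 (∑' i, ⟪v i, w i⟫_ℂ)) := by
    refine tendsto_tsum_of_dominated_convergence (bound := fun i => ‖v i‖ ^ 2 + ‖w i‖ ^ 2)
      (hv.add hw) (fun i => (hvlim i).inner (hwlim i)) (Eventually.of_forall fun N i => ?_)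
    refine (norm_inner_le_norm _ _).trans ((mul_le_mul (hvle N i) (hwle N i) (norm_nonneg _)
      (norm_nonneg _)).trans ?_)
    nlinarith [sq_nonneg (‖v i‖ - ‖w i‖), sq_nonneg ‖v i‖, sq_nonneg ‖w i‖]
  simp_rw [integral_conj_trigEval_mul_trigEval hU hf hμ] at h1
  exact tendsto_nhds_unique h1 h2

end Moments

end CVTomo

end

noncomputable section

namespace CVTomo

/-! ### Unitary groups and the moments of Born laws -/

section Born

open Filter Topology

variable {n m : ℕ} {A : Fin m → CoreOp n} {U : (Fin m → ℝ) → (HSpace n ≃ₗᵢ[ℂ] HSpace n)}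

theorem real_smul_eq (s : ℝ) (x : HSpace n) : s • x = (s : ℂ) • x :=
  RCLike.real_smul_eq_coe_smul (K := ℂ) s x

theorem hasDerivAt_clm_comp (L : HSpace n →L[ℂ] HSpace n) {F : ℝ → HSpace n} {F' : HSpace n}
    {s : ℝ} (h : HasDerivAt F F' s) : HasDerivAt (fun s => L (F s)) (L F') s :=
  (L.restrictScalars ℝ).hasFDerivAt.comp_hasDerivAt s h

namespace IsJointUnitaryGroup

theorem zero_apply (hU : IsJointUnitaryGroup A U) (f : HSpace n) : U 0 f = f := by
  have h := hU.map_add 0 0 f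
  rw [add_zero] at h
  exact ((U 0).injective h).symm

theorem comm (hU : IsJointUnitaryGroup A U) (s t : Fin m → ℝ) (f : HSpace n) :
    U s (U t f) = U t (U s f) := by
  rw [← hU.map_add, ← hU.map_add, add_comm]

/-- The group law carries the derivative from 0 to s. -/
theorem hasDerivAt (hU : IsJointUnitaryGroup A U) (t : Fin m → ℝ) (φ : Core n) (s : ℝ) :
    HasDerivAt (fun s : ℝ => U (s • t) (toL2 φ))
      (U (s • t) (Complex.I • toL2 ((∑ j, (t j : ℂ) • A j) φ))) s := by
  have h1 : HasDerivAt (fun s : ℝ => U (s • t) (toL2 φ))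
      (Complex.I • toL2 ((∑ j, (t j : ℂ) • A j) φ)) (s - s) := by
    rw [sub_self]; exact hU.generator t φ
  have h2 := hasDerivAt_clm_comp ((U (s • t)).toContinuousLinearEquiv : HSpace n →L[ℂ] HSpace n)
    (h1.comp_sub_const s s)
  refine h2.congr_of_eventuallyEq (Eventually.of_forall fun s' => ?_)
  change U (s' • t) (toL2 φ) = U (s • t) (U ((s' - s) • t) (toL2 φ))
  rw [← hU.map_add, ← add_smul]
  congr 3
  ring

/-- Mean value inequality: U is isometric, so the derivative has the same norm at all times. -/
theorem norm_sub_le_core (hU : IsJointUnitaryGroup A U) (t : Fin m → ℝ) (φ : Core n) (s : ℝ) :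
    ‖U (s • t) (toL2 φ) - toL2 φ‖ ≤ ‖toL2 ((∑ j, (t j : ℂ) • A j) φ)‖ * |s| := by
  have h := convex_univ.norm_image_sub_le_of_norm_hasDerivWithin_le (x := (0 : ℝ)) (y := s)
    (f := fun s : ℝ => U (s • t) (toL2 φ))
    (fun s _ => (hU.hasDerivAt t φ s).hasDerivWithinAt)
    (C := ‖toL2 ((∑ j, (t j : ℂ) • A j) φ)‖)
    (fun s _ => by rw [LinearIsometryEquiv.norm_map, norm_smul, Complex.norm_I, one_mul])
    (Set.mem_univ _) (Set.mem_univ _)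
  simpa [hU.zero_apply] using h

/-- Second-order version: differentiate (U(st) − 1)U(s'r)φ in s'. Since the unitaries commute, the
norm of this derivative is that of (U(st) − 1) applied to the generator's value at φ, which
`norm_sub_le_core` bounds. -/
theorem norm_sub_sub_le_core (hU : IsJointUnitaryGroup A U) (t r : Fin m → ℝ) (φ : Core n)
    (s : ℝ) :
    ‖U (s • t) (U (s • r) (toL2 φ) - toL2 φ) - (U (s • r) (toL2 φ) - toL2 φ)‖
      ≤ ‖toL2 ((∑ j, (t j : ℂ) • A j) ((∑ j, (r j : ℂ) • A j) φ))‖ * |s| * |s| := by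
  set L : HSpace n →L[ℂ] HSpace n :=
    ((U (s • t)).toContinuousLinearEquiv : HSpace n →L[ℂ] HSpace n) - ContinuousLinearMap.id ℂ _
  have hL : ∀ x, L x = U (s • t) x - x := fun x => rfl
  have h := convex_univ.norm_image_sub_le_of_norm_hasDerivWithin_le (x := (0 : ℝ)) (y := s)
    (f := fun s' : ℝ => L (U (s' • r) (toL2 φ)))
    (fun s' _ => (hasDerivAt_clm_comp L (hU.hasDerivAt r φ s')).hasDerivWithinAt)
    (C := ‖toL2 ((∑ j, (t j : ℂ) • A j) ((∑ j, (r j : ℂ) • A j) φ))‖ * |s|)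
    (fun s' _ => by
      rw [hL, hU.comm, ← map_sub, LinearIsometryEquiv.norm_map, map_smul, ← smul_sub, norm_smul,
        Complex.norm_I, one_mul]
      exact hU.norm_sub_le_core t _ s)
    (Set.mem_univ _) (Set.mem_univ _)
  simp only [zero_smul, hU.zero_apply, sub_zero, Real.norm_eq_abs] at h
  rwa [← map_sub, hL] at h

variable {φ : ℕ → Core n} {f h : HSpace n}

theorem norm_sub_le (hU : IsJointUnitaryGroup A U) (t : Fin m → ℝ)
    (hf : Tendsto (fun k => toL2 (φ k)) atTop (𝓝 f))
    (hh : Tendsto (fun k => toL2 ((∑ j, (t j : ℂ) • A j) (φ k))) atTop (𝓝 h)) (s : ℝ) :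
    ‖U (s • t) f - f‖ ≤ ‖h‖ * |s| :=
  le_of_tendsto_of_tendsto' (((((U (s • t)).continuous.tendsto f).comp hf).sub hf).norm)
    (hh.norm.mul_const _) fun k => hU.norm_sub_le_core t (φ k) s

theorem norm_sub_sub_le (hU : IsJointUnitaryGroup A U) (t r : Fin m → ℝ)
    (hf : Tendsto (fun k => toL2 (φ k)) atTop (𝓝 f))
    (hh : Tendsto (fun k => toL2 ((∑ j, (t j : ℂ) • A j) ((∑ j, (r j : ℂ) • A j) (φ k))))
      atTop (𝓝 h)) (s : ℝ) :
    ‖U (s • t) (U (s • r) f - f) - (U (s • r) f - f)‖ ≤ ‖h‖ * |s| * |s| := by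
  have h1 := (((U (s • r)).continuous.tendsto f).comp hf).sub hf
  exact le_of_tendsto_of_tendsto' ((((U (s • t)).continuous.tendsto _).comp h1).sub h1).norm
    ((hh.norm.mul_const _).mul_const _) fun k => hU.norm_sub_sub_le_core t r (φ k) s

/-- Difference quotients are bounded, uniformly in s, by the norm of the generator's value, so
convergence on the core extends to its graph limits. -/
theorem tendsto_quotient (hU : IsJointUnitaryGroup A U) (t : Fin m → ℝ)
    (hf : Tendsto (fun k => toL2 (φ k)) atTop (𝓝 f))
    (hh : Tendsto (fun k => toL2 ((∑ j, (t j : ℂ) • A j) (φ k))) atTop (𝓝 h))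
    {s : ℕ → ℝ} (hs : Tendsto s atTop (𝓝[≠] 0)) :
    Tendsto (fun N => (s N)⁻¹ • (U (s N • t) f - f)) atTop (𝓝 (Complex.I • h)) := by
  rw [Metric.tendsto_atTop]
  intro ε hε
  obtain ⟨k, hk⟩ := ((Metric.tendsto_atTop.1 hh (ε / 3) (by positivity)))
  have hk := hk k le_rfl
  set ψ := φ k
  have h1 := ((hU.generator t ψ).tendsto_slope_zero).comp hs
  obtain ⟨N₁, hN₁⟩ := Metric.tendsto_atTop.1 h1 (ε / 3) (by positivity)
  obtain ⟨N₂, hN₂⟩ := eventually_atTop.1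
    ((tendsto_nhdsWithin_iff.1 hs).2 : ∀ᶠ N in atTop, s N ∈ ({0}ᶜ : Set ℝ))
  refine ⟨max N₁ N₂, fun N hN => ?_⟩
  have h2 := hN₁ N (le_of_max_le_left hN)
  have hsN : s N ≠ 0 := hN₂ N (le_of_max_le_right hN)
  have h3 : ‖U (s N • t) (f - toL2 ψ) - (f - toL2 ψ)‖
      ≤ ‖h - toL2 ((∑ j, (t j : ℂ) • A j) ψ)‖ * |s N| := by
    refine hU.norm_sub_le (φ := fun k => φ k - ψ) t ?_ ?_ (s N)
    · simp only [toL2_sub]; exact hf.sub_const _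
    · simp only [map_sub, toL2_sub]; exact hh.sub_const _
  have h4 : (s N)⁻¹ • (U (s N • t) f - f) - Complex.I • h
      = (s N)⁻¹ • (U (s N • t) (f - toL2 ψ) - (f - toL2 ψ))
        + ((s N)⁻¹ • (U (s N • t) (toL2 ψ) - toL2 ψ)
            - Complex.I • toL2 ((∑ j, (t j : ℂ) • A j) ψ))
        + Complex.I • (toL2 ((∑ j, (t j : ℂ) • A j) ψ) - h) := by
    simp only [map_sub, smul_sub]
    abel
  rw [dist_eq_norm] at hk ⊢
  rw [h4]
  have h5 : ‖(s N)⁻¹ • (U (s N • t) (f - toL2 ψ) - (f - toL2 ψ))‖ < ε / 3 := by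
    rw [norm_smul, norm_inv, Real.norm_eq_abs]
    refine lt_of_le_of_lt ?_ hk
    rw [inv_mul_le_iff₀ (abs_pos.2 hsN), mul_comm, norm_sub_rev _ h]
    exact h3
  have h6 : ‖(s N)⁻¹ • (U (s N • t) (toL2 ψ) - toL2 ψ)
      - Complex.I • toL2 ((∑ j, (t j : ℂ) • A j) ψ)‖ < ε / 3 := by
    rw [dist_eq_norm] at h2
    simpa [hU.zero_apply] using h2
  have h7 : ‖Complex.I • (toL2 ((∑ j, (t j : ℂ) • A j) ψ) - h)‖ < ε / 3 := by
    rwa [norm_smul, Complex.norm_I, one_mul]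
  calc _ ≤ _ := norm_add₃_le
    _ < ε / 3 + ε / 3 + ε / 3 := by linarith
    _ = ε := by ring

end IsJointUnitaryGroup

/-- Coefficients of the difference quotient `(exp (i s t·a) - 1) / s`. -/
def quotCoeff (s : ℝ) : Fin 2 → ℂ := ![(s : ℂ)⁻¹, -(s : ℂ)⁻¹]

/-- Frequencies of the difference quotient `(exp (i s t·a) - 1) / s`. -/
def quotFreq (s : ℝ) (t : Fin m → ℝ) : Fin 2 → Fin m → ℝ := ![s • t, 0]

/-- Coefficients of the product of two difference quotients. -/
def quotCoeff₂ (s : ℝ) : Fin 4 → ℂ :=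
  ![(s : ℂ)⁻¹ * (s : ℂ)⁻¹, -((s : ℂ)⁻¹ * (s : ℂ)⁻¹), -((s : ℂ)⁻¹ * (s : ℂ)⁻¹),
    (s : ℂ)⁻¹ * (s : ℂ)⁻¹]

/-- Frequencies of the product of two difference quotients. -/
def quotFreq₂ (s : ℝ) (t r : Fin m → ℝ) : Fin 4 → Fin m → ℝ := ![s • t + s • r, s • t, s • r, 0]

theorem trigEval_quot (s : ℝ) (t a : Fin m → ℝ) :
    trigEval (quotCoeff s) (quotFreq s t) a
      = (s : ℂ)⁻¹ * (Complex.exp (Complex.I * ((s * ∑ j, t j * a j : ℝ) : ℂ)) - 1) := by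
  simp only [trigEval, Fin.sum_univ_two, quotCoeff, quotFreq, Matrix.cons_val_zero,
    Matrix.cons_val_one, Pi.smul_apply, smul_eq_mul, Pi.zero_apply, zero_mul, mul_assoc,
    Finset.mul_sum, Finset.sum_const_zero, Complex.ofReal_zero, mul_zero, Complex.exp_zero]
  ring

theorem trigEval_quot₂ (s : ℝ) (t r a : Fin m → ℝ) :
    trigEval (quotCoeff₂ s) (quotFreq₂ s t r) a
      = trigEval (quotCoeff s) (quotFreq s t) a * trigEval (quotCoeff s) (quotFreq s r) a := by
  have h : Complex.exp (Complex.I * ((∑ j, (s • t + s • r) j * a j : ℝ) : ℂ))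
      = Complex.exp (Complex.I * ((s * ∑ j, t j * a j : ℝ) : ℂ))
        * Complex.exp (Complex.I * ((s * ∑ j, r j * a j : ℝ) : ℂ)) := by
    rw [← Complex.exp_add, ← mul_add, ← Complex.ofReal_add, ← mul_add, ← Finset.sum_add_distrib,
      Finset.mul_sum]
    congr 4
    ext j
    simp
    ring
  have h' : ∀ t : Fin m → ℝ, ∑ j, (s • t) j * a j = s * ∑ j, t j * a j := fun t => by
    simp [Finset.mul_sum, mul_assoc]
  rw [trigEval_quot, trigEval_quot, trigEval, Fin.sum_univ_four]
  simp only [quotCoeff₂, quotFreq₂, Matrix.cons_val]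
  rw [h, h', h']
  simp only [Pi.zero_apply, zero_mul, Finset.sum_const_zero, Complex.ofReal_zero, mul_zero,
    Complex.exp_zero]
  ring

theorem trigApply_quot (hU : IsJointUnitaryGroup A U) (s : ℝ) (t : Fin m → ℝ) (f : HSpace n) :
    trigApply U (quotCoeff s) (quotFreq s t) f = s⁻¹ • (U (s • t) f - f) := by
  simp only [trigApply, Fin.sum_univ_two, quotCoeff, quotFreq, Matrix.cons_val_zero,
    Matrix.cons_val_one, hU.zero_apply]
  rw [neg_smul, ← sub_eq_add_neg, ← smul_sub, real_smul_eq]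
  simp

theorem trigApply_quot₂ (hU : IsJointUnitaryGroup A U) (s : ℝ) (t r : Fin m → ℝ) (f : HSpace n) :
    trigApply U (quotCoeff₂ s) (quotFreq₂ s t r) f
      = (s⁻¹ * s⁻¹) • (U (s • t) (U (s • r) f - f) - (U (s • r) f - f)) := by
  simp only [trigApply, Fin.sum_univ_four, quotCoeff₂, quotFreq₂, Matrix.cons_val, hU.zero_apply,
    hU.map_add]
  rw [real_smul_eq, map_sub, Complex.ofReal_mul, Complex.ofReal_inv]
  simp only [neg_smul, smul_sub]
  abel

theorem norm_trigEval_quot_le {s : ℝ} (hs : s ≠ 0) (t a : Fin m → ℝ) :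
    ‖trigEval (quotCoeff s) (quotFreq s t) a‖ ≤ ‖Complex.I * ((∑ j, t j * a j : ℝ) : ℂ)‖ := by
  rw [trigEval_quot, norm_mul, norm_mul, Complex.norm_I, one_mul, norm_inv, Complex.norm_real,
    Complex.norm_real, inv_mul_le_iff₀ (norm_pos_iff.2 hs), ← norm_mul]
  exact Real.norm_exp_I_mul_ofReal_sub_one_le

theorem tendsto_trigEval_quot {s : ℕ → ℝ} (hs : Tendsto s atTop (𝓝[≠] 0)) (t a : Fin m → ℝ) :
    Tendsto (fun N => trigEval (quotCoeff (s N)) (quotFreq (s N) t) a) atTop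
      (𝓝 (Complex.I * ((∑ j, t j * a j : ℝ) : ℂ))) := by
  set x := ∑ j, t j * a j
  have h1 : HasDerivAt (fun s : ℝ => Complex.exp (Complex.I * ((s * x : ℝ) : ℂ)))
      (Complex.I * (x : ℂ)) 0 := by
    have h2 : HasDerivAt (fun s : ℝ => ((s * x : ℝ) : ℂ)) ((1 * x : ℝ) : ℂ) 0 :=
      ((hasDerivAt_id (0 : ℝ)).mul_const x).ofReal_comp
    have h3 := (h2.const_mul Complex.I).cexp
    simpa using h3
  refine (h1.tendsto_slope_zero.comp hs).congr fun N => ?_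
  rw [trigEval_quot]
  simp [← Complex.coe_smul, x]

theorem tendsto_inv_nat_add_one :
    Tendsto (fun N : ℕ => ((N : ℝ) + 1)⁻¹) atTop (𝓝[≠] 0) := by
  refine tendsto_nhdsWithin_iff.2 ⟨?_, Eventually.of_forall fun N => ?_⟩
  · simpa using tendsto_one_div_add_atTop_nhds_zero_nat (𝕜 := ℝ)
  · exact (inv_pos.2 (by positivity : (0 : ℝ) < N + 1)).ne'

/-! ### First and second moments of outcomes and of their products. -/

section Moments

variable {ι : Type*} {f : ι → HSpace n} {μ : Measure (Fin m → ℝ)} [IsProbabilityMeasure μ]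
  {φ : ι → ℕ → Core n}

theorem lintegral_sq_le (hU : IsJointUnitaryGroup A U) (hf : Summable fun i => ‖f i‖ ^ 2)
    (hμ : ∀ t : Fin m → ℝ,
      ∫ a, Complex.exp (Complex.I * ((∑ j, t j * a j : ℝ) : ℂ)) ∂μ = ∑' i, ⟪f i, U t (f i)⟫_ℂ)
    (hφ : ∀ i, Tendsto (fun k => toL2 (φ i k)) atTop (𝓝 (f i))) (j : Fin m) {h : ι → HSpace n}
    (hh : ∀ i, Tendsto (fun k => toL2 (A j (φ i k))) atTop (𝓝 (h i)))
    (hs : Summable fun i => ‖h i‖ ^ 2) :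
    ∫⁻ a, ‖a j‖ₑ ^ 2 ∂μ ≤ ENNReal.ofReal (∑' i, ‖h i‖ ^ 2) := by
  have h1 := lintegral_le_of_tendsto_trigEval hU.map_add hf hμ
    (fun N => quotCoeff ((N : ℝ) + 1)⁻¹) (fun N => quotFreq ((N : ℝ) + 1)⁻¹ (Pi.single j 1)) hs
    (fun N i => ?_) (fun a => tendsto_trigEval_quot tendsto_inv_nat_add_one (Pi.single j 1) a)
  · refine le_trans (le_of_eq (lintegral_congr fun a => ?_)) h1
    rw [enorm_mul]
    simp [Pi.single_apply, ← ofReal_norm]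
  · have hN : (0 : ℝ) < ((N : ℝ) + 1)⁻¹ := by positivity
    rw [trigApply_quot hU, norm_smul, norm_inv, inv_mul_le_iff₀ (norm_pos_iff.2 hN.ne'), mul_comm]
    refine hU.norm_sub_le (φ := φ i) _ (hφ i) ?_ _
    simpa [Pi.single_apply] using hh i

/-- The product of two difference quotients tends to −aⱼaₗ, while its vector counterpart is bounded
by ‖AⱼAₗf‖. Only this upper bound on the fourth-order moment is needed, since it serves as a
variance bound. -/
theorem lintegral_mul_sq_le (hU : IsJointUnitaryGroup A U) (hf : Summable fun i => ‖f i‖ ^ 2)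
    (hμ : ∀ t : Fin m → ℝ,
      ∫ a, Complex.exp (Complex.I * ((∑ j, t j * a j : ℝ) : ℂ)) ∂μ = ∑' i, ⟪f i, U t (f i)⟫_ℂ)
    (hφ : ∀ i, Tendsto (fun k => toL2 (φ i k)) atTop (𝓝 (f i))) (j l : Fin m) {h : ι → HSpace n}
    (hh : ∀ i, Tendsto (fun k => toL2 (A j (A l (φ i k)))) atTop (𝓝 (h i)))
    (hs : Summable fun i => ‖h i‖ ^ 2) :
    ∫⁻ a, ‖a j * a l‖ₑ ^ 2 ∂μ ≤ ENNReal.ofReal (∑' i, ‖h i‖ ^ 2) := by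
  have h1 := lintegral_le_of_tendsto_trigEval hU.map_add hf hμ
    (fun N => quotCoeff₂ ((N : ℝ) + 1)⁻¹)
    (fun N => quotFreq₂ ((N : ℝ) + 1)⁻¹ (Pi.single j 1) (Pi.single l 1)) hs
    (fun N i => ?_) (P := fun a => (Complex.I * ((∑ k, (Pi.single j 1 : Fin m → ℝ) k * a k : ℝ) : ℂ))
      * (Complex.I * ((∑ k, (Pi.single l 1 : Fin m → ℝ) k * a k : ℝ) : ℂ))) (fun a => ?_)
  · refine le_trans (le_of_eq (lintegral_congr fun a => ?_)) h1
    rw [enorm_mul, enorm_mul, enorm_mul, enorm_mul]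
    simp [Pi.single_apply, ← ofReal_norm]
  · have hN : (0 : ℝ) < ((N : ℝ) + 1)⁻¹ := by positivity
    rw [trigApply_quot₂ hU, norm_smul, norm_mul, norm_inv, mul_assoc,
      inv_mul_le_iff₀ (norm_pos_iff.2 hN.ne'), inv_mul_le_iff₀ (norm_pos_iff.2 hN.ne')]
    have h2 := hU.norm_sub_sub_le (φ := φ i) (Pi.single j 1) (Pi.single l 1) (hφ i) (h := h i)
      (by simpa [Pi.single_apply] using hh i) ((N : ℝ) + 1)⁻¹
    rw [Real.norm_eq_abs]
    linarith
  · simp only [trigEval_quot₂]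
    exact (tendsto_trigEval_quot tendsto_inv_nat_add_one _ a).mul
      (tendsto_trigEval_quot tendsto_inv_nat_add_one _ a)

omit [IsProbabilityMeasure μ] in
theorem memLp_coord {j : Fin m} {b : ℝ}
    (h : ∫⁻ a, ‖a j‖ₑ ^ 2 ∂μ ≤ ENNReal.ofReal b) : MemLp (fun a : Fin m → ℝ => a j) 2 μ := by
  refine ⟨(measurable_pi_apply j).aestronglyMeasurable, ?_⟩
  rw [eLpNorm_lt_top_iff_lintegral_rpow_enorm_lt_top (by norm_num) (by norm_num)]
  refine lt_of_le_of_lt ?_ ENNReal.ofReal_lt_top (b := ENNReal.ofReal b)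
  refine le_trans (le_of_eq (lintegral_congr fun a => ?_)) h
  norm_num

theorem integral_coord_eq (hU : IsJointUnitaryGroup A U) (hf : Summable fun i => ‖f i‖ ^ 2)
    (hμ : ∀ t : Fin m → ℝ,
      ∫ a, Complex.exp (Complex.I * ((∑ j, t j * a j : ℝ) : ℂ)) ∂μ = ∑' i, ⟪f i, U t (f i)⟫_ℂ)
    (hφ : ∀ i, Tendsto (fun k => toL2 (φ i k)) atTop (𝓝 (f i))) (j : Fin m) {h : ι → HSpace n}
    (hh : ∀ i, Tendsto (fun k => toL2 (A j (φ i k))) atTop (𝓝 (h i)))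
    (hs : Summable fun i => ‖h i‖ ^ 2) :
    ((∫ a, a j ∂μ : ℝ) : ℂ) = ∑' i, ⟪f i, h i⟫_ℂ := by
  have hint := (memLp_coord (lintegral_sq_le hU hf hμ hφ j hh hs)).integrable (by norm_num)
  -- The mean is the pairing of the constant 1, a trigonometric polynomial with the single frequency
  -- 0, with the difference quotient.
  have h1 := integral_conj_mul_of_tendsto_trigEval hU.map_add hf hμ
    (fun _ (_ : Unit) => (1 : ℂ)) (fun _ _ => 0)
    (fun N => quotCoeff ((N : ℝ) + 1)⁻¹) (fun N => quotFreq ((N : ℝ) + 1)⁻¹ (Pi.single j 1))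
    (v := f) (w := fun i => Complex.I • h i) hf (by simpa [norm_smul] using hs)
    (fun N i => by simp [trigApply, hU.zero_apply]) (fun N i => ?_)
    (fun i => by simp [trigApply, hU.zero_apply]) (fun i => ?_) (P := fun _ => 1)
    (fun a => by simp [trigEval]) (fun a => tendsto_trigEval_quot tendsto_inv_nat_add_one _ a)
    (fun N a => by simp [trigEval]) (fun N a => norm_trigEval_quot_le (by positivity) _ a) ?_
  · simp only [inner_smul_right, map_one, one_mul] at h1
    rw [integral_const_mul, tsum_mul_left, integral_complex_ofReal] at h1
    have h2 := mul_left_cancel₀ Complex.I_ne_zero h1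
    rw [← h2]
    simp [Pi.single_apply]
  · have hN : (0 : ℝ) < ((N : ℝ) + 1)⁻¹ := by positivity
    rw [trigApply_quot hU, norm_smul, norm_smul, Complex.norm_I, one_mul, norm_inv,
      inv_mul_le_iff₀ (norm_pos_iff.2 hN.ne'), mul_comm]
    refine hU.norm_sub_le (φ := φ i) _ (hφ i) ?_ _
    simpa [Pi.single_apply] using hh i
  · simp only [trigApply_quot hU]
    refine hU.tendsto_quotient (φ := φ i) _ (hφ i) ?_ tendsto_inv_nat_add_one
    simpa [Pi.single_apply] using hh i
  · simpa [Pi.single_apply] using (hint.ofReal (𝕜 := ℂ)).const_mul Complex.I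

/-- Pair two first-order quotients: the factors i and its conjugate cancel, leaving ⟨Aⱼf, Aₗf⟩. -/
theorem integral_coord_mul_eq (hU : IsJointUnitaryGroup A U) (hf : Summable fun i => ‖f i‖ ^ 2)
    (hμ : ∀ t : Fin m → ℝ,
      ∫ a, Complex.exp (Complex.I * ((∑ j, t j * a j : ℝ) : ℂ)) ∂μ = ∑' i, ⟪f i, U t (f i)⟫_ℂ)
    (hφ : ∀ i, Tendsto (fun k => toL2 (φ i k)) atTop (𝓝 (f i))) (j l : Fin m) {h h' : ι → HSpace n}
    (hh : ∀ i, Tendsto (fun k => toL2 (A j (φ i k))) atTop (𝓝 (h i)))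
    (hs : Summable fun i => ‖h i‖ ^ 2)
    (hh' : ∀ i, Tendsto (fun k => toL2 (A l (φ i k))) atTop (𝓝 (h' i)))
    (hs' : Summable fun i => ‖h' i‖ ^ 2) :
    ((∫ a, a j * a l ∂μ : ℝ) : ℂ) = ∑' i, ⟪h i, h' i⟫_ℂ := by
  have hint := (memLp_coord (lintegral_sq_le hU hf hμ hφ j hh hs)).integrable_mul
    (memLp_coord (lintegral_sq_le hU hf hμ hφ l hh' hs'))
  have key : ∀ (j : Fin m) (h : ι → HSpace n),
      (∀ i, Tendsto (fun k => toL2 (A j (φ i k))) atTop (𝓝 (h i))) →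
      (∀ (N : ℕ) i, ‖trigApply U (quotCoeff ((N : ℝ) + 1)⁻¹)
        (quotFreq ((N : ℝ) + 1)⁻¹ (Pi.single j 1)) (f i)‖ ≤ ‖Complex.I • h i‖) ∧
      ∀ i, Tendsto (fun N : ℕ => trigApply U (quotCoeff ((N : ℝ) + 1)⁻¹)
        (quotFreq ((N : ℝ) + 1)⁻¹ (Pi.single j 1)) (f i)) atTop (𝓝 (Complex.I • h i)) := by
    refine fun j h hh => ⟨fun N i => ?_, fun i => ?_⟩
    · have hN : (0 : ℝ) < ((N : ℝ) + 1)⁻¹ := by positivity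
      rw [trigApply_quot hU, norm_smul, norm_smul, Complex.norm_I, one_mul, norm_inv,
        inv_mul_le_iff₀ (norm_pos_iff.2 hN.ne'), mul_comm]
      refine hU.norm_sub_le (φ := φ i) _ (hφ i) ?_ _
      simpa [Pi.single_apply] using hh i
    · simp only [trigApply_quot hU]
      refine hU.tendsto_quotient (φ := φ i) _ (hφ i) ?_ tendsto_inv_nat_add_one
      simpa [Pi.single_apply] using hh i
  have h1 := integral_conj_mul_of_tendsto_trigEval hU.map_add hf hμ
    (fun N => quotCoeff ((N : ℝ) + 1)⁻¹) (fun N => quotFreq ((N : ℝ) + 1)⁻¹ (Pi.single j 1))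
    (fun N => quotCoeff ((N : ℝ) + 1)⁻¹) (fun N => quotFreq ((N : ℝ) + 1)⁻¹ (Pi.single l 1))
    (v := fun i => Complex.I • h i) (w := fun i => Complex.I • h' i)
    (by simpa [norm_smul] using hs) (by simpa [norm_smul] using hs')
    (key j h hh).1 (key l h' hh').1 (key j h hh).2 (key l h' hh').2
    (fun a => tendsto_trigEval_quot tendsto_inv_nat_add_one _ a)
    (fun a => tendsto_trigEval_quot tendsto_inv_nat_add_one _ a)
    (fun N a => norm_trigEval_quot_le (by positivity) _ a)
    (fun N a => norm_trigEval_quot_le (by positivity) _ a) ?_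
  · rw [← integral_complex_ofReal]
    refine Eq.trans (integral_congr_ae (Eventually.of_forall fun a => ?_)) (h1.trans
      (tsum_congr fun i => ?_))
    · simp only [Pi.single_apply, ite_mul, one_mul, zero_mul, Finset.sum_ite_eq',
        Finset.mem_univ, if_true, map_mul, Complex.conj_I, Complex.conj_ofReal, Complex.ofReal_mul]
      linear_combination ((a j : ℂ) * a l) * Complex.I_sq
    · rw [inner_smul_left, inner_smul_right, ← mul_assoc]
      simp
  · refine ((hint.ofReal (𝕜 := ℂ)).const_mul (-1)).congr (Eventually.of_forall fun a => ?_)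
    simp [Pi.single_apply]
    linear_combination (-(a j : ℂ) * a l) * Complex.I_sq

end Moments

end Born

end CVTomo

end

noncomputable section

namespace CVTomo

/-! ### States of finite second moment of the energy -/

section EnergyState

open Filter Topology

variable {n : ℕ}

theorem opSqrt_mul_opSqrt {H : Type*} [NormedAddCommGroup H] [InnerProductSpace ℂ H]
    [CompleteSpace H] {T : H →L[ℂ] H} (hT : T.IsPositive) : opSqrt T * opSqrt T = T :=
  CFC.sqrt_mul_sqrt_self T ((ContinuousLinearMap.nonneg_iff_isPositive _).2 hT)

theorem opSqrt_isPositive {H : Type*} [NormedAddCommGroup H] [InnerProductSpace ℂ H]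
    [CompleteSpace H] (T : H →L[ℂ] H) : (opSqrt T).IsPositive :=
  (ContinuousLinearMap.nonneg_iff_isPositive _).1 (CFC.sqrt_nonneg T)

theorem State.norm_sq_vec (ρ : State n) (i : onbIndex n) :
    ‖ρ.vec i‖ ^ 2 = (⟪onb n i, ρ.op (onb n i)⟫_ℂ).re := by
  have h1 := opSqrt_mul_opSqrt ρ.isPositive
  have h2 := opSqrt_isPositive ρ.op
  have h3 : ⟪ρ.vec i, ρ.vec i⟫_ℂ = ⟪onb n i, ρ.op (onb n i)⟫_ℂ := by
    conv_rhs => rw [← h1]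
    exact h2.isSymmetric _ _
  rw [← h3, inner_self_eq_norm_sq_to_K]
  norm_cast

theorem State.hasSum_norm_sq_vec (ρ : State n) : HasSum (fun i => ‖ρ.vec i‖ ^ 2) 1 := by
  have h := Complex.hasSum_re ρ.trace_eq_one
  simpa [← State.norm_sq_vec] using h

/-- The vectors `√ρ eᵢ` together with the values of the energy, of the quadratures and of their
products, for a state with `Tr[ρ Ê²] ≤ (n E)²`. -/
structure EnergyBound (ρ : State n) (E : ℝ) (φ : onbIndex n → ℕ → Core n)
    (g : onbIndex n → HSpace n) (r : onbIndex n → QIdx n → HSpace n)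
    (w : onbIndex n → QIdx n → QIdx n → HSpace n) : Prop where
  lim : ∀ i, IsEnergyLimit (φ i) (ρ.vec i) (g i) (r i) (w i)
  summable : Summable fun i => ‖g i‖ ^ 2
  tsum_le : ∑' i, ‖g i‖ ^ 2 ≤ (n * E) ^ 2

/-- `opNormSq` is infinite outside the domain, so a finite second moment puts every √ρ eᵢ in the
domain of the energy. -/
theorem exists_energyBound (ρ : State n) {E : ℝ} (hE : 0 ≤ E)
    (h : (ρ.secondMoment (energyOp n)) ^ (1 / 2 : ℝ) ≤ ENNReal.ofReal (n * E)) :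
    ∃ φ g r w, EnergyBound ρ E φ g r w := by
  have h1 : ρ.secondMoment (energyOp n) ≤ ENNReal.ofReal ((n * E) ^ 2) := by
    have h2 := ENNReal.rpow_le_rpow h (by norm_num : (0 : ℝ) ≤ 2)
    rwa [← ENNReal.rpow_mul, show (1 / 2 : ℝ) * 2 = 1 by norm_num, ENNReal.rpow_one,
      ENNReal.rpow_two, ← ENNReal.ofReal_pow (by positivity)] at h2
  have htop : ∀ i, opNormSq (energyOp n) (ρ.vec i) ≠ ⊤ :=
    ENNReal.ne_top_of_tsum_ne_top (ne_top_of_le_ne_top ENNReal.ofReal_ne_top h1)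
  have hval : ∀ i, ∃ g, IsValue (energyOp n) (ρ.vec i) g := fun i => by
    by_contra hc
    exact htop i (by rw [opNormSq, if_neg hc])
  choose g hg using hval
  have hn : ∀ i, opNormSq (energyOp n) (ρ.vec i) = ENNReal.ofReal (‖g i‖ ^ 2) := fun i => by
    rw [opNormSq, if_pos ⟨g i, hg i⟩, opApply_eq (hg i), ENNReal.ofReal_pow (norm_nonneg _),
      ofReal_norm]
  have h3 : ∑' i, ENNReal.ofReal (‖g i‖ ^ 2) ≤ ENNReal.ofReal ((n * E) ^ 2) := by
    simp_rw [← hn]; exact h1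
  have hsum : Summable fun i => ‖g i‖ ^ 2 := by
    have h4 := ENNReal.summable_toReal (ne_top_of_le_ne_top ENNReal.ofReal_ne_top h3)
    refine h4.congr fun i => ?_
    rw [ENNReal.toReal_ofReal (by positivity)]
  rw [← ENNReal.ofReal_tsum_of_nonneg (fun _ => by positivity) hsum,
    ENNReal.ofReal_le_ofReal_iff (by positivity)] at h3
  choose φ r w hl using fun i => exists_isEnergyLimit (hg i)
  exact ⟨φ, g, r, w, hl, hsum, h3⟩

namespace EnergyBound

variable {ρ : State n} {E : ℝ} {φ : onbIndex n → ℕ → Core n}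
    {g : onbIndex n → HSpace n} {r : onbIndex n → QIdx n → HSpace n}
    {w : onbIndex n → QIdx n → QIdx n → HSpace n}

/-- Young's inequality in place of a product of norms makes the bound summable over i; the weight a
is chosen later. -/
theorem sum_norm_sq_quad_le (h : EnergyBound ρ E φ g r w) {a : ℝ} (ha : 0 < a) (i : onbIndex n) :
    ∑ k, ‖r i k‖ ^ 2 ≤ a * ‖ρ.vec i‖ ^ 2 + a⁻¹ * ‖g i‖ ^ 2 := by
  refine ((h.lim i).sum_norm_sq_quad_le).trans ?_
  have h1 : 0 ≤ a⁻¹ * (a * ‖ρ.vec i‖ - ‖g i‖) ^ 2 := by positivity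
  have h2 : a⁻¹ * (a * ‖ρ.vec i‖ - ‖g i‖) ^ 2
      = a * ‖ρ.vec i‖ ^ 2 + a⁻¹ * ‖g i‖ ^ 2 - 2 * (‖ρ.vec i‖ * ‖g i‖) := by
    field_simp; ring
  linarith

theorem summable_quad (h : EnergyBound ρ E φ g r w) (k : QIdx n) :
    Summable fun i => ‖r i k‖ ^ 2 := by
  refine Summable.of_nonneg_of_le (fun _ => by positivity) (fun i => ?_)
    ((ρ.hasSum_norm_sq_vec.summable.mul_left 1).add (h.summable.mul_left 1⁻¹))
  exact (Finset.single_le_sum (f := fun k => ‖r i k‖ ^ 2) (fun _ _ => by positivity)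
    (Finset.mem_univ k)).trans (h.sum_norm_sq_quad_le one_pos i)

theorem tsum_quad_le (h : EnergyBound ρ E φ g r w) {a : ℝ} (ha : 0 < a) :
    ∑ k, ∑' i, ‖r i k‖ ^ 2 ≤ a + a⁻¹ * (n * E) ^ 2 := by
  have h1 := hasSum_sum (s := Finset.univ) fun k _ => (h.summable_quad k).hasSum
  refine (hasSum_le (h.sum_norm_sq_quad_le ha) h1 ((ρ.hasSum_norm_sq_vec.mul_left a).add
    (h.summable.hasSum.mul_left a⁻¹))).trans ?_
  rw [mul_one]
  gcongr
  exact h.tsum_le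

theorem le_tsum_quad (h : EnergyBound ρ E φ g r w) : (n : ℝ) ≤ ∑ k, ∑' i, ‖r i k‖ ^ 2 := by
  have h1 := hasSum_sum (s := Finset.univ) fun k _ => (h.summable_quad k).hasSum
  have h2 := hasSum_le (fun i => (h.lim i).le_sum_norm_sq_quad)
    (ρ.hasSum_norm_sq_vec.mul_left (n : ℝ)) h1
  simpa using h2

/-- The zero-point energy forces E ≥ 1/2. This makes nE positive and lets lower-order terms be
absorbed in n²E². -/
theorem half_le (h : EnergyBound ρ E φ g r w) (hn : 1 ≤ n) (hE : 0 ≤ E) : 1 / 2 ≤ E := by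
  have hn' : (1 : ℝ) ≤ n := by exact_mod_cast hn
  by_contra! hlt
  -- With a = n/2 the bounds read n ≤ n/2 + 2nE², which contradicts E < 1/2.
  have h1 := h.le_tsum_quad.trans (h.tsum_quad_le (a := n / 2) (by positivity))
  have h2 : ((n : ℝ) / 2)⁻¹ * (n * E) ^ 2 = 2 * n * E ^ 2 := by field_simp
  rw [h2] at h1
  have h3 : E ^ 2 < 1 / 4 := by nlinarith
  nlinarith

/-- The weight a = nE minimises a + (nE)²/a. -/
theorem tsum_quad_le_energy (h : EnergyBound ρ E φ g r w) (hn : 1 ≤ n) (hE : 0 ≤ E) :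
    ∑ k, ∑' i, ‖r i k‖ ^ 2 ≤ 2 * n * E := by
  have hn' : (1 : ℝ) ≤ n := by exact_mod_cast hn
  have hE' := h.half_le hn hE
  refine (h.tsum_quad_le (a := n * E) (by positivity)).trans (le_of_eq ?_)
  have : (n : ℝ) * E ≠ 0 := by positivity
  field_simp
  ring

theorem summable_quad_quad (h : EnergyBound ρ E φ g r w) (k l : QIdx n) :
    Summable fun i => ‖w i k l‖ ^ 2 := by
  refine Summable.of_nonneg_of_le (fun _ => by positivity) (fun i => ?_)
    ((h.summable.mul_left 4).add (ρ.hasSum_norm_sq_vec.summable.mul_left (2 * n : ℝ)))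
  rw [← (h.lim i).sum_norm_sq_quad_quad]
  exact (Finset.single_le_sum (f := fun l => ‖w i k l‖ ^ 2)
    (fun _ _ => by positivity) (Finset.mem_univ l)).trans
    (Finset.single_le_sum (f := fun k => ∑ l, ‖w i k l‖ ^ 2)
      (fun _ _ => by positivity) (Finset.mem_univ k))

theorem norm_sq_add_le (x y : HSpace n) : ‖x + y‖ ^ 2 ≤ 2 * ‖x‖ ^ 2 + 2 * ‖y‖ ^ 2 := by
  have h1 := norm_add_le x y
  nlinarith [norm_nonneg (x + y), sq_nonneg (‖x‖ - ‖y‖)]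

theorem summable_anticomm (h : EnergyBound ρ E φ g r w) (k l : QIdx n) :
    Summable fun i => ‖w i k l + w i l k‖ ^ 2 :=
  Summable.of_nonneg_of_le (fun _ => by positivity) (fun _ => norm_sq_add_le _ _)
    (((h.summable_quad_quad k l).mul_left 2).add ((h.summable_quad_quad l k).mul_left 2))

theorem tsum_anticomm_le (h : EnergyBound ρ E φ g r w) :
    ∑ k, ∑ l, ∑' i, ‖w i k l + w i l k‖ ^ 2 ≤ 16 * (n * E) ^ 2 + 8 * n := by
  have h1 := hasSum_sum (s := Finset.univ) fun k _ =>
    hasSum_sum (s := Finset.univ) fun l _ => (h.summable_anticomm k l).hasSum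
  have h2 : ∀ i, ∑ k, ∑ l, ‖w i k l + w i l k‖ ^ 2
      ≤ 16 * ‖g i‖ ^ 2 + 8 * n * ‖ρ.vec i‖ ^ 2 := fun i => by
    calc ∑ k, ∑ l, ‖w i k l + w i l k‖ ^ 2
        ≤ ∑ k, ∑ l, (2 * ‖w i k l‖ ^ 2 + 2 * ‖w i l k‖ ^ 2) :=
          Finset.sum_le_sum fun k _ => Finset.sum_le_sum fun l _ => norm_sq_add_le _ _
      _ = 2 * ∑ k, ∑ l, ‖w i k l‖ ^ 2 + 2 * ∑ k, ∑ l, ‖w i l k‖ ^ 2 := by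
          simp only [Finset.sum_add_distrib, Finset.mul_sum]
      _ = 16 * ‖g i‖ ^ 2 + 8 * n * ‖ρ.vec i‖ ^ 2 := by
          rw [Finset.sum_comm (f := fun k l => ‖w i l k‖ ^ 2), (h.lim i).sum_norm_sq_quad_quad]
          ring
  refine (hasSum_le h2 h1 ((h.summable.hasSum.mul_left 16).add
    (ρ.hasSum_norm_sq_vec.mul_left (8 * n : ℝ)))).trans ?_
  have := h.tsum_le
  linarith

/-! ### Expectations, Gram matrix and uncertainty relation. -/

theorem expect_quad (h : EnergyBound ρ E φ g r w) (k : QIdx n) :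
    ρ.expect (quad k) = (∑' i, ⟪ρ.vec i, r i k⟫_ℂ).re := by
  unfold State.expect
  simp_rw [(h.lim _).opApply_quad]

theorem expect_anticomm (h : EnergyBound ρ E φ g r w) (k l : QIdx n) :
    ρ.expect (anticomm (quad k) (quad l)) = (∑' i, ⟪ρ.vec i, w i k l + w i l k⟫_ℂ).re := by
  unfold State.expect
  simp_rw [(h.lim _).opApply_anticomm]

theorem summable_inner {v v' : onbIndex n → HSpace n} (hv : Summable fun i => ‖v i‖ ^ 2)
    (hv' : Summable fun i => ‖v' i‖ ^ 2) : Summable fun i => ⟪v i, v' i⟫_ℂ := by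
  refine Summable.of_norm_bounded (hv.add hv') fun i => (norm_inner_le_norm _ _).trans ?_
  nlinarith [sq_nonneg (‖v i‖ - ‖v' i‖), sq_nonneg ‖v i‖, sq_nonneg ‖v' i‖]

theorem hasSum_inner_quad (h : EnergyBound ρ E φ g r w) (k : QIdx n) :
    HasSum (fun i => ⟪ρ.vec i, r i k⟫_ℂ) (ρ.mean k : ℂ) := by
  have h1 := (summable_inner ρ.hasSum_norm_sq_vec.summable (h.summable_quad k)).hasSum
  have h2 : ∀ i, (starRingEnd ℂ) ⟪ρ.vec i, r i k⟫_ℂ = ⟪ρ.vec i, r i k⟫_ℂ := fun i => by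
    rw [inner_conj_symm]
    exact tendsto_nhds_unique (((h.lim i).quad k).inner (h.lim i).tendsto)
      (((h.lim i).tendsto.inner ((h.lim i).quad k)).congr fun m => (quad_symm k _ _).symm)
  have h3 : (starRingEnd ℂ) (∑' i, ⟪ρ.vec i, r i k⟫_ℂ) = ∑' i, ⟪ρ.vec i, r i k⟫_ℂ := by
    rw [Complex.conj_tsum]
    exact tsum_congr h2
  have h4 : ((ρ.mean k : ℝ) : ℂ) = ∑' i, ⟪ρ.vec i, r i k⟫_ℂ := by
    rw [← Complex.conj_eq_iff_re.1 h3, ← h.expect_quad k]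
    rfl
  rw [h4]
  exact h1

/-- Twice a product is anticommutator plus commutator: with G = ∑ ⟨R̂ₖf, R̂ₗf⟩, the sum of G and its
conjugate is the expectation, and their difference is iΩₖₗ by the commutation relation and unit
trace. -/
theorem hasSum_inner_quad_quad (h : EnergyBound ρ E φ g r w) (k l : QIdx n) :
    HasSum (fun i => 2 * ⟪r i k, r i l⟫_ℂ)
      ((ρ.expect (anticomm (quad k) (quad l)) : ℂ) + Complex.I * symplecticForm n k l) := by
  have h1 := (summable_inner (h.summable_quad k) (h.summable_quad l)).hasSum
  have h2 := (summable_inner (h.summable_quad l) (h.summable_quad k)).hasSum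
  set G := ∑' i, ⟪r i k, r i l⟫_ℂ with hG
  set G' := ∑' i, ⟪r i l, r i k⟫_ℂ with hG'
  have h3 : G' = (starRingEnd ℂ) G := by
    rw [hG, hG', Complex.conj_tsum]
    exact tsum_congr fun i => (inner_conj_symm _ _).symm
  have h4 : G - G' = Complex.I * symplecticForm n k l := by
    have h5 : HasSum (fun i => (Complex.I * symplecticForm n k l) * ((‖ρ.vec i‖ ^ 2 : ℝ) : ℂ))
        ((Complex.I * symplecticForm n k l) * ((1 : ℝ) : ℂ)) :=
      (Complex.hasSum_ofReal.2 ρ.hasSum_norm_sq_vec).mul_left _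
    rw [Complex.ofReal_one, mul_one] at h5
    refine (h1.sub h2).unique (h5.congr_fun fun i => ?_)
    rw [(h.lim i).inner_eq, (h.lim i).inner_eq, ← inner_sub_right, (h.lim i).sub_eq,
      inner_smul_right, inner_self_eq_norm_sq_to_K]
    push_cast
    rfl
  have h6 : ρ.expect (anticomm (quad k) (quad l)) = (G + G').re := by
    rw [h.expect_anticomm, ← (h1.add h2).tsum_eq]
    congr 1
    refine tsum_congr fun i => ?_
    rw [(h.lim i).inner_eq, (h.lim i).inner_eq, inner_add_right]
  have h7 : (((G + G').re : ℝ) : ℂ) = G + G' := by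
    rw [h3, Complex.add_conj, Complex.ofReal_re]
  rw [h6, h7, ← h4, show G + G' + (G - G') = 2 * G by ring]
  exact h1.mul_left 2

/-- The uncertainty relation for the covariance matrix of a state. -/
theorem uncertainty_cov (h : EnergyBound ρ E φ g r w) : Uncertainty ρ.cov := by
  -- The entries of V + iΩ are twice the summed inner products of the centred vectors (R̂ₖ − mₖ)√ρ
  -- eᵢ, so the quadratic form at z is a sum of squared norms.
  have key : ∀ k l, HasSum (fun i => 2 * ⟪r i k - (ρ.mean k : ℂ) • ρ.vec i,
      r i l - (ρ.mean l : ℂ) • ρ.vec i⟫_ℂ)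
      ((ρ.cov.map Complex.ofReal + Complex.I • (symplecticForm n).map Complex.ofReal) k l) := by
    intro k l
    have h1 := h.hasSum_inner_quad_quad k l
    have h2 := (h.hasSum_inner_quad k).mapL (Complex.conjCLE : ℂ →L[ℝ] ℂ)
    have h3 := h.hasSum_inner_quad l
    have h4 := Complex.hasSum_ofReal.2 ρ.hasSum_norm_sq_vec
    simp only [ContinuousLinearEquiv.coe_coe, Complex.conjCLE_apply, inner_conj_symm,
      Complex.conj_ofReal] at h2
    have h5 := ((h1.sub (h2.mul_left (2 * (ρ.mean l : ℂ)))).sub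
      (h3.mul_left (2 * (ρ.mean k : ℂ)))).add (h4.mul_left (2 * (ρ.mean k : ℂ) * ρ.mean l))
    have h6 : (ρ.cov.map Complex.ofReal + Complex.I • (symplecticForm n).map Complex.ofReal) k l
        = (ρ.expect (anticomm (quad k) (quad l)) : ℂ) + Complex.I * symplecticForm n k l
          - 2 * (ρ.mean l : ℂ) * ρ.mean k - 2 * (ρ.mean k : ℂ) * ρ.mean l
          + 2 * (ρ.mean k : ℂ) * ρ.mean l * ((1 : ℝ) : ℂ) := by
      simp only [State.cov, Matrix.add_apply, Matrix.map_apply, Matrix.smul_apply, Matrix.of_apply,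
        smul_eq_mul]
      push_cast
      ring
    rw [h6]
    refine h5.congr_fun fun i => ?_
    simp only [inner_sub_left, inner_sub_right, inner_smul_left, inner_smul_right,
      Complex.conj_ofReal, inner_self_eq_norm_sq_to_K]
    push_cast
    simp only [Complex.coe_algebraMap]
    ring
  refine Matrix.PosSemidef.of_dotProduct_mulVec_nonneg ?_ fun z => ?_
  · ext k l
    rw [Matrix.conjTranspose_apply]
    refine HasSum.unique ?_ (key k l)
    have h1 := (key l k).mapL (Complex.conjCLE : ℂ →L[ℝ] ℂ)
    simpa [inner_conj_symm, map_ofNat (starRingEnd ℂ) 2] using h1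
  · have h1 : HasSum (fun i => ((2 * ‖∑ k, z k • (r i k - (ρ.mean k : ℂ) • ρ.vec i)‖ ^ 2 : ℝ) : ℂ))
        (star z ⬝ᵥ ((ρ.cov.map Complex.ofReal
          + Complex.I • (symplecticForm n).map Complex.ofReal).mulVec z)) := by
      have h2 := hasSum_sum (s := Finset.univ) fun k _ => hasSum_sum (s := Finset.univ)
        fun l _ => ((key k l).mul_left ((starRingEnd ℂ) (z k) * z l))
      have h4 : star z ⬝ᵥ ((ρ.cov.map Complex.ofReal
          + Complex.I • (symplecticForm n).map Complex.ofReal).mulVec z)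
          = ∑ k, ∑ l, (starRingEnd ℂ) (z k) * z l * (ρ.cov.map Complex.ofReal
            + Complex.I • (symplecticForm n).map Complex.ofReal) k l := by
        simp only [dotProduct, Matrix.mulVec, Finset.mul_sum, Pi.star_apply, RCLike.star_def]
        exact Finset.sum_congr rfl fun k _ => Finset.sum_congr rfl fun l _ => by ring
      rw [h4]
      refine h2.congr_fun fun i => ?_
      push_cast
      have h3 : ∀ y : HSpace n, ⟪y, y⟫_ℂ = (‖y‖ : ℂ) ^ 2 := inner_self_eq_norm_sq_to_K
      rw [← h3, sum_inner, Finset.mul_sum]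
      refine Finset.sum_congr rfl fun k _ => ?_
      rw [inner_sum, Finset.mul_sum]
      refine Finset.sum_congr rfl fun l _ => ?_
      rw [inner_smul_left, inner_smul_right]
      ring
    rw [← h1.tsum_eq, ← Complex.ofReal_tsum]
    exact Complex.zero_le_real.2 (tsum_nonneg fun i => by positivity)

end EnergyBound

end EnergyState

end CVTomo

end

noncomputable section

namespace CVTomo

/-! ### Moments of the outcomes of each round -/

section Sampling

open Filter Topology

variable {n : ℕ}

/-- Under `μ`, the function `F` is square integrable with mean `T` and second moment at most `v`. -/
structure HasMoments {α : Type*} [MeasurableSpace α] (μ : Measure α) (F : α → ℝ) (T v : ℝ) :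
    Prop where
  memLp : MemLp F 2 μ
  mean : ∫ a, F a ∂μ = T
  sq_le : ∫ a, F a ^ 2 ∂μ ≤ v

theorem memLp_and_integral_sq_le {α : Type*} [MeasurableSpace α] {μ : Measure α} {F : α → ℝ}
    (hF : Measurable F) {b : ℝ} (hb : 0 ≤ b) (h : ∫⁻ a, ‖F a‖ₑ ^ 2 ∂μ ≤ ENNReal.ofReal b) :
    MemLp F 2 μ ∧ ∫ a, F a ^ 2 ∂μ ≤ b := by
  refine ⟨⟨hF.aestronglyMeasurable, ?_⟩, ?_⟩
  · rw [eLpNorm_lt_top_iff_lintegral_rpow_enorm_lt_top (by norm_num) (by norm_num)]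
    refine lt_of_le_of_lt ?_ ENNReal.ofReal_lt_top (b := ENNReal.ofReal b)
    refine le_trans (le_of_eq (lintegral_congr fun a => ?_)) h
    norm_num
  · rw [integral_eq_lintegral_of_nonneg_ae (Eventually.of_forall fun a => by positivity)
      (hF.pow_const 2).aestronglyMeasurable]
    refine ENNReal.toReal_le_of_le_ofReal hb (le_trans (le_of_eq (lintegral_congr fun a => ?_)) h)
    rw [← sq_abs, ENNReal.ofReal_pow (abs_nonneg _), ← Real.norm_eq_abs, ofReal_norm]

variable {ρ : State n} {E : ℝ} {φ : onbIndex n → ℕ → Core n}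
    {g : onbIndex n → HSpace n} {r : onbIndex n → QIdx n → HSpace n}
    {w : onbIndex n → QIdx n → QIdx n → HSpace n} {A : Fin n → CoreOp n}
    {μ : Measure (Fin n → ℝ)}

theorem HasMoments.of_quad (h : EnergyBound ρ E φ g r w) (hμ : IsBornLaw ρ A μ) {j : Fin n}
    {k : QIdx n} (hj : A j = quad k) :
    HasMoments μ (fun a => a j) (ρ.mean k) (∑' i, ‖r i k‖ ^ 2) := by
  obtain ⟨hp, U, hU, hχ⟩ := hμ
  have hf := ρ.hasSum_norm_sq_vec.summable
  have hlim : ∀ i, Tendsto (fun m => toL2 (A j (φ i m))) atTop (𝓝 (r i k)) := fun i => by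
    rw [hj]; exact (h.lim i).quad k
  obtain ⟨h1, h2⟩ := memLp_and_integral_sq_le (measurable_pi_apply j)
    (tsum_nonneg fun i => by positivity)
    (lintegral_sq_le hU hf hχ (fun i => (h.lim i).tendsto) j hlim (h.summable_quad k))
  refine ⟨h1, ?_, h2⟩
  have h3 := integral_coord_eq hU hf hχ (fun i => (h.lim i).tendsto) j hlim (h.summable_quad k)
  rw [(h.hasSum_inner_quad k).tsum_eq] at h3
  exact_mod_cast h3

/-- When Ωₖₗ = 0 the two products agree in the limit, so {R̂ₖ, R̂ₗ} acts as 2R̂ₖR̂ₗ and is sampled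
by twice the product of the outcomes. -/
theorem HasMoments.of_quad_mul_quad (h : EnergyBound ρ E φ g r w) (hμ : IsBornLaw ρ A μ)
    {j j' : Fin n} {k l : QIdx n} (hj : A j = quad k) (hj' : A j' = quad l)
    (hkl : symplecticForm n k l = 0) :
    HasMoments μ (fun a => 2 * (a j * a j')) (ρ.expect (anticomm (quad k) (quad l)))
      (∑' i, ‖w i k l + w i l k‖ ^ 2) := by
  obtain ⟨hp, U, hU, hχ⟩ := hμ
  have hf := ρ.hasSum_norm_sq_vec.summable
  have hw : ∀ i, w i k l + w i l k = (2 : ℂ) • w i k l := fun i => by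
    have h1 := (h.lim i).sub_eq k l
    rw [hkl] at h1
    simp only [Complex.ofReal_zero, mul_zero, zero_smul] at h1
    rw [← sub_eq_zero.1 h1, two_smul]
  have hn : ∑' i, ‖w i k l + w i l k‖ ^ 2 = 4 * ∑' i, ‖w i k l‖ ^ 2 := by
    rw [← tsum_mul_left]
    refine tsum_congr fun i => ?_
    rw [hw, norm_smul, mul_pow]
    norm_num
  have hlim : ∀ i, Tendsto (fun m => toL2 (A j (φ i m))) atTop (𝓝 (r i k)) := fun i => by
    rw [hj]; exact (h.lim i).quad k
  have hlim' : ∀ i, Tendsto (fun m => toL2 (A j' (φ i m))) atTop (𝓝 (r i l)) := fun i => by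
    rw [hj']; exact (h.lim i).quad l
  have hlim2 : ∀ i, Tendsto (fun m => toL2 (A j (A j' (φ i m)))) atTop (𝓝 (w i k l)) := fun i => by
    rw [hj, hj']; exact (h.lim i).quad_quad k l
  obtain ⟨h1, h2⟩ := memLp_and_integral_sq_le
    ((measurable_pi_apply j).mul (measurable_pi_apply j'))
    (tsum_nonneg fun i => by positivity)
    (lintegral_mul_sq_le hU hf hχ (fun i => (h.lim i).tendsto) j j' hlim2
      (h.summable_quad_quad k l))
  refine ⟨h1.const_mul 2, ?_, ?_⟩
  · have h3 := integral_coord_mul_eq hU hf hχ (fun i => (h.lim i).tendsto) j j' hlim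
      (h.summable_quad k) hlim' (h.summable_quad l)
    have h4 := (h.hasSum_inner_quad_quad k l).tsum_eq
    rw [tsum_mul_left, ← h3, hkl] at h4
    rw [integral_const_mul]
    have h5 : ((2 * ∫ a, a j * a j' ∂μ : ℝ) : ℂ)
        = (ρ.expect (anticomm (quad k) (quad l)) : ℂ) := by
      push_cast at h4 ⊢
      rw [h4]; simp
    exact_mod_cast h5
  · rw [hn]
    calc ∫ a, (2 * (a j * a j')) ^ 2 ∂μ = 4 * ∫ a, (a j * a j') ^ 2 ∂μ := by
          rw [← integral_const_mul]; congr 1; ext a; ring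
      _ ≤ _ := by gcongr

theorem HasMoments.of_anticomm (h : EnergyBound ρ E φ g r w) (hμ : IsBornLaw ρ A μ) {j : Fin n}
    {k l : QIdx n} (hj : A j = anticomm (quad k) (quad l)) :
    HasMoments μ (fun a => a j) (ρ.expect (anticomm (quad k) (quad l)))
      (∑' i, ‖w i k l + w i l k‖ ^ 2) := by
  obtain ⟨hp, U, hU, hχ⟩ := hμ
  have hf := ρ.hasSum_norm_sq_vec.summable
  have hlim : ∀ i, Tendsto (fun m => toL2 (A j (φ i m))) atTop (𝓝 (w i k l + w i l k)) := fun i => by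
    rw [hj]
    simp only [anticomm, LinearMap.add_apply, Module.End.mul_apply, toL2_add]
    exact ((h.lim i).quad_quad k l).add ((h.lim i).quad_quad l k)
  obtain ⟨h1, h2⟩ := memLp_and_integral_sq_le (measurable_pi_apply j)
    (tsum_nonneg fun i => by positivity)
    (lintegral_sq_le hU hf hχ (fun i => (h.lim i).tendsto) j hlim (h.summable_anticomm k l))
  refine ⟨h1, ?_, h2⟩
  have h3 := integral_coord_eq hU hf hχ (fun i => (h.lim i).tendsto) j hlim
    (h.summable_anticomm k l)
  have h4 := congrArg Complex.re h3
  rw [← h.expect_anticomm k l] at h4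
  exact_mod_cast h4

theorem anticomm_comm (X Y : CoreOp n) : anticomm X Y = anticomm Y X := add_comm _ _

theorem exists_sampler_mean (h : EnergyBound ρ E φ g r w) (k : QIdx n) :
    ∃ (R : Round n) (F : (Fin n → ℝ) → ℝ), Measurable F ∧
      (∀ (N K : ℕ) (Y : Round n → Fin N → Fin n → ℝ),
        estMean K Y k = medianOfMeans K fun s => F (Y R s)) ∧
      ∀ μ, IsBornLaw ρ R.observables μ → HasMoments μ F (ρ.mean k) (∑' i, ‖r i k‖ ^ 2) := by
  obtain ⟨i, s⟩ := k
  fin_cases s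
  · exact ⟨.position, fun a => a i, measurable_pi_apply i, fun N K Y => rfl,
      fun μ hμ => HasMoments.of_quad h hμ rfl⟩
  · exact ⟨.momentum, fun a => a i, measurable_pi_apply i, fun N K Y => rfl,
      fun μ hμ => HasMoments.of_quad h hμ rfl⟩

/-- Every anticommutator is read off from one round: commuting pairs from a product of outcomes, the
conjugate pair of a mode from the dilation. The uniform format removes the case distinction from the
probabilistic part. -/
theorem exists_sampler_second (h : EnergyBound ρ E φ g r w) (k l : QIdx n) :
    ∃ (R : Round n) (F : (Fin n → ℝ) → ℝ), Measurable F ∧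
      (∀ (N K : ℕ) (Y : Round n → Fin N → Fin n → ℝ),
        estSecond K Y k l = medianOfMeans K fun s => F (Y R s)) ∧
      ∀ μ, IsBornLaw ρ R.observables μ →
        HasMoments μ F (ρ.expect (anticomm (quad k) (quad l))) (∑' i, ‖w i k l + w i l k‖ ^ 2) := by
  have hmeas : ∀ i j : Fin n, Measurable fun a : Fin n → ℝ => 2 * (a i * a j) := fun i j =>
    ((measurable_pi_apply i).mul (measurable_pi_apply j)).const_mul 2
  obtain ⟨i, s⟩ := k
  obtain ⟨j, t⟩ := l
  fin_cases s <;> fin_cases t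
  · exact ⟨.position, _, hmeas i j, fun N K Y => rfl,
      fun μ hμ => HasMoments.of_quad_mul_quad h hμ rfl rfl (by simp [symplecticForm])⟩
  · by_cases hij : i = j
    · subst hij
      refine ⟨.dilation, fun a => a i, measurable_pi_apply i, fun N K Y => ?_,
        fun μ hμ => HasMoments.of_anticomm h hμ rfl⟩
      simp [estSecond]
    · refine ⟨.mixed j, _, hmeas i j, fun N K Y => ?_,
        fun μ hμ => HasMoments.of_quad_mul_quad h hμ (if_neg hij) (if_pos rfl)
          (by simp [symplecticForm, hij])⟩
      simp [estSecond, hij]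
  · by_cases hij : i = j
    · subst hij
      refine ⟨.dilation, fun a => a i, measurable_pi_apply i, fun N K Y => ?_,
        fun μ hμ => HasMoments.of_anticomm h hμ (anticomm_comm _ _)⟩
      simp [estSecond]
    · refine ⟨.mixed i, _, hmeas i j, fun N K Y => ?_,
        fun μ hμ => HasMoments.of_quad_mul_quad h hμ (if_pos rfl) (if_neg (Ne.symm hij))
          (by simp [symplecticForm, hij])⟩
      simp [estSecond, hij, mul_comm]
  · exact ⟨.momentum, _, hmeas i j, fun N K Y => rfl,
      fun μ hμ => HasMoments.of_quad_mul_quad h hμ rfl rfl (by simp [symplecticForm])⟩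

end Sampling

end CVTomo

end

noncomputable section

namespace CVTomo

/-! ### Median of means -/

section MedianOfMeans

open Filter Topology

/-- If the median is too high, so is the sorted value of index K/2 and all later ones; if too low,
the value of index (K − 1)/2 and all earlier ones. For either parity these are at least half of the
values. -/
theorem card_le_of_lt_median {K : ℕ} (x : Fin K → ℝ) {T η : ℝ} (hK : 0 < K)
    (h : η < |median x - T|) :
    K ≤ 2 * (Finset.univ.filter fun l => η ≤ |x l - T|).card := by
  have hm := Tuple.monotone_sort x
  set σ := Tuple.sort x
  have h1 : (K - 1) / 2 < K := by omega
  have h2 : K / 2 < K := by omega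
  have hmed : median x = (x (σ ⟨(K - 1) / 2, h1⟩) + x (σ ⟨K / 2, h2⟩)) / 2 := by
    rw [median, dif_pos hK]
  have h12 : x (σ ⟨(K - 1) / 2, h1⟩) ≤ x (σ ⟨K / 2, h2⟩) :=
    hm (Fin.mk_le_mk.2 (by omega))
  rcases lt_abs.1 h with h | h
  · have h3 : T + η < x (σ ⟨K / 2, h2⟩) := by linarith
    have hsub : (Finset.Ici (⟨K / 2, h2⟩ : Fin K)).map σ.toEmbedding
        ⊆ Finset.univ.filter fun l => η ≤ |x l - T| := by
      intro l hl
      obtain ⟨i, hi, rfl⟩ := Finset.mem_map.1 hl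
      have h4 : x (σ ⟨K / 2, h2⟩) ≤ x (σ i) := hm (Finset.mem_Ici.1 hi)
      exact Finset.mem_filter.2 ⟨Finset.mem_univ _,
        le_trans (by change η ≤ x (σ i) - T; linarith) (le_abs_self _)⟩
    have := Finset.card_le_card hsub
    rw [Finset.card_map, Fin.card_Ici] at this
    simp only at this
    omega
  · have h3 : x (σ ⟨(K - 1) / 2, h1⟩) < T - η := by linarith
    have hsub : (Finset.Iic (⟨(K - 1) / 2, h1⟩ : Fin K)).map σ.toEmbedding
        ⊆ Finset.univ.filter fun l => η ≤ |x l - T| := by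
      intro l hl
      obtain ⟨i, hi, rfl⟩ := Finset.mem_map.1 hl
      have h4 : x (σ i) ≤ x (σ ⟨(K - 1) / 2, h1⟩) := hm (Finset.mem_Iic.1 hi)
      exact Finset.mem_filter.2 ⟨Finset.mem_univ _,
        le_trans (by change η ≤ -(x (σ i) - T); linarith) (neg_le_abs _)⟩
    have := Finset.card_le_card hsub
    rw [Finset.card_map, Fin.card_Iic] at this
    simp only at this
    omega

variable {S : Type*} [MeasurableSpace S] {P : Measure S}

/-- Independence says that the joint law is a product measure, and a product over pairs curries to a
product of products. It gives the independence of the bins as blocks. -/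
theorem iIndepFun_curry {κ κ' β : Type*} [MeasurableSpace β]
    [IsProbabilityMeasure P] {X : κ → κ' → S → β} (mX : ∀ i j, Measurable (X i j))
    (h : iIndepFun (fun (p : (_ : κ) × κ') s => X p.1 p.2 s) P) :
    iIndepFun (fun i s j => X i j s) P := by
  have : ∀ i j, IsProbabilityMeasure (P.map (X i j)) :=
    fun i j => Measure.isProbabilityMeasure_map (mX i j).aemeasurable
  have hrow : ∀ i, iIndepFun (X i) P := fun i =>
    iIndepFun.precomp (g := fun j => (⟨i, j⟩ : (_ : κ) × κ')) (fun a b hab => by simpa using hab) h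
  rw [iIndepFun_iff_map_fun_eq_infinitePi_map (by fun_prop)]
  have h1 := (iIndepFun_iff_map_fun_eq_infinitePi_map (by fun_prop)).1 h
  have h2 := congrArg (Measure.map (MeasurableEquiv.piCurry fun _ : κ => fun _ : κ' => β)) h1
  rw [Measure.map_map (by fun_prop) (by fun_prop),
    Measure.infinitePi_map_piCurry (fun i j => P.map (X i j))] at h2
  have h3 : (MeasurableEquiv.piCurry fun _ : κ => fun _ : κ' => β)
      ∘ (fun s (p : (_ : κ) × κ') => X p.1 p.2 s) = fun s i j => X i j s := by
    ext; simp [Sigma.curry]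
  rw [h3] at h2
  rw [h2]
  congr 1
  funext i
  exact ((iIndepFun_iff_map_fun_eq_infinitePi_map (by fun_prop)).1 (hrow i)).symm

/-- Union bound over the at most 2ᴷ sets of at least K/2 bad bins; independence gives each the
probability at most p^(K/2). -/
theorem measure_card_le [IsProbabilityMeasure P] {K : ℕ} {Z : Fin K → S → ℝ} (hZ : iIndepFun Z P)
    {B : Set ℝ} (hB : MeasurableSet B) {p : ℝ≥0∞} (hp1 : p ≤ 1) (hp : ∀ l, P (Z l ⁻¹' B) ≤ p) :
    P {s | ∃ I : Finset (Fin K), K ≤ 2 * I.card ∧ ∀ l ∈ I, Z l s ∈ B}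
      ≤ 2 ^ K * p ^ ((K : ℝ) / 2) := by
  classical
  have h1 : {s | ∃ I : Finset (Fin K), K ≤ 2 * I.card ∧ ∀ l ∈ I, Z l s ∈ B}
      ⊆ ⋃ I ∈ (Finset.univ : Finset (Finset (Fin K))).filter fun I => K ≤ 2 * I.card,
        ⋂ l ∈ I, Z l ⁻¹' B := by
    rintro s ⟨I, hI, hs⟩
    simp only [Finset.mem_filter, Finset.mem_univ, true_and, Set.mem_iUnion, Set.mem_iInter,
      Set.mem_preimage]
    exact ⟨I, hI, hs⟩
  refine (measure_mono h1).trans ((measure_biUnion_finset_le _ _).trans ?_)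
  have h2 : ∀ I ∈ (Finset.univ : Finset (Finset (Fin K))).filter fun I => K ≤ 2 * I.card,
      P (⋂ l ∈ I, Z l ⁻¹' B) ≤ p ^ ((K : ℝ) / 2) := by
    intro I hI
    have hI := (Finset.mem_filter.1 hI).2
    rw [hZ.measure_inter_preimage_eq_mul I (sets := fun _ => B) fun _ _ => hB]
    calc ∏ l ∈ I, P (Z l ⁻¹' B) ≤ ∏ _l ∈ I, p := Finset.prod_le_prod' fun l _ => hp l
      _ = p ^ (I.card : ℝ) := by rw [Finset.prod_const, ENNReal.rpow_natCast]
      _ ≤ p ^ ((K : ℝ) / 2) := by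
        refine ENNReal.rpow_le_rpow_of_exponent_ge hp1 ?_
        rw [div_le_iff₀ (by norm_num), mul_comm]
        exact_mod_cast hI
  refine (Finset.sum_le_sum h2).trans ?_
  rw [Finset.sum_const, nsmul_eq_mul]
  gcongr
  refine (Nat.cast_le.2 (Finset.card_le_univ _)).trans ?_
  simp

/-- Chebyshev's inequality, with the variance of a sample bounded by its second moment. -/
theorem measure_bin_mean_le [IsProbabilityMeasure P] {b : ℕ} (hb : 0 < b) {Y : Fin b → S → ℝ}
    {T v η : ℝ} (hY : ∀ j, HasMoments P (Y j) T v)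
    (hind : iIndepFun Y P) (hη : 0 < η) :
    P {s | η ≤ |(∑ j, Y j s) / b - T|} ≤ ENNReal.ofReal (v / (b * η ^ 2)) := by
  have hb' : (0 : ℝ) < b := by exact_mod_cast hb
  set Z : S → ℝ := fun s => (b : ℝ)⁻¹ * (∑ j, Y j) s
  have hsum : MemLp (∑ j, Y j) 2 P := memLp_finsetSum' _ fun j _ => (hY j).memLp
  have hZ : MemLp Z 2 P := hsum.const_mul _
  have hmean : P[Z] = T := by
    simp only [Z, Finset.sum_apply]
    rw [integral_const_mul, integral_finsetSum _ fun j _ => (hY j).memLp.integrable (by norm_num)]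
    simp only [(hY _).mean, Finset.sum_const, Finset.card_univ, Fintype.card_fin, nsmul_eq_mul]
    field_simp
  have hvar : variance Z P ≤ v / b := by
    have h1 : variance Z P = ((b : ℝ)⁻¹) ^ 2 * variance (∑ j, Y j) P := variance_const_mul _ _ _
    rw [h1, IndepFun.variance_sum (fun j _ => (hY j).memLp)
      (fun i _ j _ hij => hind.indepFun hij)]
    have h2 : ∑ j, variance (Y j) P ≤ b * v := by
      calc ∑ j, variance (Y j) P ≤ ∑ _j : Fin b, v := Finset.sum_le_sum fun j _ =>
            (variance_le_expectation_sq (hY j).memLp.1).trans (hY j).sq_le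
        _ = b * v := by simp
    calc ((b : ℝ)⁻¹) ^ 2 * ∑ j, variance (Y j) P ≤ ((b : ℝ)⁻¹) ^ 2 * (b * v) := by gcongr
      _ = v / b := by field_simp
  have h3 := meas_ge_le_variance_div_sq hZ hη
  rw [hmean] at h3
  have h4 : {s | η ≤ |(∑ j, Y j s) / b - T|} = {s | η ≤ |Z s - T|} := by
    ext s
    simp only [Z, Finset.sum_apply, Set.mem_ofPred_eq, div_eq_inv_mul]
  rw [h4]
  refine h3.trans (ENNReal.ofReal_le_ofReal ?_)
  rw [← div_div]
  gcongr

/-- Concentration of the median of means. -/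
theorem measure_medianOfMeans_le [IsProbabilityMeasure P] {N K : ℕ} (hK : 0 < K)
    (hb : 0 < N / K) {Y : Fin N → S → ℝ} {T v η : ℝ} (hYm : ∀ j, Measurable (Y j))
    (hY : ∀ j, HasMoments P (Y j) T v) (hind : iIndepFun Y P) (hη : 0 < η)
    (hv : 4 * Real.exp 1 * v ≤ (N / K : ℕ) * η ^ 2) :
    P {s | η < |medianOfMeans K (fun j => Y j s) - T|}
      ≤ ENNReal.ofReal (Real.exp (-((K : ℝ) / 2))) := by
  have hb' : (0 : ℝ) < (N / K : ℕ) := by exact_mod_cast hb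
  set X : Fin K → Fin (N / K) → S → ℝ :=
    fun l j => Y ⟨(l : ℕ) * (N / K) + j, bin_lt l j⟩ with hX
  have hinj : Function.Injective fun p : (_ : Fin K) × Fin (N / K) =>
      (⟨(p.1 : ℕ) * (N / K) + p.2, bin_lt p.1 p.2⟩ : Fin N) := by
    rintro ⟨l, j⟩ ⟨l', j'⟩ h
    have h1 : (l : ℕ) * (N / K) + j = l' * (N / K) + j' := congrArg Fin.val h
    have h2 : (l : ℕ) = l' := by
      have e : ∀ (l : Fin K) (j : Fin (N / K)), ((l : ℕ) * (N / K) + j) / (N / K) = l := by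
        intro l j
        rw [mul_comm, Nat.mul_add_div hb, Nat.div_eq_of_lt j.2, add_zero]
      rw [← e l j, h1, e]
    have h3 : (j : ℕ) = j' := by rw [h2] at h1; omega
    rw [Fin.ext h2, Fin.ext h3]
  have hXind : iIndepFun (fun (p : (_ : Fin K) × Fin (N / K)) s => X p.1 p.2 s) P :=
    hind.precomp hinj
  have hXm : ∀ l j, Measurable (X l j) := fun l j => hYm _
  have hrow : ∀ l, iIndepFun (X l) P := fun l =>
    iIndepFun.precomp (g := fun j => (⟨l, j⟩ : (_ : Fin K) × Fin (N / K)))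
      (fun a b hab => by simpa using hab) hXind
  set Z : Fin K → S → ℝ := fun l s => (∑ j, X l j s) / ((N / K : ℕ) : ℝ) with hZ
  have hZind : iIndepFun Z P :=
    (iIndepFun_curry hXm hXind).comp (fun _ x => (∑ j, x j) / ((N / K : ℕ) : ℝ))
      fun _ => by fun_prop
  have hB : MeasurableSet {x : ℝ | η ≤ |x - T|} :=
    measurableSet_le measurable_const (by fun_prop)
  -- The threshold 1/(4e) is chosen so that 2ᴷ(4e)^(−K/2) = exp(−K/2).
  have hp : ∀ l, P (Z l ⁻¹' {x : ℝ | η ≤ |x - T|}) ≤ ENNReal.ofReal (1 / (4 * Real.exp 1)) := by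
    intro l
    refine (measure_bin_mean_le hb (fun j => hY _) (hrow l) hη).trans (ENNReal.ofReal_le_ofReal ?_)
    rw [div_le_div_iff₀ (by positivity) (by positivity)]
    linarith
  have hsub : {s | η < |medianOfMeans K (fun j => Y j s) - T|}
      ⊆ {s | ∃ I : Finset (Fin K), K ≤ 2 * I.card ∧ ∀ l ∈ I, Z l s ∈ {x : ℝ | η ≤ |x - T|}} :=
    fun s hs => ⟨_, card_le_of_lt_median (fun l => Z l s) hK hs,
      fun l hl => (Finset.mem_filter.1 hl).2⟩
  have h41 : (1 : ℝ) ≤ 4 * Real.exp 1 := by linarith [Real.add_one_le_exp (1 : ℝ)]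
  refine (measure_mono hsub).trans ((measure_card_le hZind hB ?_ hp).trans (le_of_eq ?_))
  · rw [ENNReal.ofReal_le_one, div_le_one (by positivity)]
    exact h41
  · rw [ENNReal.ofReal_rpow_of_pos (by positivity),
      show (2 : ℝ≥0∞) = ENNReal.ofReal 2 by simp, ← ENNReal.ofReal_pow (by norm_num),
      ← ENNReal.ofReal_mul (by positivity)]
    congr 1
    have h5 : (1 : ℝ) / (4 * Real.exp 1) = (2 : ℝ) ^ (-2 : ℝ) * Real.exp (-1) := by
      rw [Real.exp_neg, Real.rpow_neg (by norm_num)]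
      norm_num
      field_simp
    rw [h5, Real.mul_rpow (by positivity) (by positivity), ← Real.rpow_mul (by norm_num),
      ← Real.exp_mul, ← mul_assoc, ← Real.rpow_natCast, ← Real.rpow_add (by norm_num)]
    rw [show (K : ℝ) + -2 * (K / 2) = 0 by ring, Real.rpow_zero, one_mul]
    congr 1
    ring

end MedianOfMeans

end CVTomo

end

noncomputable section

namespace CVTomo

/-! ### Norms and positivity of matrices -/

section MatrixNorm

variable {ι : Type} [Fintype ι]

theorem posSemidef_map_ofReal {A : Matrix ι ι ℝ} (hA : A.PosSemidef) :
    (A.map Complex.ofReal).PosSemidef := by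
  obtain ⟨m, v, rfl⟩ := Matrix.posSemidef_iff_eq_sum_vecMulVec.1 hA
  have h : (∑ i, Matrix.vecMulVec (v i) (star (v i))).map Complex.ofReal
      = ∑ i, Matrix.vecMulVec (fun k => (v i k : ℂ)) (star fun k => (v i k : ℂ)) := by
    ext k l
    simp [Matrix.sum_apply, Matrix.vecMulVec_apply]
  rw [h]
  exact Matrix.posSemidef_sum _ fun i _ => Matrix.posSemidef_vecMulVec_self_star _

variable [DecidableEq ι]

/-- The operator norm is at most the Frobenius norm, by Cauchy–Schwarz in each row. -/
theorem opNorm_le_of_sum_sq_le {A : Matrix ι ι ℝ} {c : ℝ} (hc : 0 ≤ c)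
    (h : ∑ k, ∑ l, A k l ^ 2 ≤ c ^ 2) : opNorm A ≤ c := by
  refine ContinuousLinearMap.opNorm_le_bound _ hc fun x => ?_
  refine abs_le_of_sq_le_sq' ?_ (by positivity) |>.2
  rw [mul_pow, EuclideanSpace.norm_sq_eq, EuclideanSpace.norm_sq_eq]
  simp only [Real.norm_eq_abs, sq_abs]
  have h1 : ∀ k, (Matrix.toEuclideanCLM (𝕜 := ℝ) A x) k = ∑ l, A k l * x l := fun k => by
    simp [Matrix.mulVec, dotProduct]
  calc ∑ k, (Matrix.toEuclideanCLM (𝕜 := ℝ) A x) k ^ 2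
      ≤ ∑ k, (∑ l, A k l ^ 2) * ∑ l, x l ^ 2 := by
        refine Finset.sum_le_sum fun k _ => ?_
        rw [h1]
        exact Finset.sum_mul_sq_le_sq_mul_sq _ _ _
    _ = (∑ k, ∑ l, A k l ^ 2) * ∑ l, x l ^ 2 := by rw [Finset.sum_mul]
    _ ≤ c ^ 2 * ∑ l, x l ^ 2 := by gcongr

theorem opNorm_add_le (A B : Matrix ι ι ℝ) : opNorm (A + B) ≤ opNorm A + opNorm B := by
  unfold opNorm
  rw [map_add]
  exact norm_add_le _ _

theorem opNorm_smul (c : ℝ) (A : Matrix ι ι ℝ) : opNorm (c • A) = |c| * opNorm A := by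
  unfold opNorm
  rw [map_smul, norm_smul, Real.norm_eq_abs]

theorem opNorm_one_le : opNorm (1 : Matrix ι ι ℝ) ≤ 1 := by
  unfold opNorm
  rw [map_one]
  exact ContinuousLinearMap.norm_id_le

theorem opNorm_vecMulVec_le (u v : EuclideanSpace ℝ ι) :
    opNorm (Matrix.vecMulVec u v) ≤ ‖u‖ * ‖v‖ := by
  refine opNorm_le_of_sum_sq_le (by positivity) (le_of_eq ?_)
  rw [mul_pow, EuclideanSpace.norm_sq_eq, EuclideanSpace.norm_sq_eq, Finset.sum_mul_sum]
  simp [Matrix.vecMulVec_apply, mul_pow]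

/-- The quadratic form of D is at least −‖D‖ times the squared norm. -/
theorem posSemidef_add_smul_one {D : Matrix ι ι ℝ} (hD : D.IsSymm) {c : ℝ} (h : opNorm D ≤ c) :
    (D + c • (1 : Matrix ι ι ℝ)).PosSemidef := by
  refine Matrix.PosSemidef.of_dotProduct_mulVec_nonneg ?_ fun x => ?_
  · exact (hD.add (Matrix.isSymm_one.smul c))
  · set y : EuclideanSpace ℝ ι := WithLp.toLp 2 x
    have h1 : x ⬝ᵥ D.mulVec x = ⟪y, Matrix.toEuclideanCLM (𝕜 := ℝ) D y⟫_ℝ := by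
      simp [PiLp.inner_apply, dotProduct, y, mul_comm]
    have h2 : x ⬝ᵥ x = ‖y‖ ^ 2 := by
      rw [EuclideanSpace.norm_sq_eq]
      simp [dotProduct, y, sq]
    have h3 : |⟪y, Matrix.toEuclideanCLM (𝕜 := ℝ) D y⟫_ℝ| ≤ c * ‖y‖ ^ 2 := by
      refine (abs_real_inner_le_norm _ _).trans ?_
      have h4 := (Matrix.toEuclideanCLM (𝕜 := ℝ) D).le_opNorm y
      have h5 : ‖Matrix.toEuclideanCLM (𝕜 := ℝ) D y‖ ≤ c * ‖y‖ :=
        h4.trans (mul_le_mul_of_nonneg_right h (norm_nonneg _))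
      nlinarith [norm_nonneg y]
    rw [star_trivial, Matrix.add_mulVec, dotProduct_add, Matrix.smul_mulVec, Matrix.one_mulVec,
      dotProduct_smul, h1, h2, smul_eq_mul]
    linarith [neg_abs_le ⟪y, Matrix.toEuclideanCLM (𝕜 := ℝ) D y⟫_ℝ]

theorem Uncertainty.add {n : ℕ} {V D : Matrix (QIdx n) (QIdx n) ℝ} (hV : Uncertainty V)
    (hD : D.PosSemidef) : Uncertainty (V + D) := by
  have h := Matrix.PosSemidef.add hV (posSemidef_map_ofReal hD)
  unfold Uncertainty
  convert h using 1
  ext k l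
  simp
  ring

end MatrixNorm

/-! ### Accuracy of the estimators -/

section Accuracy

variable {n : ℕ}

theorem estSecond_isSymm {N : ℕ} (K : ℕ) (Y : Round n → Fin N → Fin n → ℝ) :
    (estSecond K Y).IsSymm := by
  ext ⟨i, s⟩ ⟨j, t⟩
  fin_cases s <;> fin_cases t
  · simp [estSecond, mul_comm]
  · by_cases hij : i = j
    · subst hij; simp [estSecond]
    · simp [estSecond, hij, Ne.symm hij]
  · by_cases hij : i = j
    · subst hij; simp [estSecond]
    · simp [estSecond, hij, Ne.symm hij]
  · simp [estSecond, mul_comm]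

theorem estCov_isSymm {N : ℕ} (K : ℕ) (ε : ℝ) (Y : Round n → Fin N → Fin n → ℝ) :
    (estCov K ε Y).IsSymm := by
  refine ((estSecond_isSymm K Y).sub (Matrix.IsSymm.smul ?_ _)).add (Matrix.isSymm_one.smul _)
  ext k l
  simp [Matrix.vecMulVec_apply, mul_comm]

theorem cov_isSymm (ρ : State n) : ρ.cov.IsSymm := by
  ext k l
  simp only [State.cov, Matrix.transpose_apply, Matrix.of_apply, anticomm_comm (quad l)]
  ring

namespace EnergyBound

variable {ρ : State n} {E : ℝ} {φ : onbIndex n → ℕ → Core n}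
    {g : onbIndex n → HSpace n} {r : onbIndex n → QIdx n → HSpace n}
    {w : onbIndex n → QIdx n → QIdx n → HSpace n}

/-- The variance is nonnegative: expand ∑ᵢ ‖(R̂ₖ − mₖ)√ρ eᵢ‖² ≥ 0. -/
theorem sq_mean_le (h : EnergyBound ρ E φ g r w) (k : QIdx n) :
    ρ.mean k ^ 2 ≤ ∑' i, ‖r i k‖ ^ 2 := by
  have h1 := (Complex.hasSum_re (h.hasSum_inner_quad k)).mul_left (2 * ρ.mean k)
  have h2 := ((h.summable_quad k).hasSum.sub h1).add
    (ρ.hasSum_norm_sq_vec.mul_left (ρ.mean k ^ 2))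
  have h3 := h2.nonneg fun i => by
    have h4 : ‖r i k - (ρ.mean k : ℂ) • ρ.vec i‖ ^ 2 = ‖r i k‖ ^ 2
        - 2 * ρ.mean k * (⟪ρ.vec i, r i k⟫_ℂ).re + ρ.mean k ^ 2 * ‖ρ.vec i‖ ^ 2 := by
      rw [norm_sub_sq (𝕜 := ℂ), inner_smul_right, norm_smul, mul_pow]
      have h5 : (⟪r i k, ρ.vec i⟫_ℂ).re = (⟪ρ.vec i, r i k⟫_ℂ).re := inner_re_symm (𝕜 := ℂ) _ _
      simp [h5]
      ring
    rw [← h4]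
    positivity
  rw [Complex.ofReal_re] at h3
  linarith

theorem norm_sq_mean_le (h : EnergyBound ρ E φ g r w) (hn : 1 ≤ n) (hE : 0 ≤ E) :
    ‖ρ.mean‖ ^ 2 ≤ 2 * n * E := by
  rw [EuclideanSpace.norm_sq_eq]
  simp only [Real.norm_eq_abs, sq_abs]
  exact (Finset.sum_le_sum fun k _ => h.sq_mean_le k).trans (h.tsum_quad_le_energy hn hE)

end EnergyBound

/-- With d = m̃ − m, the error is W − 2(mdᵀ + dmᵀ + ddᵀ). Here ‖W‖ ≤ ε/10; since ‖m‖ ≤ √(8En)/2 and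
√(8En) ≥ 2, each of the three rank-one terms has norm at most ε/20. The total is at most 2ε/5. -/
theorem opNorm_estCov_sub_le {N K : ℕ} {Y : Round n → Fin N → Fin n → ℝ} {ε E : ℝ} {ρ : State n}
    (hε : 0 < ε) (hε1 : ε < 1) (hnE : 1 / 2 ≤ n * E) (hmean : ‖ρ.mean‖ ^ 2 ≤ 2 * n * E)
    (hm : ‖estMean K Y - ρ.mean‖ ≤ ε / (10 * Real.sqrt (8 * E * n)))
    (hW : ∑ k, ∑ l, (estSecond K Y k l - ρ.expect (anticomm (quad k) (quad l))) ^ 2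
      ≤ (ε / 10) ^ 2) :
    opNorm (estCov K ε Y - (ε / 2) • (1 : Matrix (QIdx n) (QIdx n) ℝ) - ρ.cov) ≤ ε / 2 := by
  set d := estMean K Y - ρ.mean with hd
  set W : Matrix (QIdx n) (QIdx n) ℝ :=
    Matrix.of fun k l => estSecond K Y k l - ρ.expect (anticomm (quad k) (quad l)) with hWdef
  have hest : estMean K Y = ρ.mean + d := by rw [hd]; abel
  have h1 : estCov K ε Y - (ε / 2) • (1 : Matrix (QIdx n) (QIdx n) ℝ) - ρ.cov
      = W + (-2 : ℝ) • (Matrix.vecMulVec ρ.mean d + (Matrix.vecMulVec d ρ.mean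
        + Matrix.vecMulVec d d)) := by
    ext k l
    simp only [estCov, hest, State.cov, hWdef, Matrix.sub_apply, Matrix.add_apply,
      Matrix.smul_apply, Matrix.of_apply, Matrix.vecMulVec_apply, smul_eq_mul, PiLp.add_apply]
    ring
  have hs : 0 < Real.sqrt (8 * E * n) := Real.sqrt_pos.2 (by linarith)
  have hs2 : Real.sqrt (8 * E * n) ^ 2 = 8 * E * n := Real.sq_sqrt (by linarith)
  have hm0 : ‖ρ.mean‖ ≤ Real.sqrt (8 * E * n) / 2 := by
    refine abs_le_of_sq_le_sq' ?_ (by positivity) |>.2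
    rw [div_pow, hs2]
    linarith
  have hd2 : 10 * Real.sqrt (8 * E * n) * ‖d‖ ≤ ε := by
    rw [le_div_iff₀ (by positivity)] at hm
    linarith
  have hs3 : 2 ≤ Real.sqrt (8 * E * n) := Real.le_sqrt_of_sq_le (by linarith)
  have hd0 := norm_nonneg d
  have hd3 : ‖d‖ ≤ ε / 20 := by nlinarith
  have hmd : ‖ρ.mean‖ * ‖d‖ ≤ ε / 20 := by nlinarith
  have hWn : opNorm W ≤ ε / 10 := opNorm_le_of_sum_sq_le (by positivity) hW
  rw [h1]
  refine (opNorm_add_le _ _).trans ?_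
  rw [opNorm_smul]
  have h2 := opNorm_add_le (Matrix.vecMulVec ρ.mean d)
    (Matrix.vecMulVec d ρ.mean + Matrix.vecMulVec d d)
  have h3 := opNorm_add_le (Matrix.vecMulVec d ρ.mean) (Matrix.vecMulVec d d)
  have h4 := opNorm_vecMulVec_le ρ.mean d
  have h5 := opNorm_vecMulVec_le d ρ.mean
  have h6 := opNorm_vecMulVec_le d d
  have h7 : ‖d‖ * ‖d‖ ≤ ε / 20 * 1 := mul_le_mul hd3 (by linarith) hd0 (by positivity)
  have h8 : |(-2 : ℝ)| = 2 := by norm_num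
  rw [h8]
  nlinarith [mul_le_mul hd3 hd3 hd0 (by positivity)]

/-- The shift by ε/2 turns an error D of norm at most ε/2 into a positive semidefinite one. So the
output dominates V(ρ), inherits its uncertainty relation, and is at distance at most ε/2 + ε/2. -/
theorem algorithm_succeeds {ρ : State n} {E ε δ : ℝ} {φ : onbIndex n → ℕ → Core n}
    {g : onbIndex n → HSpace n} {r : onbIndex n → QIdx n → HSpace n}
    {w : onbIndex n → QIdx n → QIdx n → HSpace n}
    (h : EnergyBound ρ E φ g r w) (hn : 1 ≤ n) (hE : 0 ≤ E) (hε : 0 < ε) (hε1 : ε < 1)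
    {Y : Round n → Fin (roundSize n E ε δ) → Fin n → ℝ}
    (hm : ‖estMean (numBins n δ) Y - ρ.mean‖ ≤ ε / (10 * Real.sqrt (8 * E * n)))
    (hW : ∑ k, ∑ l, (estSecond (numBins n δ) Y k l
      - ρ.expect (anticomm (quad k) (quad l))) ^ 2 ≤ (ε / 10) ^ 2) :
    ∃ m V, algorithm n E ε δ Y = some (m, V) ∧ V.IsSymm ∧ opNorm (V - ρ.cov) ≤ ε ∧
      Uncertainty V ∧ ‖m - ρ.mean‖ ≤ ε / (10 * Real.sqrt (8 * E * n)) := by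
  have hE2 := h.half_le hn hE
  have hn' : (1 : ℝ) ≤ n := by exact_mod_cast hn
  have hD := opNorm_estCov_sub_le hε hε1 (by nlinarith) (h.norm_sq_mean_le hn hE) hm hW
  set V := estCov (numBins n δ) ε Y with hV
  set D := V - (ε / 2) • (1 : Matrix (QIdx n) (QIdx n) ℝ) - ρ.cov with hDdef
  have hsymm : V.IsSymm := estCov_isSymm _ _ _
  have hDs : D.IsSymm := (hsymm.sub (Matrix.isSymm_one.smul _)).sub (cov_isSymm ρ)
  have hVD : V = ρ.cov + (D + (ε / 2) • 1) := by rw [hDdef]; abel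
  have hunc : Uncertainty V := by
    rw [hVD]
    exact h.uncertainty_cov.add (posSemidef_add_smul_one hDs hD)
  refine ⟨_, _, if_pos hunc, hsymm, ?_, hunc, hm⟩
  have h1 : V - ρ.cov = D + (ε / 2) • 1 := by rw [hDdef]; abel
  rw [h1]
  refine (opNorm_add_le _ _).trans ?_
  rw [opNorm_smul, abs_of_pos (by positivity)]
  have := opNorm_one_le (ι := QIdx n)
  nlinarith

end Accuracy

end CVTomo

end

noncomputable section

namespace CVTomo

/-! ### The number of copies -/

section Counting

theorem card_round (n : ℕ) : Nat.card (Round n) = n + 3 := by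
  let e : Round n ≃ Option (Option (Option (Fin n))) :=
    { toFun := fun
        | .position => none
        | .momentum => some none
        | .dilation => some (some none)
        | .mixed k => some (some (some k))
      invFun := fun
        | none => .position
        | some none => .momentum
        | some (some none) => .dilation
        | some (some (some k)) => .mixed k
      left_inv := fun r => by cases r <;> rfl
      right_inv := fun o => by rcases o with _ | _ | _ | k <;> rfl }
  rw [Nat.card_congr e]
  simp

theorem card_copy (n : ℕ) (E ε δ : ℝ) : Nat.card (Copy n E ε δ) = numCopies n E ε δ := by
  rw [Nat.card_prod, card_round, Nat.card_fin]
  rfl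

/-- `log (2 (2 n² + 3 n) / δ)`. -/
def logFactor (n : ℕ) (δ : ℝ) : ℝ := Real.log (2 * (2 * (n : ℝ) ^ 2 + 3 * n) / δ)

/-- `200 (8 n² E² + 3 n) / ε²`. -/
def accuracyFactor (n : ℕ) (E ε : ℝ) : ℝ := 200 * (8 * (n : ℝ) ^ 2 * E ^ 2 + 3 * n) / ε ^ 2

theorem numBins_eq (n : ℕ) (δ : ℝ) : numBins n δ = ⌈2 * logFactor n δ⌉₊ := rfl

variable {n : ℕ} {E ε δ : ℝ}

theorem two_le_logFactor (hn : 1 ≤ n) (hδ : 0 < δ) (hδ1 : δ < 1) : 2 ≤ logFactor n δ := by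
  have hn' : (1 : ℝ) ≤ n := by exact_mod_cast hn
  rw [logFactor, Real.le_log_iff_exp_le (by positivity), le_div_iff₀ hδ]
  have h1 : Real.exp 2 = Real.exp 1 ^ 2 := by rw [← Real.exp_nat_mul]; norm_num
  have h2 := Real.exp_one_lt_d9
  have h3 : Real.exp 2 ≤ 10 := by rw [h1]; nlinarith [Real.exp_pos 1]
  -- For n ≥ 1 the argument of the logarithm is at least 10/δ, while e² < 10.
  nlinarith [Real.exp_pos 2]

theorem le_accuracyFactor (hn : 1 ≤ n) (hε : 0 < ε) (hε1 : ε < 1) :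
    600 ≤ accuracyFactor n E ε := by
  have hn' : (1 : ℝ) ≤ n := by exact_mod_cast hn
  rw [accuracyFactor, le_div_iff₀ (by positivity)]
  nlinarith [sq_nonneg ((n : ℝ) * E)]

theorem numBins_pos (hn : 1 ≤ n) (hδ : 0 < δ) (hδ1 : δ < 1) : 0 < numBins n δ := by
  rw [numBins_eq, Nat.ceil_pos]
  linarith [two_le_logFactor hn hδ hδ1]

theorem exp_neg_numBins_le (hn : 1 ≤ n) (hδ : 0 < δ) :
    Real.exp (-((numBins n δ : ℝ) / 2)) ≤ δ / (2 * (2 * (n : ℝ) ^ 2 + 3 * n)) := by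
  have hn' : (1 : ℝ) ≤ n := by exact_mod_cast hn
  have h1 : 2 * logFactor n δ ≤ numBins n δ := Nat.le_ceil _
  calc Real.exp (-((numBins n δ : ℝ) / 2)) ≤ Real.exp (-logFactor n δ) :=
        Real.exp_le_exp.2 (by linarith)
    _ = δ / (2 * (2 * (n : ℝ) ^ 2 + 3 * n)) := by
        rw [Real.exp_neg, logFactor, Real.exp_log (by positivity), inv_div]

/-- Rounding costs are absorbed by the gap between 68 and 2 · 22 = 44: with L = `logFactor` ≥ 2 and
T = `accuracyFactor` ≥ 600, 68LT exceeds (22T + 1)(2L + 1). -/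
theorem le_bin_size (hn : 1 ≤ n) (hε : 0 < ε) (hε1 : ε < 1) (hδ : 0 < δ) (hδ1 : δ < 1) :
    22 * accuracyFactor n E ε ≤ (roundSize n E ε δ / numBins n δ : ℕ) := by
  have hL := two_le_logFactor hn hδ hδ1
  have hT := le_accuracyFactor (E := E) hn hε hε1
  have hK := numBins_pos hn hδ hδ1
  have hK' : (0 : ℝ) < numBins n δ := by exact_mod_cast hK
  have h1 : 68 * logFactor n δ * accuracyFactor n E ε ≤ roundSize n E ε δ := Nat.le_ceil _
  have h2 : (numBins n δ : ℝ) < 2 * logFactor n δ + 1 :=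
    Nat.ceil_lt_add_one (show 0 ≤ 2 * logFactor n δ by linarith)
  have h3 := Nat.lt_div_mul_add (a := roundSize n E ε δ) hK
  have h4 : (roundSize n E ε δ : ℝ)
      < (roundSize n E ε δ / numBins n δ : ℕ) * numBins n δ + numBins n δ := by
    exact_mod_cast h3
  by_contra! hlt
  have h5 : ((roundSize n E ε δ / numBins n δ : ℕ) : ℝ) * numBins n δ
      ≤ 22 * accuracyFactor n E ε * numBins n δ := by gcongr
  have h6 : (22 * accuracyFactor n E ε + 1) * numBins n δ
      ≤ (22 * accuracyFactor n E ε + 1) * (2 * logFactor n δ + 1) := by gcongr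
  nlinarith [mul_nonneg (sub_nonneg.2 hL) (sub_nonneg.2 hT)]

/-- The cube of n²/δ dominates the argument since 2(2n² + 3n) ≤ n⁶. This needs n ≥ 2; at n = 1 the
right side tends to 0 as δ tends to 1. -/
theorem logFactor_le (hn : 2 ≤ n) (hδ : 0 < δ) (hδ1 : δ < 1) :
    logFactor n δ ≤ 3 * Real.log ((n : ℝ) ^ 2 / δ) := by
  have hn' : (2 : ℝ) ≤ n := by exact_mod_cast hn
  have h1 : (3 : ℝ) * Real.log ((n : ℝ) ^ 2 / δ) = Real.log (((n : ℝ) ^ 2 / δ) ^ 3) := by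
    rw [Real.log_pow]; norm_num
  rw [h1, logFactor]
  refine Real.log_le_log (by positivity) ?_
  rw [div_pow, div_le_div_iff₀ hδ (by positivity)]
  have h2 : 2 * (2 * (n : ℝ) ^ 2 + 3 * n) ≤ ((n : ℝ) ^ 2) ^ 3 := by
    have h3 : (4 : ℝ) ≤ (n : ℝ) ^ 2 := by nlinarith
    have h4 : (16 : ℝ) ≤ (n : ℝ) ^ 2 * (n : ℝ) ^ 2 := by nlinarith
    have h5 : (16 : ℝ) * (n : ℝ) ^ 2 ≤ (n : ℝ) ^ 2 * (n : ℝ) ^ 2 * (n : ℝ) ^ 2 := by gcongr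
    nlinarith
  have h6 : δ ^ 3 ≤ δ := by
    simpa using pow_le_pow_of_le_one hδ.le hδ1.le (show 1 ≤ 3 by norm_num)
  gcongr

/-- The constant collects 3 from n + 3 ≤ 3n, 69 from the ceiling, 3 from the logarithm and 4000 from
the accuracy factor, where E ≥ 1/2 absorbs the linear term in n. -/
theorem numCopies_le (hn : 2 ≤ n) (hE : 1 / 2 ≤ E) (hε : 0 < ε) (hε1 : ε < 1) (hδ : 0 < δ)
    (hδ1 : δ < 1) : (numCopies n E ε δ : ℝ)
      ≤ 2500000 * (Real.log ((n : ℝ) ^ 2 / δ) * ((n : ℝ) ^ 3 * E ^ 2 / ε ^ 2)) := by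
  have hn' : (2 : ℝ) ≤ n := by exact_mod_cast hn
  have hL := two_le_logFactor (by omega : 1 ≤ n) hδ hδ1
  have hT := le_accuracyFactor (E := E) (by omega : 1 ≤ n) hε hε1
  have hL3 := logFactor_le hn hδ hδ1
  have h1 : (roundSize n E ε δ : ℝ) < 68 * logFactor n δ * accuracyFactor n E ε + 1 :=
    Nat.ceil_lt_add_one (by positivity)
  have h2 : (roundSize n E ε δ : ℝ) ≤ 69 * (logFactor n δ * accuracyFactor n E ε) := by
    nlinarith
  have h3 : accuracyFactor n E ε ≤ 4000 * ((n : ℝ) ^ 2 * E ^ 2 / ε ^ 2) := by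
    rw [accuracyFactor, ← mul_div_assoc]
    refine div_le_div_of_nonneg_right ?_ (by positivity)
    have h4 : (1 : ℝ) / 4 ≤ E ^ 2 := by nlinarith
    have h5 : (n : ℝ) ^ 2 * (1 / 4) ≤ (n : ℝ) ^ 2 * E ^ 2 := by gcongr
    nlinarith
  have h6 : ((n + 3 : ℕ) : ℝ) ≤ 3 * n := by push_cast; linarith
  have h7 : (0 : ℝ) ≤ (n : ℝ) ^ 3 * E ^ 2 / ε ^ 2 := by positivity
  have h8 : logFactor n δ * accuracyFactor n E ε
      ≤ 3 * Real.log ((n : ℝ) ^ 2 / δ) * (4000 * ((n : ℝ) ^ 2 * E ^ 2 / ε ^ 2)) :=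
    mul_le_mul hL3 h3 (by linarith) (by linarith)
  calc (numCopies n E ε δ : ℝ) = ((n + 3 : ℕ) : ℝ) * roundSize n E ε δ := by
        rw [numCopies]; push_cast; ring
    _ ≤ (3 * n) * (69 * (3 * Real.log ((n : ℝ) ^ 2 / δ)
          * (4000 * ((n : ℝ) ^ 2 * E ^ 2 / ε ^ 2)))) := by
        gcongr
        exact h2.trans (by gcongr)
    _ = 2484000 * (Real.log ((n : ℝ) ^ 2 / δ) * ((n : ℝ) ^ 3 * E ^ 2 / ε ^ 2)) := by ring
    _ ≤ _ := by
        have : 0 ≤ Real.log ((n : ℝ) ^ 2 / δ) := by linarith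
        gcongr
        norm_num

end Counting

/-! ### Confidence of the algorithm -/

section Confidence

variable {n : ℕ} {E ε δ : ℝ} {S : Type} [MeasurableSpace S] {P : Measure S}

theorem HasMoments.mono {α : Type*} [MeasurableSpace α] {μ : Measure α} {F : α → ℝ} {T v v' : ℝ}
    (h : HasMoments μ F T v) (hv : v ≤ v') : HasMoments μ F T v' :=
  ⟨h.memLp, h.mean, h.sq_le.trans hv⟩

theorem HasMoments.comp {α : Type*} [MeasurableSpace α] {X : S → α} (hX : Measurable X)
    {F : α → ℝ} (hF : Measurable F) {T v : ℝ} (h : HasMoments (P.map X) F T v) :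
    HasMoments P (fun s => F (X s)) T v := by
  refine ⟨(memLp_map_measure_iff hF.aestronglyMeasurable hX.aemeasurable).1 h.memLp, ?_, ?_⟩
  · rw [← h.mean, integral_map hX.aemeasurable hF.aestronglyMeasurable]
  · have h1 := h.sq_le
    rwa [integral_map hX.aemeasurable (hF.pow_const 2).aestronglyMeasurable] at h1

/-- Each estimator deviates from its target `T` by more than `√(v / (2 T'))` with probability at
most `δ / (2 (2 n² + 3 n))`, where `v` bounds the second moment of a sample. -/
theorem measure_estimator_le [IsProbabilityMeasure P] {ρ : State n} (hn : 1 ≤ n)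
    (hε : 0 < ε) (hε1 : ε < 1) (hδ : 0 < δ) (hδ1 : δ < 1)
    {X : Copy n E ε δ → S → (Fin n → ℝ)} (hX : ∀ c, Measurable (X c)) (hind : iIndepFun X P)
    (hlaw : ∀ c, IsBornLaw ρ c.1.observables (P.map (X c))) {R : Round n}
    {F : (Fin n → ℝ) → ℝ} (hF : Measurable F) {T v : ℝ}
    (hmom : ∀ μ, IsBornLaw ρ R.observables μ → HasMoments μ F T v) (hv : 0 < v) :
    P {s | Real.sqrt (v / (2 * accuracyFactor n E ε))
        < |medianOfMeans (numBins n δ) (fun j => F (X (R, j) s)) - T|}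
      ≤ ENNReal.ofReal (δ / (2 * (2 * (n : ℝ) ^ 2 + 3 * n))) := by
  have hT := le_accuracyFactor (E := E) hn hε hε1
  have hB := le_bin_size (E := E) hn hε hε1 hδ hδ1
  have hB0 : (0 : ℝ) < (roundSize n E ε δ / numBins n δ : ℕ) := by linarith
  have hη : 0 < v / (2 * accuracyFactor n E ε) := by positivity
  have hrow : iIndepFun (fun j s => F (X (R, j) s)) P :=
    (hind.precomp (g := fun j => (R, j)) fun a b hab => by simpa using hab).comp
      (fun _ => F) fun _ => hF
  refine (measure_medianOfMeans_le (numBins_pos hn hδ hδ1) (by exact_mod_cast hB0)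
    (fun j => hF.comp (hX _)) (fun j => (hmom _ (hlaw (R, j))).comp (hX _) hF) hrow
    (Real.sqrt_pos.2 hη) ?_).trans (ENNReal.ofReal_le_ofReal (exp_neg_numBins_le hn hδ))
  rw [Real.sq_sqrt hη.le]
  -- The constant 22 in the bin size is twice 11, and 4e < 11.
  calc 4 * Real.exp 1 * v ≤ 11 * v := by nlinarith [Real.exp_one_lt_d9]
    _ = 22 * accuracyFactor n E ε * (v / (2 * accuracyFactor n E ε)) := by field_simp; norm_num
    _ ≤ _ := by gcongr

/-- Union bound over 2n + 4n² entries, each failing with probability at most δ/(4n² + 6n). The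
summands E/2 and 1/n keep the tolerances positive when a second moment vanishes; over all entries
they add only nE and 4n. -/
theorem measure_accurate_ge [IsProbabilityMeasure P] {ρ : State n} {φ : onbIndex n → ℕ → Core n}
    {g : onbIndex n → HSpace n} {r : onbIndex n → QIdx n → HSpace n}
    {w : onbIndex n → QIdx n → QIdx n → HSpace n} (h : EnergyBound ρ E φ g r w) (hn : 1 ≤ n)
    (hE : 0 ≤ E) (hε : 0 < ε) (hε1 : ε < 1) (hδ : 0 < δ) (hδ1 : δ < 1)
    {X : Copy n E ε δ → S → (Fin n → ℝ)} (hX : ∀ c, Measurable (X c)) (hind : iIndepFun X P)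
    (hlaw : ∀ c, IsBornLaw ρ c.1.observables (P.map (X c))) :
    ENNReal.ofReal (1 - δ) ≤ P {s |
      (∀ k, |estMean (numBins n δ) (fun R j => X (R, j) s) k - ρ.mean k|
        ≤ Real.sqrt ((∑' i, ‖r i k‖ ^ 2 + E / 2) / (2 * accuracyFactor n E ε))) ∧
      ∀ k l, |estSecond (numBins n δ) (fun R j => X (R, j) s) k l
          - ρ.expect (anticomm (quad k) (quad l))|
        ≤ Real.sqrt ((∑' i, ‖w i k l + w i l k‖ ^ 2 + 1 / n) / (2 * accuracyFactor n E ε))} := by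
  have hn' : (1 : ℝ) ≤ n := by exact_mod_cast hn
  have hE' := h.half_le hn hE
  set p : ℝ := δ / (2 * (2 * (n : ℝ) ^ 2 + 3 * n)) with hp
  have hp0 : 0 ≤ p := by positivity
  set G := {s | (∀ k, |estMean (numBins n δ) (fun R j => X (R, j) s) k - ρ.mean k|
        ≤ Real.sqrt ((∑' i, ‖r i k‖ ^ 2 + E / 2) / (2 * accuracyFactor n E ε))) ∧
      ∀ k l, |estSecond (numBins n δ) (fun R j => X (R, j) s) k l
          - ρ.expect (anticomm (quad k) (quad l))|
        ≤ Real.sqrt ((∑' i, ‖w i k l + w i l k‖ ^ 2 + 1 / n) / (2 * accuracyFactor n E ε))}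
    with hG
  set A : QIdx n → Set S := fun k => {s |
    Real.sqrt ((∑' i, ‖r i k‖ ^ 2 + E / 2) / (2 * accuracyFactor n E ε))
      < |estMean (numBins n δ) (fun R j => X (R, j) s) k - ρ.mean k|} with hA
  set B : QIdx n × QIdx n → Set S := fun k => {s |
    Real.sqrt ((∑' i, ‖w i k.1 k.2 + w i k.2 k.1‖ ^ 2 + 1 / n) / (2 * accuracyFactor n E ε))
      < |estSecond (numBins n δ) (fun R j => X (R, j) s) k.1 k.2
          - ρ.expect (anticomm (quad k.1) (quad k.2))|} with hBdef
  have hPA : ∀ k, P (A k) ≤ ENNReal.ofReal p := fun k => by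
    obtain ⟨R, F, hF, hest, hmom⟩ := exists_sampler_mean h k
    have h0 : 0 ≤ ∑' i, ‖r i k‖ ^ 2 := tsum_nonneg fun i => by positivity
    have := measure_estimator_le hn hε hε1 hδ hδ1 hX hind hlaw hF
      (fun μ hμ => (hmom μ hμ).mono (v' := ∑' i, ‖r i k‖ ^ 2 + E / 2) (by linarith))
      (by linarith)
    simpa only [hA, hest] using this
  have hPB : ∀ k, P (B k) ≤ ENNReal.ofReal p := fun k => by
    obtain ⟨R, F, hF, hest, hmom⟩ := exists_sampler_second h k.1 k.2
    have h0 : 0 ≤ ∑' i, ‖w i k.1 k.2 + w i k.2 k.1‖ ^ 2 := tsum_nonneg fun i => by positivity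
    have h1 : (0 : ℝ) < 1 / n := by positivity
    have := measure_estimator_le hn hε hε1 hδ hδ1 hX hind hlaw hF
      (fun μ hμ => (hmom μ hμ).mono
        (v' := ∑' i, ‖w i k.1 k.2 + w i k.2 k.1‖ ^ 2 + 1 / n) (by linarith))
      (by linarith)
    simpa only [hBdef, hest] using this
  have hsub : Gᶜ ⊆ (⋃ k, A k) ∪ ⋃ k, B k := by
    intro s hs
    by_contra hcon
    simp only [Set.mem_union, Set.mem_iUnion, not_or, not_exists] at hcon
    exact hs ⟨fun k => not_lt.1 (hcon.1 k), fun k l => not_lt.1 (hcon.2 (k, l))⟩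
  have hbad : P Gᶜ ≤ ENNReal.ofReal δ := by
    calc P Gᶜ ≤ P (⋃ k, A k) + P (⋃ k, B k) :=
          (measure_mono hsub).trans (measure_union_le _ _)
      _ ≤ ∑ k, P (A k) + ∑ k, P (B k) := add_le_add (measure_iUnion_fintype_le _ _)
          (measure_iUnion_fintype_le _ _)
      _ ≤ ∑ _k : QIdx n, ENNReal.ofReal p + ∑ _k : QIdx n × QIdx n, ENNReal.ofReal p :=
          add_le_add (Finset.sum_le_sum fun k _ => hPA k) (Finset.sum_le_sum fun k _ => hPB k)
      _ = ENNReal.ofReal ((2 * n + 4 * n ^ 2) * p) := by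
          rw [← ENNReal.ofReal_sum_of_nonneg fun _ _ => hp0,
            ← ENNReal.ofReal_sum_of_nonneg fun _ _ => hp0,
            ← ENNReal.ofReal_add (Finset.sum_nonneg fun _ _ => hp0)
              (Finset.sum_nonneg fun _ _ => hp0)]
          congr 1
          simp only [Finset.sum_const, Finset.card_univ, Fintype.card_prod, Fintype.card_fin,
            nsmul_eq_mul]
          push_cast
          ring
      _ ≤ ENNReal.ofReal δ := by
          refine ENNReal.ofReal_le_ofReal ?_
          rw [hp, ← mul_div_assoc, div_le_iff₀ (by positivity)]
          nlinarith
  have h1 : 1 ≤ P G + ENNReal.ofReal δ := by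
    calc (1 : ℝ≥0∞) = P (G ∪ Gᶜ) := by rw [Set.union_compl_self, measure_univ]
      _ ≤ P G + P Gᶜ := measure_union_le _ _
      _ ≤ _ := by gcongr
  rw [ENNReal.ofReal_sub _ hδ.le, ENNReal.ofReal_one]
  exact tsub_le_iff_right.2 h1

theorem sq_le_of_abs_le_sqrt {x y : ℝ} (hy : 0 ≤ y) (h : |x| ≤ Real.sqrt y) : x ^ 2 ≤ y := by
  rw [← sq_abs, ← Real.sq_sqrt hy]
  gcongr

/-- Summing the entrywise squared tolerances turns them into total second moments, bounded by the
energy with no further factor of n. -/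
theorem confidence [IsProbabilityMeasure P] {ρ : State n} {φ : onbIndex n → ℕ → Core n}
    {g : onbIndex n → HSpace n} {r : onbIndex n → QIdx n → HSpace n}
    {w : onbIndex n → QIdx n → QIdx n → HSpace n} (h : EnergyBound ρ E φ g r w) (hn : 1 ≤ n)
    (hE : 0 ≤ E) (hε : 0 < ε) (hε1 : ε < 1) (hδ : 0 < δ) (hδ1 : δ < 1)
    {X : Copy n E ε δ → S → (Fin n → ℝ)} (hX : ∀ c, Measurable (X c)) (hind : iIndepFun X P)
    (hlaw : ∀ c, IsBornLaw ρ c.1.observables (P.map (X c))) :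
    ENNReal.ofReal (1 - δ) ≤
      P {s | ∃ m V, algorithm n E ε δ (fun R j => X (R, j) s) = some (m, V) ∧
        V.IsSymm ∧ opNorm (V - ρ.cov) ≤ ε ∧ Uncertainty V ∧
        ‖m - ρ.mean‖ ≤ ε / (10 * Real.sqrt (8 * E * n))} := by
  refine (measure_accurate_ge h hn hE hε hε1 hδ hδ1 hX hind hlaw).trans (measure_mono ?_)
  rintro s ⟨hm, hW⟩
  have hn' : (1 : ℝ) ≤ n := by exact_mod_cast hn
  have hE' := h.half_le hn hE
  have hT := le_accuracyFactor (E := E) hn hε hε1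
  have hT' : accuracyFactor n E ε * ε ^ 2 = 200 * (8 * (n : ℝ) ^ 2 * E ^ 2 + 3 * n) := by
    rw [accuracyFactor]
    field_simp
  refine algorithm_succeeds h hn hE hε hε1 ?_ ?_
  · have h8 : 0 < 8 * E * n := by positivity
    refine abs_le_of_sq_le_sq' ?_ (by positivity) |>.2
    rw [div_pow, mul_pow, Real.sq_sqrt h8.le, EuclideanSpace.norm_sq_eq]
    calc ∑ k, ‖(estMean (numBins n δ) (fun R j => X (R, j) s) - ρ.mean) k‖ ^ 2
        ≤ ∑ k, (∑' i, ‖r i k‖ ^ 2 + E / 2) / (2 * accuracyFactor n E ε) := by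
          refine Finset.sum_le_sum fun k _ => ?_
          have h0 : 0 ≤ ∑' i, ‖r i k‖ ^ 2 := tsum_nonneg fun i => by positivity
          rw [Real.norm_eq_abs, sq_abs, PiLp.sub_apply]
          exact sq_le_of_abs_le_sqrt (by positivity) (hm k)
      _ ≤ 3 * n * E / (2 * accuracyFactor n E ε) := by
          rw [← Finset.sum_div, Finset.sum_add_distrib]
          gcongr
          have h1 := h.tsum_quad_le_energy hn hE
          simp only [Finset.sum_const, Finset.card_univ, Fintype.card_prod, Fintype.card_fin,
            nsmul_eq_mul]
          push_cast
          linarith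
      _ ≤ ε ^ 2 / (10 ^ 2 * (8 * E * n)) := by
          rw [div_le_div_iff₀ (by positivity) (by positivity)]
          nlinarith [sq_nonneg ((n : ℝ) * E)]
  · calc ∑ k, ∑ l, (estSecond (numBins n δ) (fun R j => X (R, j) s) k l
          - ρ.expect (anticomm (quad k) (quad l))) ^ 2
        ≤ ∑ k, ∑ l, (∑' i, ‖w i k l + w i l k‖ ^ 2 + 1 / n) / (2 * accuracyFactor n E ε) := by
          refine Finset.sum_le_sum fun k _ => Finset.sum_le_sum fun l _ => ?_
          have h0 : 0 ≤ ∑' i, ‖w i k l + w i l k‖ ^ 2 := tsum_nonneg fun i => by positivity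
          exact sq_le_of_abs_le_sqrt (by positivity) (hW k l)
      _ ≤ (16 * (n * E) ^ 2 + 12 * n) / (2 * accuracyFactor n E ε) := by
          simp only [← Finset.sum_div, Finset.sum_add_distrib]
          refine div_le_div_of_nonneg_right ?_ (by positivity)
          have h1 := h.tsum_anticomm_le
          have h2 : (n : ℝ) * 2 * (n * 2 * 1) / n = 4 * n := by field_simp; norm_num
          simp only [Finset.sum_const, Finset.card_univ, Fintype.card_prod, Fintype.card_fin,
            nsmul_eq_mul]
          push_cast
          linarith
      -- The factor 200 is set by this step: (ε/10)² times 2 · `accuracyFactor` equals 32n²E² + 12n.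
      _ ≤ (ε / 10) ^ 2 := by
          rw [div_le_iff₀ (by positivity)]
          nlinarith [sq_nonneg ((n : ℝ) * E)]

end Confidence

end CVTomo

end

theorem mainTheorem12 :
    ∃ C : ℝ, ∀ (n : ℕ) (ε δ E : ℝ) (ρ : CVTomo.State n), 1 ≤ n →
      0 < ε → ε < 1 → 0 < δ → δ < 1 → 0 ≤ E →
      (ρ.secondMoment (CVTomo.energyOp n)) ^ (1 / 2 : ℝ) ≤ ENNReal.ofReal (n * E) →
      -- number of copies
      Nat.card (CVTomo.Copy n E ε δ) = CVTomo.numCopies n E ε δ ∧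
      (2 ≤ n → (CVTomo.numCopies n E ε δ : ℝ)
        ≤ C * (Real.log ((n : ℝ) ^ 2 / δ) * ((n : ℝ) ^ 3 * E ^ 2 / ε ^ 2))) ∧
      -- correctness, for independent outcomes distributed according to the Born rule
      ∀ (S : Type) [MeasurableSpace S] (P : Measure S) [IsProbabilityMeasure P]
        (X : CVTomo.Copy n E ε δ → S → (Fin n → ℝ)),
        (∀ c, Measurable (X c)) → iIndepFun X P →
        (∀ c, CVTomo.IsBornLaw ρ c.1.observables (P.map (X c))) →
        ENNReal.ofReal (1 - δ) ≤
          P {s | ∃ m V, CVTomo.algorithm n E ε δ (fun r l => X (r, l) s) = some (m, V) ∧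
            V.IsSymm ∧ CVTomo.opNorm (V - ρ.cov) ≤ ε ∧ CVTomo.Uncertainty V ∧
            ‖m - ρ.mean‖ ≤ ε / (10 * Real.sqrt (8 * E * n))} := by
  refine ⟨2500000, fun n ε δ E ρ hn hε hε1 hδ hδ1 hE hρ => ?_⟩
  obtain ⟨φ, g, r, w, h⟩ := CVTomo.exists_energyBound ρ hE hρ
  exact ⟨CVTomo.card_copy n E ε δ,
    fun hn2 => CVTomo.numCopies_le hn2 (h.half_le hn hE) hε hε1 hδ hδ1,
    fun S _ P _ X hX hind hlaw => CVTomo.confidence h hn hE hε hε1 hδ hδ1 hX hind hlaw⟩
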